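/- Let $N\ge 2$, let $G=(g_{ij})$ be a nonsingular complex $N\times N$ matrix with $G^t=G$ (then $\mathfrak g_N=\mathfrak o_N$) or $G^t=-G$ (then $\mathfrak g_N=\mathfrak{sp}_N$), and put $\sigma(A)=-G^{-1}A^tG$ for $A\in\mathfrak{gl}_N$. Let $P=\sum_{i,j} e_{ij}\otimes e_{ji}$ and $R(u)=1-\frac hu P$, and let $g(u)\in 1+u^{-1}\mathbb C[[u^{-1}]]$ be the unique series with $g(u+N)=g(u)(1-u^{-2})$; put $\overline R(u)=g(u/h)R(u)$. The double Yangian $\mathrm{DY}(\mathfrak{gl}_N)$ is the associative $\mathbb C[[h]]$-algebra generated by a central element $C$ and elements $t_{ij}^{(\pm r)}$ ($1\le i,j\le N$, $r\ge 1$) subject to $$R(u-v)T_1(u)T_2(v)=T_2(v)T_1(u)R(u-v),\qquad R(u-v)T^+_1(u)T^+_2(v)=T^+_2(v)T^+_1(u)R(u-v),$$ $$\overline R(u-v+hC/2)\,T_1(u)T^+_2(v)=T^+_2(v)T_1(u)\,\overline R(u-v-hC/2),$$ where $T(u)=\sum e_{ij}\otimes t_{ij}(u)$, $T^+(u)=\sum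 e_{ij}\otimes t^+_{ij}(u)$, $t_{ij}(u)=\delta_{ij}+h\sum_{r\ge1}t_{ij}^{(r)}u^{-r}$, $t^+_{ij}(u)=\delta_{ij}-h\sum_{r\ge1}t_{ij}^{(-r)}u^{r-1}$, negative powers of $u-v$ and of $u-v\pm hC/2$ are expanded in negative powers of $u$, and in each coefficient of these relations the common factor $h^2$ is cancelled. The dual Yangian $\mathrm Y^+(\mathfrak{gl}_N)$ is the subalgebra of $\mathrm{DY}(\mathfrak{gl}_N)$ generated by all $t_{ij}^{(-r)}$, $r\ge1$. It carries the ascending filtration $(F_p)_{p\in\mathbb Z}$ given by $\deg t_{ij}^{(-r)}=-r$: $F_p$ is the $\mathbb C[[h]]$-span of the monomials in the $t_{ij}^{(-r)}$ of total degree at most $p$. Let $\mathrm Y^+(\mathfrak g_N)$ be the subalgebra of $\mathrm Y^+(\mathfrak{gl}_N)$ generated by the elements $s_{ij}^{(-r)}$, $r\ge 1$, given by $$T^+(u)\,G\,T^{+t}(-u)=G-h\sum_{r\ge1}s^{(-r)}u^{r-1},\qquad s^{(-r)}=\sum_{i,j}e_{ij}\otimes s_{ij}^{(-r)}$$ (the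 left-hand side is expanded in the $t_{ij}^{(-r)}$ and the factor $h$ is cancelled), with the restricted filtration $F_p\cap \mathrm Y^+(\mathfrak g_N)$. Write $\operatorname{gr}$ for the associated graded algebra $\bigoplus_p F_p/F_{p-1}$, respectively its analogue for $\mathrm Y^+(\mathfrak g_N)$. Let $$(\mathfrak{gl}_N\otimes t^{-1}\mathbb C[t^{-1}])^\sigma=\{A(t)\in\mathfrak{gl}_N\otimes t^{-1}\mathbb C[t^{-1}] : \sigma(A(t))=A(-t)\}.$$ **Proposition.** There is an isomorphism of $\mathbb C[[h]]$-algebras $$\Phi:\operatorname{gr}\mathrm Y^+(\mathfrak{gl}_N)\to U(\mathfrak{gl}_N\otimes t^{-1}\mathbb C[t^{-1}])\otimes_{\mathbb C}\mathbb C[[h]]$$ sending the class of $t_{ij}^{(-r)}$ in degree $-r$ to $e_{ij}\otimes t^{-r}$ for all $i,j$ and $r\ge1$, and $\Phi$ restricts to an isomorphism of $\mathbb C[[h]]$-algebras $$\Psi:\operatorname{gr}\mathrm Y^+(\mathfrak g_N)\to U\big((\mathfrak{gl}_N\otimes t^{-1}\mathbb C[t^{-1}])^\sigma\big)\otimes_{\mathbb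 C}\mathbb C[[h]];$$ that is, $\Psi$ followed by the map induced by the inclusion of Lie algebras equals $\Phi$ applied after the natural map $\operatorname{gr}\mathrm Y^+(\mathfrak g_N)\to\operatorname{gr}\mathrm Y^+(\mathfrak{gl}_N)$. -/

import Mathlib

open scoped PowerSeries TensorProduct DirectSum Kronecker

-- The Lie bracket of an associative ring is the commutator.
attribute [local instance 100] LieRing.ofAssociativeRing

noncomputable section

namespace TwistedYangian

/-! ## Associated graded algebra of an ascending `ℤ`-filtration -/

section AssociatedGraded

variable {R A : Type*} [CommRing R] [Ring A] [Algebra R A]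

/-- The component `F p / F (p - 1)`. -/
abbrev GrPiece (F : ℤ → Submodule R A) (p : ℤ) : Type _ :=
  F p ⧸ (F (p - 1)).submoduleOf (F p)

variable (F : ℤ → Submodule R A)

/-- The image in `F p / F (p - 1)` of an element of `F p`. -/
def grMk (p : ℤ) : F p →ₗ[R] GrPiece F p := Submodule.mkQ _

variable {F}

lemma grMk_eq_zero {p : ℤ} (x : F p) : grMk F p x = 0 ↔ (x : A) ∈ F (p - 1) := by
  rw [grMk, Submodule.mkQ_apply, Submodule.Quotient.mk_eq_zero]
  rfl

lemma gradedMonoid_mk_eq {p q : ℤ} (h : p = q) (x : F p) (y : F q) (hxy : (x : A) = y) :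
    (GradedMonoid.mk p (grMk F p x) : GradedMonoid (GrPiece F)) =
      GradedMonoid.mk q (grMk F q y) := by
  subst h
  rw [Subtype.ext hxy]

lemma grMk_surjective (p : ℤ) : Function.Surjective (grMk F p) := Submodule.mkQ_surjective _

variable [IsRingFiltration F (fun n ↦ F (n - 1))]

/-- The product `F p × F q → F (p + q)`. -/
def filMul (p q : ℤ) : F p →ₗ[R] F q →ₗ[R] F (p + q) :=
  LinearMap.mk₂ R (fun x y ↦ ⟨(x : A) * y, SetLike.mul_mem_graded x.2 y.2⟩)
    (fun _ _ _ ↦ Subtype.ext (add_mul _ _ _)) (fun _ _ _ ↦ Subtype.ext (smul_mul_assoc _ _ _))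
    (fun _ _ _ ↦ Subtype.ext (mul_add _ _ _)) (fun _ _ _ ↦ Subtype.ext (mul_smul_comm _ _ _))

/-- The product `F p / F (p - 1) × F q / F (q - 1) → F (p + q) / F (p + q - 1)`. -/
def grMul (p q : ℤ) : GrPiece F p →ₗ[R] GrPiece F q →ₗ[R] GrPiece F (p + q) :=
  Submodule.liftQ _
    { toFun := fun x ↦ Submodule.liftQ _ (grMk F (p + q) ∘ₗ filMul p q x) (by
        intro y hy
        have hy' : (y : A) ∈ F (q - 1) := hy
        rw [LinearMap.mem_ker, LinearMap.comp_apply, grMk_eq_zero]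
        have := SetLike.mul_mem_graded x.2 hy'
        rwa [← add_sub_assoc] at this)
      map_add' := fun x x' ↦ by
        ext y
        simp
      map_smul' := fun c x ↦ by
        ext y
        simp }
    (by
      intro x hx
      have hx' : (x : A) ∈ F (p - 1) := hx
      rw [LinearMap.mem_ker]
      ext y
      change grMk F (p + q) (filMul p q x y) = 0
      rw [grMk_eq_zero]
      have := SetLike.mul_mem_graded hx' y.2
      rwa [sub_add_eq_add_sub] at this)

lemma grMul_mk {p q : ℤ} (x : F p) (y : F q) :
    grMul p q (grMk F p x) (grMk F q y) =
      grMk F (p + q) ⟨(x : A) * y, SetLike.mul_mem_graded x.2 y.2⟩ := rfl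

instance grGMul : GradedMonoid.GMul (GrPiece F) where
  mul {p q} x y := grMul p q x y

instance grGOne : GradedMonoid.GOne (GrPiece F) where
  one := grMk F 0 ⟨1, SetLike.one_mem_graded F⟩

instance grGSemiring : DirectSum.GSemiring (GrPiece F) where
  mul_zero {p q} x := map_zero (grMul p q x)
  zero_mul {p q} y := by change grMul p q 0 y = 0; simp
  mul_add {p q} x y z := map_add (grMul p q x) y z
  add_mul {p q} x y z := by
    change grMul p q (x + y) z = grMul p q x z + grMul p q y z; simp
  one_mul := by
    rintro ⟨p, x⟩
    obtain ⟨x, rfl⟩ := grMk_surjective p x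
    exact gradedMonoid_mk_eq (zero_add p) _ _ (one_mul _)
  mul_one := by
    rintro ⟨p, x⟩
    obtain ⟨x, rfl⟩ := grMk_surjective p x
    exact gradedMonoid_mk_eq (add_zero p) _ _ (mul_one _)
  mul_assoc := by
    rintro ⟨p, x⟩ ⟨q, y⟩ ⟨r, z⟩
    obtain ⟨x, rfl⟩ := grMk_surjective p x
    obtain ⟨y, rfl⟩ := grMk_surjective q y
    obtain ⟨z, rfl⟩ := grMk_surjective r z
    exact gradedMonoid_mk_eq (add_assoc p q r) _ _ (mul_assoc _ _ _)
  natCast n := n • grMk F 0 ⟨1, SetLike.one_mem_graded F⟩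
  natCast_zero := zero_smul _ _
  natCast_succ n := succ_nsmul _ n

instance grGAlgebra : DirectSum.GAlgebra R (GrPiece F) where
  toFun :=
    { toFun := fun r ↦ r • grMk F 0 ⟨1, SetLike.one_mem_graded F⟩
      map_zero' := zero_smul _ _
      map_add' := fun r s ↦ add_smul r s _ }
  map_one := one_smul _ _
  map_mul r s := by
    refine gradedMonoid_mk_eq (F := F) (zero_add 0).symm
      ((r * s) • ⟨1, SetLike.one_mem_graded F⟩)
      (filMul 0 0 (r • ⟨1, SetLike.one_mem_graded F⟩) (s • ⟨1, SetLike.one_mem_graded F⟩)) ?_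
    simp [filMul, mul_smul, smul_comm r s]
  commutes r := by
    rintro ⟨p, x⟩
    obtain ⟨x, rfl⟩ := grMk_surjective p x
    refine gradedMonoid_mk_eq (F := F) ((zero_add p).trans (add_zero p).symm)
      (filMul 0 p (r • ⟨1, SetLike.one_mem_graded F⟩) x)
      (filMul p 0 x (r • ⟨1, SetLike.one_mem_graded F⟩)) ?_
    simp [filMul]
  smul_def r := by
    rintro ⟨p, x⟩
    obtain ⟨x, rfl⟩ := grMk_surjective p x
    refine gradedMonoid_mk_eq (F := F) (zero_add p).symm (r • x)
      (filMul 0 p (r • ⟨1, SetLike.one_mem_graded F⟩) x) ?_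
    simp [filMul]

variable (F)

/-- The associated graded algebra `⨁ₚ F p / F (p - 1)` of the filtration `F`. -/
abbrev Gr : Type _ := ⨁ p : ℤ, GrPiece F p

/-- The image of `x ∈ F p` in the component of degree `p` of the associated graded algebra. -/
def symbol (p : ℤ) (x : F p) : Gr F := DirectSum.of (GrPiece F) p (grMk F p x)

end AssociatedGraded

/-! ## The normalizing series `g(u)` -/

/-- The expansion of `(u + N)⁻¹` as a power series in the variable `X = u⁻¹`. -/
def shiftInv (N : ℕ) : ℂ⟦X⟧ := PowerSeries.X * (1 + (N : ℂ⟦X⟧) * PowerSeries.X)⁻¹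

/-- The coefficients of `g(u)`; they are the unique solution of `g(u + N) = g(u) (1 - u⁻²)` with
constant term `1`, see `normSeries_spec` and `normSeries_unique`. -/
def normCoeff (N : ℕ) : ℕ → ℂ
  | 0 => 1
  | n + 1 => (normCoeff N n +
      ∑ m : Fin (n + 1), normCoeff N m * PowerSeries.coeff (n + 2) (shiftInv N ^ (m : ℕ))) /
        ((n + 1) * N)

/-- The series `g(u) ∈ 1 + u⁻¹ ℂ[[u⁻¹]]`, as a power series in the variable `X = u⁻¹`. -/
def normSeries (N : ℕ) : ℂ⟦X⟧ := PowerSeries.mk (normCoeff N)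

lemma shiftInv_pow (N m : ℕ) :
    shiftInv N ^ m = PowerSeries.X ^ m * ((1 + (N : ℂ⟦X⟧) * PowerSeries.X)⁻¹) ^ m :=
  mul_pow _ _ _

lemma coeff_shiftInv_pow_of_lt {N m n : ℕ} (h : n < m) :
    PowerSeries.coeff n (shiftInv N ^ m) = 0 := by
  rw [shiftInv_pow, PowerSeries.coeff_X_pow_mul', if_neg (by omega)]

lemma coeff_shiftInv_pow_self (N m : ℕ) : PowerSeries.coeff m (shiftInv N ^ m) = 1 := by
  rw [shiftInv_pow, PowerSeries.coeff_X_pow_mul', if_pos le_rfl]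
  simp

lemma coeff_shiftInv_pow_succ (N m : ℕ) :
    PowerSeries.coeff (m + 1) (shiftInv N ^ m) = -(m * N : ℂ) := by
  rw [shiftInv_pow, PowerSeries.coeff_X_pow_mul', if_pos (by omega), Nat.add_sub_cancel_left]
  have h1 : PowerSeries.coeff 1 ((1 + (N : ℂ⟦X⟧) * PowerSeries.X)⁻¹) = -(N : ℂ) := by
    have h := PowerSeries.mul_inv_cancel (1 + (N : ℂ⟦X⟧) * PowerSeries.X) (by simp)
    have h' := congrArg (PowerSeries.coeff 1) h
    have hN : (N : ℂ⟦X⟧) = PowerSeries.C (N : ℂ) := by simp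
    rw [add_mul, one_mul, map_add, hN, mul_assoc, PowerSeries.coeff_C_mul,
      PowerSeries.coeff_one, PowerSeries.coeff_succ_X_mul] at h'
    simp at h'
    rw [← hN] at *
    simpa using eq_neg_of_add_eq_zero_left h'
  induction m with
  | zero => simp [PowerSeries.coeff_one]
  | succ m ih =>
    rw [pow_succ, PowerSeries.coeff_mul, Finset.Nat.antidiagonal_succ]
    simp [ih, h1]
    ring

lemma coeff_subst_shiftInv (N : ℕ) (f : ℂ⟦X⟧) (n : ℕ) :
    PowerSeries.coeff n (f.subst (shiftInv N)) = ∑ m ∈ Finset.range (n + 1),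
      PowerSeries.coeff m f * PowerSeries.coeff n (shiftInv N ^ m) := by
  rw [PowerSeries.coeff_subst' (PowerSeries.HasSubst.of_constantCoeff_zero' (by simp [shiftInv]))]
  refine finsum_eq_sum_of_support_subset _ fun m hm ↦ ?_
  by_contra h
  simp only [Finset.coe_range, Set.mem_Iio, not_lt] at h
  exact hm (by simp [coeff_shiftInv_pow_of_lt (show n < m by omega)])

lemma coeff_mul_one_sub_sq (f : ℂ⟦X⟧) (n : ℕ) :
    PowerSeries.coeff (n + 2) (f * (1 - PowerSeries.X ^ 2)) =
      PowerSeries.coeff (n + 2) f - PowerSeries.coeff n f := by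
  rw [mul_sub, mul_one, map_sub, PowerSeries.coeff_mul_X_pow]

/-- A series with constant term `1` satisfies `g(u + N) = g(u) (1 - u⁻²)` if and only if its
coefficients satisfy the recursion of `normCoeff`. -/
lemma shift_eq_iff {N : ℕ} (hN : N ≠ 0) (f : ℂ⟦X⟧) :
    f.subst (shiftInv N) = f * (1 - PowerSeries.X ^ 2) ↔
      ∀ n : ℕ, PowerSeries.coeff (n + 1) f = (PowerSeries.coeff n f +
        ∑ m : Fin (n + 1), PowerSeries.coeff m f *
          PowerSeries.coeff (n + 2) (shiftInv N ^ (m : ℕ))) / ((n + 1) * N) := by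
  have hN' : (N : ℂ) ≠ 0 := by exact_mod_cast hN
  have key : ∀ n : ℕ, (PowerSeries.coeff (n + 2) (f.subst (shiftInv N)) =
      PowerSeries.coeff (n + 2) (f * (1 - PowerSeries.X ^ 2)) ↔
        PowerSeries.coeff (n + 1) f = (PowerSeries.coeff n f +
          ∑ m : Fin (n + 1), PowerSeries.coeff m f *
            PowerSeries.coeff (n + 2) (shiftInv N ^ (m : ℕ))) / ((n + 1) * N)) := by
    intro n
    have hn : ((n : ℂ) + 1) ≠ 0 := by exact_mod_cast n.succ_ne_zero
    rw [coeff_subst_shiftInv, coeff_mul_one_sub_sq, Finset.sum_range_succ, Finset.sum_range_succ,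
      coeff_shiftInv_pow_self, coeff_shiftInv_pow_succ, eq_div_iff (mul_ne_zero hn hN'),
      Finset.sum_range]
    push_cast
    constructor <;> intro h <;> linear_combination -h
  constructor
  · intro h n
    exact (key n).1 (by rw [h])
  · intro h
    ext n
    match n with
    | 0 => simp [coeff_subst_shiftInv]
    | 1 =>
      rw [coeff_subst_shiftInv, Finset.sum_range_succ, Finset.sum_range_one,
        coeff_shiftInv_pow_self, mul_sub, mul_one, map_sub, PowerSeries.coeff_mul_X_pow']
      simp [PowerSeries.coeff_one]
    | n + 2 => exact (key n).2 (h n)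

theorem normSeries_spec {N : ℕ} (hN : N ≠ 0) :
    PowerSeries.constantCoeff (normSeries N) = 1 ∧
      (normSeries N).subst (shiftInv N) = normSeries N * (1 - PowerSeries.X ^ 2) := by
  constructor
  · rw [← PowerSeries.coeff_zero_eq_constantCoeff_apply, normSeries, PowerSeries.coeff_mk,
      normCoeff]
  · rw [shift_eq_iff hN]
    intro n
    simp only [normSeries, PowerSeries.coeff_mk]
    rw [normCoeff]

theorem normSeries_unique {N : ℕ} (hN : N ≠ 0) (f : ℂ⟦X⟧)
    (h0 : PowerSeries.constantCoeff f = 1)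
    (h : f.subst (shiftInv N) = f * (1 - PowerSeries.X ^ 2)) : f = normSeries N := by
  rw [shift_eq_iff hN] at h
  ext n
  simp only [normSeries, PowerSeries.coeff_mk]
  induction n using Nat.strong_induction_on with
  | _ n ih =>
    cases n with
    | zero => rw [PowerSeries.coeff_zero_eq_constantCoeff_apply, h0, normCoeff]
    | succ n =>
      rw [h n, normCoeff, ih n (by omega)]
      congr 2
      exact Finset.sum_congr rfl fun m _ ↦ by rw [ih m (by omega)]

/-! ## The double Yangian, over the base ring `ℂ[[h]]` -/

section Series

variable {A : Type*} [Ring A] [Algebra ℂ⟦X⟧ A] {N : ℕ}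

variable (A) in
/-- The formal parameter `h` in a `ℂ[[h]]`-algebra. -/
def hbar : A := algebraMap ℂ⟦X⟧ A PowerSeries.X

variable (A) in
/-- A complex number in a `ℂ[[h]]`-algebra. -/
def scal (c : ℂ) : A := algebraMap ℂ⟦X⟧ A (PowerSeries.C c)

/-- `T(u)`, as a matrix of power series in `u⁻¹`, with `t i j r` standing for `t_ij^(r)`:
the `(i, j)` entry is `δ_ij + h ∑_{r ≥ 1} t_ij^(r) u^(-r)`. -/
def tMatrix (t : Fin N → Fin N → ℕ+ → A) : Matrix (Fin N) (Fin N) A⟦X⟧ :=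
  Matrix.of fun i j ↦ (1 : Matrix (Fin N) (Fin N) A⟦X⟧) i j +
    PowerSeries.C (hbar A) * (PowerSeries.X * PowerSeries.mk fun m ↦ t i j m.succPNat)

/-- `T⁺(u)`, as a matrix of power series in `u`, with `t i j r` standing for `t_ij^(-r)`:
the `(i, j)` entry is `δ_ij - h ∑_{r ≥ 1} t_ij^(-r) u^(r-1)`. -/
def tPlusMatrix (t : Fin N → Fin N → ℕ+ → A) : Matrix (Fin N) (Fin N) A⟦X⟧ :=
  Matrix.of fun i j ↦ (1 : Matrix (Fin N) (Fin N) A⟦X⟧) i j -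
    PowerSeries.C (hbar A) * PowerSeries.mk fun m ↦ t i j m.succPNat

variable (A) in
/-- Series in two variables: power series in an outer variable whose coefficients are Laurent
series in an inner variable. An expression in `u, v` expanded in negative powers of `u` lives in
this ring for a suitable choice of the two variables among `u, v, u⁻¹, v⁻¹`. -/
abbrev Ser : Type _ := PowerSeries (LaurentSeries A)

/-- A series in the inner variable. -/
def innerSer : A⟦X⟧ →+* Ser A := PowerSeries.C.comp (HahnSeries.ofPowerSeries ℤ A)

/-- A series in the outer variable. -/
def outerSer : A⟦X⟧ →+* Ser A := PowerSeries.map HahnSeries.C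

/-- A constant series. -/
def constSer : A →+* Ser A := PowerSeries.C.comp HahnSeries.C

/-- The permutation operator `P = ∑ e_ij ⊗ e_ji` on `ℂ^N ⊗ ℂ^N`. -/
def permMatrix (B : Type*) [Ring B] (N : ℕ) : Matrix (Fin N × Fin N) (Fin N × Fin N) B :=
  ∑ i : Fin N, ∑ j : Fin N, Matrix.single i j 1 ⊗ₖ Matrix.single j i 1

variable (N) in
/-- The Yang `R`-matrix `R(z) = 1 - (h / z) P`, where `w` is the expansion of `z⁻¹`. -/
def rMatrix (w : Ser A) : Matrix (Fin N × Fin N) (Fin N × Fin N) (Ser A) :=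
  1 - (constSer (hbar A) * w) • permMatrix (Ser A) N

variable (N) in
/-- The series `g(z / h)`, where `w`, divisible by the outer variable, is the expansion of `z⁻¹`.
Then `(h w) ^ m` is divisible by the `m`-th power of the outer variable, so that each coefficient
of `∑ₘ gₘ (h w) ^ m` is a finite sum. -/
def normEval (w : Ser A) : Ser A :=
  PowerSeries.mk fun k ↦ ∑ m ∈ Finset.range (k + 1), PowerSeries.coeff k
    (constSer (scal A (PowerSeries.coeff m (normSeries N))) * (constSer (hbar A) * w) ^ m)

variable (N) in
/-- The normalized `R`-matrix `g(z / h) R(z)`, where `w`, divisible by the outer variable, is the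
expansion of `z⁻¹`. -/
def rBarMatrix (w : Ser A) : Matrix (Fin N × Fin N) (Fin N × Fin N) (Ser A) :=
  normEval N w • rMatrix N w

/-- `M₁ = M ⊗ 1`, with the matrix `M` acting on the first tensor factor. -/
def leg1 {B : Type*} [Ring B] (M : Matrix (Fin N) (Fin N) B) :
    Matrix (Fin N × Fin N) (Fin N × Fin N) B := M ⊗ₖ (1 : Matrix (Fin N) (Fin N) B)

/-- `M₂ = 1 ⊗ M`, with the matrix `M` acting on the second tensor factor. -/
def leg2 {B : Type*} [Ring B] (M : Matrix (Fin N) (Fin N) B) :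
    Matrix (Fin N × Fin N) (Fin N × Fin N) B := (1 : Matrix (Fin N) (Fin N) B) ⊗ₖ M

/-- `R(u - v) T₁(u) T₂(v) - T₂(v) T₁(u) R(u - v)`. The outer variable is `u⁻¹`, the inner
variable is `v⁻¹`, and `(u - v)⁻¹ = ∑_{l ≥ 0} u^(-l-1) v^l`. -/
def rttYangian (t : Fin N → Fin N → ℕ+ → A) :
    Matrix (Fin N × Fin N) (Fin N × Fin N) (Ser A) :=
  let w : Ser A := PowerSeries.X * PowerSeries.mk fun l ↦ HahnSeries.single (-(l : ℤ)) 1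
  let T₁ := leg1 ((tMatrix t).map outerSer)
  let T₂ := leg2 ((tMatrix t).map innerSer)
  rMatrix N w * T₁ * T₂ - T₂ * T₁ * rMatrix N w

/-- `R(u - v) T⁺₁(u) T⁺₂(v) - T⁺₂(v) T⁺₁(u) R(u - v)`. The outer variable is `v`, the inner
variable is `u`, and `(u - v)⁻¹ = ∑_{l ≥ 0} u^(-l-1) v^l`. -/
def rttDual (t : Fin N → Fin N → ℕ+ → A) :
    Matrix (Fin N × Fin N) (Fin N × Fin N) (Ser A) :=
  let w : Ser A := PowerSeries.mk fun l ↦ HahnSeries.single (-(l : ℤ) - 1) 1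
  let T₁ := leg1 ((tPlusMatrix t).map innerSer)
  let T₂ := leg2 ((tPlusMatrix t).map outerSer)
  rMatrix N w * T₁ * T₂ - T₂ * T₁ * rMatrix N w

/-- The expansion `(u - a)⁻¹ = ∑_{l ≥ 0} u^(-l-1) a^l` for a polynomial `a` in `v`, where the
outer variable is `u⁻¹` and the inner variable is `v`. -/
def geomInv (a : LaurentSeries A) : Ser A := PowerSeries.X * PowerSeries.mk fun l ↦ a ^ l

/-- `R̄(u - v + hC/2) T₁(u) T⁺₂(v) - T⁺₂(v) T₁(u) R̄(u - v - hC/2)`. The outer variable is `u⁻¹`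
and the inner variable is `v`. -/
def rttMixed (C : A) (t t' : Fin N → Fin N → ℕ+ → A) :
    Matrix (Fin N × Fin N) (Fin N × Fin N) (Ser A) :=
  let v : LaurentSeries A := HahnSeries.single 1 1
  let c : LaurentSeries A := HahnSeries.C (hbar A * scal A (1 / 2) * C)
  let T₁ := leg1 ((tMatrix t).map outerSer)
  let T₂ := leg2 ((tPlusMatrix t').map innerSer)
  rBarMatrix N (geomInv (v - c)) * T₁ * T₂ - T₂ * T₁ * rBarMatrix N (geomInv (v + c))

/-- The coefficients of all entries of a matrix of series. -/
def coeffSet (M : Matrix (Fin N × Fin N) (Fin N × Fin N) (Ser A)) : Set A :=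
  {a | ∃ p q, ∃ (n : ℕ) (m : ℤ), a = HahnSeries.coeff (PowerSeries.coeff n (M p q)) m}

end Series

/-- The generators of the double Yangian: `t i j r` is `t_ij^(r)` and `tMinus i j r` is
`t_ij^(-r)`, where `r ≥ 1`. -/
inductive DYGen (N : ℕ) : Type
  | C : DYGen N
  | t (i j : Fin N) (r : ℕ+) : DYGen N
  | tMinus (i j : Fin N) (r : ℕ+) : DYGen N

/-- The free associative `ℂ[[h]]`-algebra on the generators of the double Yangian. -/
abbrev FreeDY (N : ℕ) : Type := FreeAlgebra ℂ⟦X⟧ (DYGen N)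

/-- The coefficients of the three `RTT` relations, in the free algebra. -/
def rttCoeffs (N : ℕ) : Set (FreeDY N) :=
  let ι : DYGen N → FreeDY N := FreeAlgebra.ι ℂ⟦X⟧
  let t : Fin N → Fin N → ℕ+ → FreeDY N := fun i j r ↦ ι (.t i j r)
  let t' : Fin N → Fin N → ℕ+ → FreeDY N := fun i j r ↦ ι (.tMinus i j r)
  coeffSet (rttYangian t) ∪ coeffSet (rttDual t') ∪ coeffSet (rttMixed (ι .C) t t')

/-- The defining relations of the double Yangian. As the generators enter `T(u) - 1` and
`T⁺(u) - 1` with the factor `h`, each coefficient of the `RTT` relations is `h²` times an element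
`y` of the (torsion-free) free algebra; the relations imposed are `y = 0`. -/
inductive DYRel (N : ℕ) : FreeDY N → FreeDY N → Prop
  | central (x : DYGen N) :
      DYRel N (FreeAlgebra.ι ℂ⟦X⟧ .C * FreeAlgebra.ι ℂ⟦X⟧ x)
        (FreeAlgebra.ι ℂ⟦X⟧ x * FreeAlgebra.ι ℂ⟦X⟧ .C)
  | rtt (y : FreeDY N) (hy : hbar (FreeDY N) ^ 2 * y ∈ rttCoeffs N) : DYRel N y 0

/-- The double Yangian `DY(gl_N)`. -/
def DoubleYangian (N : ℕ) : Type := RingQuot (DYRel N)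

instance (N : ℕ) : Ring (DoubleYangian N) := inferInstanceAs (Ring (RingQuot (DYRel N)))

instance (N : ℕ) : Algebra ℂ⟦X⟧ (DoubleYangian N) :=
  inferInstanceAs (Algebra ℂ⟦X⟧ (RingQuot (DYRel N)))

/-- The quotient map from the free algebra to the double Yangian. -/
def toDY (N : ℕ) : FreeDY N →ₐ[ℂ⟦X⟧] DoubleYangian N := RingQuot.mkAlgHom ℂ⟦X⟧ (DYRel N)

/-- The element `t_ij^(-r)` of the double Yangian. -/
def dyMinus {N : ℕ} (i j : Fin N) (r : ℕ+) : DoubleYangian N :=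
  toDY N (FreeAlgebra.ι ℂ⟦X⟧ (.tMinus i j r))

/-- The dual Yangian `Y⁺(gl_N)` as a subalgebra of the double Yangian: it is generated by all
`t_ij^(-r)`. -/
def dualYangian (N : ℕ) : Subalgebra ℂ⟦X⟧ (DoubleYangian N) :=
  Algebra.adjoin ℂ⟦X⟧ {x | ∃ i j r, x = dyMinus i j r}

/-- The dual Yangian `Y⁺(gl_N)` as an algebra. -/
def DualYangian (N : ℕ) : Type := dualYangian N

instance (N : ℕ) : Ring (DualYangian N) := inferInstanceAs (Ring (dualYangian N))

instance (N : ℕ) : Algebra ℂ⟦X⟧ (DualYangian N) := inferInstanceAs (Algebra ℂ⟦X⟧ (dualYangian N))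

/-- The element `t_ij^(-r)` of the dual Yangian. -/
def tMinus {N : ℕ} (i j : Fin N) (r : ℕ+) : DualYangian N :=
  (⟨dyMinus i j r, Algebra.subset_adjoin ⟨i, j, r, rfl⟩⟩ : dualYangian N)

/-! ## The filtration on the dual Yangian given by `deg t_ij^(-r) = -r` -/

/-- The monomial in the elements `t_ij^(-r)` given by a list of triples `(i, j, r)`. -/
def monomialMinus {N : ℕ} (l : List (Fin N × Fin N × ℕ+)) : DualYangian N :=
  (l.map fun g ↦ tMinus g.1 g.2.1 g.2.2).prod

/-- The degree of `monomialMinus l`. -/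
def monomialDeg {N : ℕ} (l : List (Fin N × Fin N × ℕ+)) : ℤ :=
  (l.map fun g ↦ -((g.2.2 : ℕ) : ℤ)).sum

/-- `degFiltration N p` is the span of the monomials of degree at most `p`. -/
def degFiltration (N : ℕ) (p : ℤ) : Submodule ℂ⟦X⟧ (DualYangian N) :=
  Submodule.span ℂ⟦X⟧ {x | ∃ l, monomialDeg l ≤ p ∧ x = monomialMinus l}

lemma degFiltration_mono (N : ℕ) : Monotone (degFiltration N) := fun _ _ hpq ↦
  Submodule.span_mono fun _ ⟨l, hl, hx⟩ ↦ ⟨l, hl.trans hpq, hx⟩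

instance degFiltration_gradedMonoid (N : ℕ) : SetLike.GradedMonoid (degFiltration N) where
  one_mem := Submodule.subset_span ⟨[], by simp [monomialDeg], by simp [monomialMinus]⟩
  mul_mem p q x y hx hy := by
    have h := Submodule.mul_mem_mul hx hy
    rw [degFiltration, degFiltration, Submodule.span_mul_span] at h
    refine Submodule.span_mono ?_ h
    rintro _ ⟨_, ⟨l, hl, rfl⟩, _, ⟨l', hl', rfl⟩, rfl⟩
    refine ⟨l ++ l', ?_, by simp [monomialMinus]⟩
    simp only [monomialDeg, List.map_append, List.sum_append] at hl hl' ⊢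
    exact add_le_add hl hl'

instance degFiltration_isRingFiltration (N : ℕ) :
    IsRingFiltration (degFiltration N) (fun n ↦ degFiltration N (n - 1)) :=
  IsRingFiltration.mk_int _ (degFiltration_mono N)

lemma tMinus_mem {N : ℕ} (i j : Fin N) (r : ℕ+) :
    tMinus i j r ∈ degFiltration N (-((r : ℕ) : ℤ)) :=
  Submodule.subset_span ⟨[(i, j, r)], by simp [monomialDeg], by simp [monomialMinus]⟩

/-! ## The subalgebra `Y⁺(g_N)` -/

section Sklyanin

variable {A : Type*} [Ring A] [Algebra ℂ⟦X⟧ A] {N : ℕ}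

/-- A complex matrix as a matrix of constant power series over a `ℂ[[h]]`-algebra. -/
def constMatrix (G : Matrix (Fin N) (Fin N) ℂ) : Matrix (Fin N) (Fin N) A⟦X⟧ :=
  G.map fun c ↦ PowerSeries.C (scal A c)

/-- `f(-u)` for a power series `f(u)`. -/
def negVar (f : A⟦X⟧) : A⟦X⟧ := PowerSeries.mk fun m ↦ (-1) ^ m * PowerSeries.coeff m f

/-- The series `S⁺(u) = T⁺(u) G T⁺ᵗ(-u)`. -/
def sPlusMatrix (G : Matrix (Fin N) (Fin N) ℂ) (t : Fin N → Fin N → ℕ+ → A) :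
    Matrix (Fin N) (Fin N) A⟦X⟧ :=
  tPlusMatrix t * constMatrix G * ((tPlusMatrix t).map negVar).transpose

/-- The series `τ(u)` with `T⁺(u) = 1 - h τ(u)`. -/
def tauMatrix (t : Fin N → Fin N → ℕ+ → A) : Matrix (Fin N) (Fin N) A⟦X⟧ :=
  Matrix.of fun i j ↦ PowerSeries.mk fun m ↦ t i j m.succPNat

/-- The series `∑_{r ≥ 1} s_ij^(-r) u^(r-1)`, obtained from `S⁺(u) = G - h ∑_{r ≥ 1} s^(-r) u^(r-1)`
on expanding `S⁺(u) = (1 - h τ(u)) G (1 - h τᵗ(-u))` and cancelling `h`;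
see `sPlusMatrix_eq`. -/
def sSeries (G : Matrix (Fin N) (Fin N) ℂ) (t : Fin N → Fin N → ℕ+ → A) :
    Matrix (Fin N) (Fin N) A⟦X⟧ :=
  tauMatrix t * constMatrix G + constMatrix G * ((tauMatrix t).map negVar).transpose -
    PowerSeries.C (hbar A) •
      (tauMatrix t * constMatrix G * ((tauMatrix t).map negVar).transpose)

theorem sPlusMatrix_eq (G : Matrix (Fin N) (Fin N) ℂ) (t : Fin N → Fin N → ℕ+ → A) :
    sPlusMatrix G t = constMatrix G - PowerSeries.C (hbar A) • sSeries G t := by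
  have hc : ∀ f : A⟦X⟧, f * PowerSeries.C (hbar A) = PowerSeries.C (hbar A) * f := by
    intro f
    ext n
    rw [PowerSeries.coeff_mul_C, PowerSeries.coeff_C_mul]
    exact (Algebra.commutes _ _).symm
  have h1 : tPlusMatrix t = 1 - PowerSeries.C (hbar A) • tauMatrix t := by
    ext i j
    simp [tPlusMatrix, tauMatrix]
  have h2 : ((tPlusMatrix t).map negVar).transpose =
      1 - PowerSeries.C (hbar A) • ((tauMatrix t).map negVar).transpose := by
    ext i j n
    have hh : ∀ a : A, (-1) ^ n * (hbar A * a) = hbar A * ((-1) ^ n * a) := fun a ↦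
      Algebra.left_comm _ _ _
    by_cases hij : j = i
    · subst hij
      by_cases hn : n = 0 <;>
        simp [tPlusMatrix, tauMatrix, negVar, PowerSeries.coeff_one, mul_sub, hh, hn]
    · simp [tPlusMatrix, tauMatrix, negVar, Matrix.one_apply, hij, Ne.symm hij, hh]
  have hs : ∀ M M' : Matrix (Fin N) (Fin N) A⟦X⟧,
      M * (PowerSeries.C (hbar A) • M') = PowerSeries.C (hbar A) • (M * M') := by
    intro M M'
    ext1 i j
    simp only [Matrix.mul_apply, Matrix.smul_apply, smul_eq_mul, Finset.mul_sum]
    exact Finset.sum_congr rfl fun k _ ↦ by rw [← mul_assoc, hc, mul_assoc]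
  rw [sPlusMatrix, h2, h1, sSeries]
  simp only [sub_mul, mul_sub, one_mul, mul_one, hs, smul_mul_assoc, smul_sub, smul_add]
  abel

end Sklyanin

/-- The element `s_ij^(-r)` of the dual Yangian. -/
def sMinus {N : ℕ} (G : Matrix (Fin N) (Fin N) ℂ) (i j : Fin N) (r : ℕ+) : DualYangian N :=
  PowerSeries.coeff r.natPred (sSeries G tMinus i j)

/-- The subalgebra `Y⁺(g_N)` of the dual Yangian generated by all `s_ij^(-r)`. -/
def twistedDual {N : ℕ} (G : Matrix (Fin N) (Fin N) ℂ) : Subalgebra ℂ⟦X⟧ (DualYangian N) :=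
  Algebra.adjoin ℂ⟦X⟧ {x | ∃ i j r, x = sMinus G i j r}

/-- `Y⁺(g_N)` as an algebra. -/
def TwistedDual {N : ℕ} (G : Matrix (Fin N) (Fin N) ℂ) : Type := twistedDual G

instance {N : ℕ} (G : Matrix (Fin N) (Fin N) ℂ) : Ring (TwistedDual G) :=
  inferInstanceAs (Ring (twistedDual G))

instance {N : ℕ} (G : Matrix (Fin N) (Fin N) ℂ) : Algebra ℂ⟦X⟧ (TwistedDual G) :=
  inferInstanceAs (Algebra ℂ⟦X⟧ (twistedDual G))

/-- The inclusion of `Y⁺(g_N)` into the dual Yangian. -/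
def TwistedDual.val {N : ℕ} (G : Matrix (Fin N) (Fin N) ℂ) :
    TwistedDual G →ₐ[ℂ⟦X⟧] DualYangian N := (twistedDual G).val

/-- The restriction of the degree filtration to `Y⁺(g_N)`. -/
def twistedFiltration {N : ℕ} (G : Matrix (Fin N) (Fin N) ℂ) (p : ℤ) :
    Submodule ℂ⟦X⟧ (TwistedDual G) :=
  (degFiltration N p).comap (TwistedDual.val G).toLinearMap

lemma twistedFiltration_mono {N : ℕ} (G : Matrix (Fin N) (Fin N) ℂ) :
    Monotone (twistedFiltration G) := fun _ _ hpq _ hx ↦ degFiltration_mono N hpq hx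

instance twistedFiltration_gradedMonoid {N : ℕ} (G : Matrix (Fin N) (Fin N) ℂ) :
    SetLike.GradedMonoid (twistedFiltration G) where
  one_mem := SetLike.one_mem_graded (degFiltration N)
  mul_mem _ _ _ _ hx hy := SetLike.mul_mem_graded (A := degFiltration N) hx hy

instance twistedFiltration_isRingFiltration {N : ℕ} (G : Matrix (Fin N) (Fin N) ℂ) :
    IsRingFiltration (twistedFiltration G) (fun n ↦ twistedFiltration G (n - 1)) :=
  IsRingFiltration.mk_int _ (twistedFiltration_mono G)

/-- The inclusion of `F p ∩ Y⁺(g_N)` into `F p`. -/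
def filInclusion {N : ℕ} (G : Matrix (Fin N) (Fin N) ℂ) (p : ℤ) (x : twistedFiltration G p) :
    degFiltration N p := ⟨TwistedDual.val G x, x.2⟩

/-! ## The current Lie algebras -/

open Polynomial in
/-- The Lie algebra `gl_N ⊗ t⁻¹ℂ[t⁻¹]`: polynomials in `X = t⁻¹` with matrix coefficients and zero
constant term. The coefficient of `X ^ r` is the coefficient of `t^(-r)`. -/
def current (N : ℕ) : LieSubalgebra ℂ (Matrix (Fin N) (Fin N) ℂ)[X] where
  carrier := {a | a.coeff 0 = 0}
  zero_mem' := by simp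
  add_mem' ha hb := by simp_all
  smul_mem' c a ha := by simp_all
  lie_mem' {a b} ha hb := by simp_all [Ring.lie_def, Polynomial.mul_coeff_zero]

/-- The element `A ⊗ t^(-r)`. -/
def current.single {N : ℕ} (A : Matrix (Fin N) (Fin N) ℂ) (r : ℕ+) : current N :=
  ⟨Polynomial.monomial r A, by
    change (Polynomial.monomial r A).coeff 0 = 0
    rw [Polynomial.coeff_monomial, if_neg r.ne_zero]⟩

/-- The automorphism `σ(A) = -G⁻¹ Aᵗ G` of `gl_N`. -/
def sigma {N : ℕ} (G : GL (Fin N) ℂ) : Matrix (Fin N) (Fin N) ℂ ≃ₗ⁅ℂ⁆ Matrix (Fin N) (Fin N) ℂ where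
  toFun A := -((G⁻¹ : GL (Fin N) ℂ) * A.transpose * G : Matrix (Fin N) (Fin N) ℂ)
  invFun A := -((G : Matrix (Fin N) (Fin N) ℂ) * A * (G⁻¹ : GL (Fin N) ℂ)).transpose
  map_add' A B := by simp [mul_add, add_mul, add_comm]
  map_smul' c A := by simp
  map_lie' := by
    intro A B
    simp [Ring.lie_def, Matrix.transpose_sub, Matrix.transpose_mul, mul_sub, sub_mul, mul_assoc]
  left_inv A := by simp [mul_assoc]
  right_inv A := by simp [mul_assoc]

lemma coeff_lie {N : ℕ} (a b : Polynomial (Matrix (Fin N) (Fin N) ℂ)) (r : ℕ) :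
    (⁅a, b⁆).coeff r = ∑ x ∈ Finset.HasAntidiagonal.antidiagonal r, ⁅a.coeff x.1, b.coeff x.2⁆ := by
  simp only [Ring.lie_def, Polynomial.coeff_sub, Polynomial.coeff_mul, Finset.sum_sub_distrib]
  congr 1
  exact (Finset.Nat.sum_antidiagonal_swap (f := fun x ↦ b.coeff x.1 * a.coeff x.2)).symm

/-- The twisted current Lie algebra `(gl_N ⊗ t⁻¹ℂ[t⁻¹])^σ = {A(t) : σ(A(t)) = A(-t)}`. -/
def twistedCurrent {N : ℕ} (G : GL (Fin N) ℂ) : LieSubalgebra ℂ (current N) where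
  carrier := {a | ∀ r : ℕ, sigma G ((a : Polynomial (Matrix (Fin N) (Fin N) ℂ)).coeff r) =
    (-1 : ℂ) ^ r • (a : Polynomial (Matrix (Fin N) (Fin N) ℂ)).coeff r}
  zero_mem' := by simp
  add_mem' ha hb r := by simp [ha r, hb r]
  smul_mem' c a ha r := by simp [ha r, smul_comm c]
  lie_mem' {a b} ha hb r := by
    change sigma G ((⁅(a : Polynomial (Matrix (Fin N) (Fin N) ℂ)), (b : Polynomial _)⁆).coeff r) =
      (-1 : ℂ) ^ r • (⁅(a : Polynomial (Matrix (Fin N) (Fin N) ℂ)), (b : Polynomial _)⁆).coeff r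
    rw [coeff_lie, map_sum, Finset.smul_sum]
    refine Finset.sum_congr rfl fun x hx ↦ ?_
    rw [LieEquiv.map_lie, ha x.1, hb x.2, ← Finset.HasAntidiagonal.mem_antidiagonal.1 hx, smul_lie, lie_smul,
      smul_smul, pow_add]

/-- The map `U((gl_N ⊗ t⁻¹ℂ[t⁻¹])^σ) ⊗ ℂ[[h]] → U(gl_N ⊗ t⁻¹ℂ[t⁻¹]) ⊗ ℂ[[h]]` induced by the
inclusion of Lie algebras. -/
def envInclusion {N : ℕ} (G : GL (Fin N) ℂ) :
    ℂ⟦X⟧ ⊗[ℂ] UniversalEnvelopingAlgebra ℂ (twistedCurrent G) →ₐ[ℂ⟦X⟧]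
      ℂ⟦X⟧ ⊗[ℂ] UniversalEnvelopingAlgebra ℂ (current N) :=
  Algebra.TensorProduct.map (AlgHom.id ℂ⟦X⟧ ℂ⟦X⟧)
    (UniversalEnvelopingAlgebra.lift ℂ
      ((UniversalEnvelopingAlgebra.ι ℂ).comp (twistedCurrent G).incl))

end TwistedYangian

end

open TwistedYangian

/-! Untwisted part. The relation `R T⁺₁ T⁺₂ = T⁺₂ T⁺₁ R`, with `h²` cancelled, says that
`[t_ij^(-m), t_kl^(-n)]` equals `δ_kj t_il^(-m-n) - δ_il t_kj^(-m-n)` up to products of total degree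
`-m-n-1` (`tMinus_commutator_mem`). So `e_ij ⊗ t^(-r)` goes to the symbol of `t_ij^(-r)` under a
homomorphism `currentLift` from `U ⊗ ℂ[[h]]` to the associated graded algebra, and it is onto
because symbols of generators generate.

Injectivity requires enough representations of the double Yangian, which could a priori collapse. At
zero central charge these are tensor products of evaluation representations `T(u) = 1 + h (u - a)⁻¹
E`, expanded at `u = ∞` for `T` and at `u = 0` for `T⁺`. With `a⁻¹ = T s` for two formal variables,
`t_ij^(-r)` has order at least `r` in `T`, and taking coefficients of `T^r` gives a representation
of the graded algebra (`GradedRep.grHom`). One more tensor factor changes leading coefficients by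
the coproduct of `U` followed by `e_ij ⊗ t^(-r) ↦ s^r e_ij` (`GradedRep.lead_extend`). Hence the
common kernel of all these representations on `U ⊗ ℂ[[h]]` is stable under this coproduct and
contains no nonzero scalar. Such a submodule is zero: the reduced coproduct followed by a
contraction is an Euler operator, acting as `n` on the `n`-th layer of the standard filtration
(`CoproductData.red_mem`, `CoproductData.eq_zero_of_stable`). The Poincaré-Birkhoff-Witt theorem is
not used. The same argument shows that `envIncl` is injective.

Twisted part. The graded algebra has no `h`-torsion, so the degree filtration is saturated: `h x ∈
F_p` implies `x ∈ F_p` (`mem_of_hbar_mul_mem`). The reflection equation and the symmetry relation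
for the `s_ij^(-r)` are derived only after multiplication by `h²` and `h`; by saturation they hold
modulo the intersection of all `F_q`. Let `genFiltration` be spanned by the monomials in the
`s_ij^(-r)` of bounded degree together with this intersection. The reflection equation makes a
commutator of generators linear in the generators up to lower degree; which linear combination
occurs is read off in the graded algebra of `Y⁺(gl_N)`, where the leading terms of the `s_ij^(-r)`
are known (`twistedLin_commutator_mem`). This gives a surjection from `U ⊗ ℂ[[h]]` of the twisted
current algebra onto the graded algebra of `genFiltration`. Followed by the natural map to the
graded algebra of `Y⁺(gl_N)` it is `currentLift ∘ envIncl`, which is injective. Therefore the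
surjection is an isomorphism and the natural map is injective, and the latter forces `genFiltration`
to be the restricted filtration (`genFiltration_eq_of_injective`). -/

noncomputable section

namespace TwistedYangian

/-! ### The ternary relation with a central parameter, and its evaluation solutions -/

section RTT

variable {S : Type*} [Ring S] {N : ℕ}

lemma permMatrix_apply (p q : Fin N × Fin N) :
    permMatrix S N p q = if p.1 = q.2 ∧ p.2 = q.1 then 1 else 0 := by
  obtain ⟨a, b⟩ := p
  obtain ⟨c, d⟩ := q
  simp only [permMatrix, Matrix.sum_apply, Matrix.kroneckerMap_apply, Matrix.single_apply]
  rw [Finset.sum_eq_single a, Finset.sum_eq_single b]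
  · by_cases h1 : a = d <;> by_cases h2 : b = c <;> simp [h1, h2]
  · intro j _ hj
    simp [hj]
  · simp
  · intro i _ hi
    exact Finset.sum_eq_zero fun j _ ↦ by simp [hi]
  · simp

lemma permMatrix_mul_apply (M : Matrix (Fin N × Fin N) (Fin N × Fin N) S) (i k : Fin N)
    (q : Fin N × Fin N) : (permMatrix S N * M) (i, k) q = M (k, i) q := by
  rw [Matrix.mul_apply, Finset.sum_eq_single (k, i)]
  · simp [permMatrix_apply]
  · rintro ⟨a, b⟩ - h
    rw [permMatrix_apply, if_neg, zero_mul]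
    rintro ⟨h1, h2⟩
    exact h (Prod.ext h2.symm h1.symm)
  · simp

lemma mul_permMatrix_apply (M : Matrix (Fin N × Fin N) (Fin N × Fin N) S) (p : Fin N × Fin N)
    (j l : Fin N) : (M * permMatrix S N) p (j, l) = M p (l, j) := by
  rw [Matrix.mul_apply, Finset.sum_eq_single (l, j)]
  · simp [permMatrix_apply]
  · rintro ⟨a, b⟩ - h
    rw [permMatrix_apply, if_neg, mul_zero]
    rintro ⟨h1, h2⟩
    exact h (Prod.ext h1 h2)
  · simp

lemma leg1_mul_leg2_apply (T T' : Matrix (Fin N) (Fin N) S) (i j k l : Fin N) :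
    (leg1 T * leg2 T') (i, k) (j, l) = T i j * T' k l := by
  rw [Matrix.mul_apply, Finset.sum_eq_single (j, k)]
  · simp [leg1, leg2, Matrix.kroneckerMap_apply]
  · rintro ⟨a, b⟩ - h
    by_cases hb : k = b
    · have ha : a ≠ j := fun ha ↦ h (by rw [ha, hb])
      simp [leg1, leg2, Matrix.kroneckerMap_apply, Matrix.one_apply, ha]
    · simp [leg1, leg2, Matrix.kroneckerMap_apply, Matrix.one_apply, hb]
  · simp

lemma leg2_mul_leg1_apply (T T' : Matrix (Fin N) (Fin N) S) (i j k l : Fin N) :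
    (leg2 T' * leg1 T) (i, k) (j, l) = T' k l * T i j := by
  rw [Matrix.mul_apply, Finset.sum_eq_single (i, l)]
  · simp [leg1, leg2, Matrix.kroneckerMap_apply]
  · rintro ⟨a, b⟩ - h
    by_cases hb : i = a
    · have ha : b ≠ l := fun ha ↦ h (by rw [ha, hb])
      simp [leg1, leg2, Matrix.kroneckerMap_apply, Matrix.one_apply, ha]
    · simp [leg1, leg2, Matrix.kroneckerMap_apply, Matrix.one_apply, hb]
  · simp

lemma leg1_mul (M M' : Matrix (Fin N) (Fin N) S) : leg1 (M * M') = leg1 M * leg1 M' := by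
  ext ⟨i, k⟩ ⟨j, l⟩
  simp [leg1, Matrix.mul_apply, Fintype.sum_prod_type, Matrix.kroneckerMap_apply, Matrix.one_apply]

lemma leg2_mul (M M' : Matrix (Fin N) (Fin N) S) : leg2 (M * M') = leg2 M * leg2 M' := by
  ext ⟨i, k⟩ ⟨j, l⟩
  simp [leg2, Matrix.mul_apply, Fintype.sum_prod_type_right, Matrix.kroneckerMap_apply,
    Matrix.one_apply]

lemma leg1_leg2_comm {T T' : Matrix (Fin N) (Fin N) S}
    (h : ∀ i j k l, Commute (T i j) (T' k l)) : leg1 T * leg2 T' = leg2 T' * leg1 T := by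
  ext ⟨i, k⟩ ⟨j, l⟩
  rw [leg1_mul_leg2_apply, leg2_mul_leg1_apply]
  exact h _ _ _ _

/-- The ternary relation `R T₁ T'₂ = T'₂ T₁ R`, where `R = 1 - q P`. -/
def IsRTT (q : S) (T T' : Matrix (Fin N) (Fin N) S) : Prop :=
  (1 - q • permMatrix S N) * leg1 T * leg2 T' = leg2 T' * leg1 T * (1 - q • permMatrix S N)

/-- Kept as a formula for the difference of the two sides, not only as a criterion, because the
coefficients of this difference are the defining relations of the double Yangian. -/
lemma IsRTT.sub_apply {q : S} (hq : q ∈ Subring.center S) (T T' : Matrix (Fin N) (Fin N) S)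
    (i j k l : Fin N) :
    ((1 - q • permMatrix S N) * leg1 T * leg2 T' -
      leg2 T' * leg1 T * (1 - q • permMatrix S N)) (i, k) (j, l) =
    T i j * T' k l - T' k l * T i j - q * (T k j * T' i l - T' k j * T i l) := by
  have h2 : (leg2 T' * leg1 T) * (q • permMatrix S N) =
      q • ((leg2 T' * leg1 T) * permMatrix S N) := by
    ext p r
    rw [Matrix.smul_apply, Matrix.mul_apply, Matrix.mul_apply, smul_eq_mul, Finset.mul_sum]
    refine Finset.sum_congr rfl fun x _ ↦ ?_
    rw [Matrix.smul_apply, smul_eq_mul, ← mul_assoc, Subring.mem_center_iff.1 hq, mul_assoc]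
  rw [mul_assoc, sub_mul, mul_sub, one_mul, mul_one, h2, smul_mul_assoc]
  simp only [Matrix.sub_apply, Matrix.smul_apply, permMatrix_mul_apply, mul_permMatrix_apply,
    leg1_mul_leg2_apply, leg2_mul_leg1_apply, smul_eq_mul]
  rw [mul_sub]
  abel

lemma isRTT_iff {q : S} (hq : q ∈ Subring.center S) (T T' : Matrix (Fin N) (Fin N) S) :
    IsRTT q T T' ↔ ∀ i j k l,
      T i j * T' k l - T' k l * T i j = q * (T k j * T' i l - T' k j * T i l) := by
  rw [IsRTT, ← sub_eq_zero]
  constructor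
  · intro h i j k l
    rw [← sub_eq_zero, ← IsRTT.sub_apply hq, h]
    rfl
  · intro h
    ext ⟨i, k⟩ ⟨j, l⟩
    rw [IsRTT.sub_apply hq, h, sub_self]
    rfl

/-- The ternary relation is preserved by products of matrices with commuting entries. -/
lemma IsRTT.mul {q : S} {T T' M M' : Matrix (Fin N) (Fin N) S} (h : IsRTT q T T')
    (hM : IsRTT q M M') (h1 : ∀ i j k l, Commute (M i j) (T' k l))
    (h2 : ∀ i j k l, Commute (T i j) (M' k l)) : IsRTT q (T * M) (T' * M') := by
  unfold IsRTT at *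
  rw [leg1_mul, leg2_mul]
  calc (1 - q • permMatrix S N) * (leg1 T * leg1 M) * (leg2 T' * leg2 M')
      = (1 - q • permMatrix S N) * leg1 T * (leg1 M * leg2 T') * leg2 M' := by noncomm_ring
    _ = ((1 - q • permMatrix S N) * leg1 T * leg2 T') * leg1 M * leg2 M' := by
        rw [leg1_leg2_comm h1]; noncomm_ring
    _ = leg2 T' * leg1 T * ((1 - q • permMatrix S N) * leg1 M * leg2 M') := by
        rw [h]; noncomm_ring
    _ = leg2 T' * (leg1 T * leg2 M') * leg1 M * (1 - q • permMatrix S N) := by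
        rw [hM]; noncomm_ring
    _ = _ := by rw [leg1_leg2_comm h2]; noncomm_ring

/-- The evaluation solution of the ternary relation. -/
lemma isRTT_eval {h w w₁ w₂ : S} (hh : h ∈ Subring.center S) (hw : w ∈ Subring.center S)
    (hw₁ : w₁ ∈ Subring.center S) (hw₂ : w₂ ∈ Subring.center S)
    (hw' : w * (w₂ - w₁) = w₁ * w₂) {E : Fin N → Fin N → S}
    (hE : ∀ i j k l, E i j * E k l - E k l * E i j =
      (if k = j then E i l else 0) - (if i = l then E k j else 0)) :
    IsRTT (h * w) (Matrix.of fun i j ↦ (1 : Matrix (Fin N) (Fin N) S) i j + h * (w₁ * E i j))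
      (Matrix.of fun i j ↦ (1 : Matrix (Fin N) (Fin N) S) i j + h * (w₂ * E i j)) := by
  rw [isRTT_iff (mul_mem hh hw)]
  intro i j k l
  have c1 : ∀ x, x * w₁ = w₁ * x := fun x ↦ Subring.mem_center_iff.1 hw₁ x
  have c2 : ∀ x, x * w₂ = w₂ * x := fun x ↦ Subring.mem_center_iff.1 hw₂ x
  have ch : ∀ x, x * h = h * x := fun x ↦ Subring.mem_center_iff.1 hh x
  have one : ∀ (a b : Fin N) (x : S), (1 : Matrix (Fin N) (Fin N) S) a b * x =
      if a = b then x else 0 := fun a b x ↦ by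
    by_cases hab : a = b <;> simp [Matrix.one_apply, hab]
  have one' : ∀ (a b : Fin N) (x : S), x * (1 : Matrix (Fin N) (Fin N) S) a b =
      if a = b then x else 0 := fun a b x ↦ by
    by_cases hab : a = b <;> simp [Matrix.one_apply, hab]
  have e : ∀ x y : S, (h * (w₁ * x)) * (h * (w₂ * y)) = h * h * (w₁ * w₂) * (x * y) := by
    intro x y
    calc (h * (w₁ * x)) * (h * (w₂ * y)) = h * w₁ * (x * h) * w₂ * y := by noncomm_ring
      _ = h * (w₁ * h) * (x * w₂) * y := by rw [ch]; noncomm_ring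
      _ = _ := by rw [ch, c2]; noncomm_ring
  have e' : ∀ x y : S, (h * (w₂ * x)) * (h * (w₁ * y)) = h * h * (w₁ * w₂) * (x * y) := by
    intro x y
    calc (h * (w₂ * x)) * (h * (w₁ * y)) = h * w₂ * (x * h) * w₁ * y := by noncomm_ring
      _ = h * (w₂ * h) * (x * w₁) * y := by rw [ch]; noncomm_ring
      _ = h * h * (w₂ * w₁) * x * y := by rw [ch, c1]; noncomm_ring
      _ = _ := by rw [c1]; noncomm_ring
  simp only [Matrix.of_apply]
  -- The Kronecker deltas are scalars, so only the part of order `h²` survives in the commutator.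
  have lhs : ((1 : Matrix (Fin N) (Fin N) S) i j + h * (w₁ * E i j)) *
        ((1 : Matrix (Fin N) (Fin N) S) k l + h * (w₂ * E k l)) -
      ((1 : Matrix (Fin N) (Fin N) S) k l + h * (w₂ * E k l)) *
        ((1 : Matrix (Fin N) (Fin N) S) i j + h * (w₁ * E i j)) =
      h * h * (w₁ * w₂) * (E i j * E k l - E k l * E i j) := by
    simp only [mul_add, add_mul, e, e', mul_sub, Matrix.one_apply]
    split_ifs <;> simp only [one_mul, mul_one, zero_mul, mul_zero] <;> abel
  rw [lhs, hE, ← hw']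
  simp only [mul_add, add_mul, e, e', one, one']
  have hcl : h * h * (w * (w₂ - w₁)) = h * w * (h * (w₂ - w₁)) := by
    calc h * h * (w * (w₂ - w₁)) = h * (h * w) * (w₂ - w₁) := by noncomm_ring
      _ = h * (w * h) * (w₂ - w₁) := by rw [ch w]
      _ = _ := by noncomm_ring
  rw [hcl, mul_assoc (h * w)]
  congr 1
  by_cases h1 : k = j <;> by_cases h2 : i = l <;> simp [h1, h2] <;> noncomm_ring

/-- The elements `w` are fractions `c / d`. Multiplied by `d d₁ d₂` the claim becomes the polynomial
identity `h`, and `e e₁ e₂` inverts this product of denominators. -/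
lemma mul_sub_eq_of_regular {Z : Type*} [CommRing Z] {c c₁ c₂ d d₁ d₂ w w₁ w₂ e e₁ e₂ : Z}
    (hw : w * d = c) (hw₁ : w₁ * d₁ = c₁) (hw₂ : w₂ * d₂ = c₂) (he : e * d = 1)
    (he₁ : e₁ * d₁ = 1) (he₂ : e₂ * d₂ = 1) (h : c * c₂ * d₁ - c * c₁ * d₂ = c₁ * c₂ * d) :
    w * (w₂ - w₁) = w₁ * w₂ := by
  have key : (w * (w₂ - w₁) - w₁ * w₂) * (d * d₁ * d₂) = 0 := by
    subst hw hw₁ hw₂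
    linear_combination h
  have : (w * (w₂ - w₁) - w₁ * w₂) * (d * d₁ * d₂) * (e * e₁ * e₂) =
      w * (w₂ - w₁) - w₁ * w₂ := by
    linear_combination (w * (w₂ - w₁) - w₁ * w₂) * (e₁ * d₁ * (e₂ * d₂) * he + e₂ * d₂ * he₁ + he₂)
  rw [key, zero_mul] at this
  exact sub_eq_zero.1 this.symm

end RTT

/-! ### Functoriality of the `RTT` relations in the coefficient algebra -/

section SerMap

variable {A B : Type*} [Ring A] [Ring B] {N : ℕ}

/-- The ring homomorphism of Laurent series induced by a ring homomorphism of coefficients. -/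
def laurentMap (f : A →+* B) : LaurentSeries A →+* LaurentSeries B where
  toFun x := x.map f
  map_one' := HahnSeries.map_one f.toMonoidWithZeroHom
  map_mul' _ _ := HahnSeries.map_mul (f : A →ₙ+* B)
  map_zero' := HahnSeries.map_zero (f : ZeroHom A B)
  map_add' _ _ := HahnSeries.map_add (f : A →+ B)

@[simp] lemma coeff_laurentMap (f : A →+* B) (x : LaurentSeries A) (m : ℤ) :
    (laurentMap f x).coeff m = f (x.coeff m) := rfl

/-- The ring homomorphism of series in two variables induced by a ring homomorphism of
coefficients. -/
def serMap (f : A →+* B) : Ser A →+* Ser B := PowerSeries.map (laurentMap f)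

lemma coeff_serMap (f : A →+* B) (x : Ser A) (n : ℕ) (m : ℤ) :
    (PowerSeries.coeff n (serMap f x)).coeff m = f ((PowerSeries.coeff n x).coeff m) := by
  simp [serMap]

lemma ser_ext {x y : Ser A}
    (h : ∀ n m, (PowerSeries.coeff n x).coeff m = (PowerSeries.coeff n y).coeff m) : x = y :=
  PowerSeries.ext fun n ↦ HahnSeries.ext (funext fun m ↦ h n m)

lemma laurentMap_single (f : A →+* B) (m : ℤ) (a : A) :
    laurentMap f (HahnSeries.single m a) = HahnSeries.single m (f a) :=
  HahnSeries.map_single (f : ZeroHom A B)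

lemma laurentMap_ofPowerSeries (f : A →+* B) (x : A⟦X⟧) :
    laurentMap f (HahnSeries.ofPowerSeries ℤ A x) =
      HahnSeries.ofPowerSeries ℤ B (PowerSeries.map f x) := by
  ext m
  rw [coeff_laurentMap, PowerSeries.coeff_coe, PowerSeries.coeff_coe]
  split_ifs <;> simp

lemma laurentMap_C (f : A →+* B) (a : A) :
    laurentMap f (HahnSeries.C a) = HahnSeries.C (f a) := laurentMap_single f 0 a

lemma serMap_innerSer (f : A →+* B) (x : A⟦X⟧) :
    serMap f (innerSer x) = innerSer (PowerSeries.map f x) := by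
  simp only [innerSer, serMap, RingHom.comp_apply, PowerSeries.map_C, laurentMap_ofPowerSeries]

lemma serMap_outerSer (f : A →+* B) (x : A⟦X⟧) :
    serMap f (outerSer x) = outerSer (PowerSeries.map f x) := by
  ext n m
  rw [coeff_serMap]
  simp [outerSer, HahnSeries.coeff_single, apply_ite f]

lemma serMap_constSer (f : A →+* B) (a : A) : serMap f (constSer a) = constSer (f a) := by
  simp only [constSer, serMap, RingHom.comp_apply, PowerSeries.map_C, laurentMap_C]

lemma serMap_X (f : A →+* B) : serMap f PowerSeries.X = PowerSeries.X := PowerSeries.map_X _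

lemma serMap_mk (f : A →+* B) (g : ℕ → LaurentSeries A) :
    serMap f (PowerSeries.mk g) = PowerSeries.mk fun l ↦ laurentMap f (g l) := by
  ext n
  simp [serMap]

lemma map_permMatrix {S S' : Type*} [Ring S] [Ring S'] (f : S →+* S') :
    (permMatrix S N).map f = permMatrix S' N := by
  ext p q
  rw [Matrix.map_apply, permMatrix_apply, permMatrix_apply]
  split_ifs <;> simp

lemma map_leg1 {S S' : Type*} [Ring S] [Ring S'] (f : S →+* S') (M : Matrix (Fin N) (Fin N) S) :
    (leg1 M).map f = leg1 (M.map f) := by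
  ext ⟨i, k⟩ ⟨j, l⟩
  simp only [leg1, Matrix.map_apply, Matrix.kroneckerMap_apply, map_mul, Matrix.one_apply]
  split_ifs <;> simp

lemma map_leg2 {S S' : Type*} [Ring S] [Ring S'] (f : S →+* S') (M : Matrix (Fin N) (Fin N) S) :
    (leg2 M).map f = leg2 (M.map f) := by
  ext ⟨i, k⟩ ⟨j, l⟩
  simp only [leg2, Matrix.map_apply, Matrix.kroneckerMap_apply, map_mul, Matrix.one_apply]
  split_ifs <;> simp

lemma map_smul_matrix {S S' I : Type*} [Ring S] [Ring S'] (f : S →+* S') (q : S)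
    (M : Matrix I I S) : (q • M).map f = f q • M.map f := by
  ext
  simp

lemma map_outer_matrix (f : A →+* B) (T : Matrix (Fin N) (Fin N) A⟦X⟧) :
    (T.map outerSer).map (serMap f) = (T.map (PowerSeries.map f)).map outerSer := by
  ext1 i j
  exact serMap_outerSer _ _

lemma map_inner_matrix (f : A →+* B) (T : Matrix (Fin N) (Fin N) A⟦X⟧) :
    (T.map innerSer).map (serMap f) = (T.map (PowerSeries.map f)).map innerSer := by
  ext1 i j
  exact serMap_innerSer _ _

variable [Algebra ℂ⟦X⟧ A] [Algebra ℂ⟦X⟧ B] (f : A →ₐ[ℂ⟦X⟧] B)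

lemma map_hbar : (f : A →+* B) (hbar A) = hbar B := f.commutes _

lemma map_scal (c : ℂ) : (f : A →+* B) (scal A c) = scal B c := f.commutes _

lemma map_tMatrix (t : Fin N → Fin N → ℕ+ → A) :
    (tMatrix t).map (PowerSeries.map (f : A →+* B)) = tMatrix fun i j r ↦ f (t i j r) := by
  ext1 i j
  simp only [tMatrix, Matrix.map_apply, Matrix.of_apply, map_add, map_mul, PowerSeries.map_C,
    map_hbar, PowerSeries.map_X, Matrix.one_apply]
  congr 1
  split_ifs <;> simp

lemma map_tPlusMatrix (t : Fin N → Fin N → ℕ+ → A) :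
    (tPlusMatrix t).map (PowerSeries.map (f : A →+* B)) = tPlusMatrix fun i j r ↦ f (t i j r) := by
  ext1 i j
  simp only [tPlusMatrix, Matrix.map_apply, Matrix.of_apply, map_sub, map_mul, PowerSeries.map_C,
    map_hbar, Matrix.one_apply]
  congr 1
  split_ifs <;> simp

lemma map_rMatrix (w : Ser A) :
    (rMatrix N w).map (serMap (f : A →+* B)) = rMatrix N (serMap (f : A →+* B) w) := by
  rw [rMatrix, rMatrix, Matrix.map_sub (hf := map_sub _), map_smul_matrix, map_permMatrix, map_mul,
    serMap_constSer, map_hbar, Matrix.map_one _ (map_zero _) (map_one _)]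

lemma map_normEval (w : Ser A) :
    serMap (f : A →+* B) (normEval N w) = normEval N (serMap (f : A →+* B) w) := by
  refine PowerSeries.ext fun n ↦ ?_
  rw [normEval, normEval, serMap, PowerSeries.coeff_map, PowerSeries.coeff_mk, PowerSeries.coeff_mk,
    map_sum]
  refine Finset.sum_congr rfl fun m _ ↦ ?_
  rw [← PowerSeries.coeff_map]
  change PowerSeries.coeff n (serMap (f : A →+* B) _) = _
  rw [map_mul (serMap (f : A →+* B)), map_pow (serMap (f : A →+* B)),
    map_mul (serMap (f : A →+* B)), serMap_constSer, serMap_constSer, map_hbar, map_scal]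
  rfl

lemma map_rBarMatrix (w : Ser A) :
    (rBarMatrix N w).map (serMap (f : A →+* B)) = rBarMatrix N (serMap (f : A →+* B) w) := by
  rw [rBarMatrix, rBarMatrix, map_smul_matrix, map_normEval, map_rMatrix]

lemma map_rttYangian (t : Fin N → Fin N → ℕ+ → A) :
    (rttYangian t).map (serMap (f : A →+* B)) = rttYangian fun i j r ↦ f (t i j r) := by
  simp only [rttYangian, Matrix.map_sub _ (map_sub (serMap (f : A →+* B))), Matrix.map_mul,
    map_leg1, map_leg2, map_rMatrix, map_outer_matrix, map_inner_matrix, map_tMatrix, map_mul,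
    serMap_X, serMap_mk, laurentMap_single, map_one]

lemma map_rttDual (t : Fin N → Fin N → ℕ+ → A) :
    (rttDual t).map (serMap (f : A →+* B)) = rttDual fun i j r ↦ f (t i j r) := by
  simp only [rttDual, Matrix.map_sub _ (map_sub (serMap (f : A →+* B))), Matrix.map_mul,
    map_leg1, map_leg2, map_rMatrix, map_outer_matrix, map_inner_matrix, map_tPlusMatrix,
    serMap_mk, laurentMap_single, map_one]

lemma map_rttMixed (c : A) (t t' : Fin N → Fin N → ℕ+ → A) :
    (rttMixed c t t').map (serMap (f : A →+* B)) =
      rttMixed (f c) (fun i j r ↦ f (t i j r)) fun i j r ↦ f (t' i j r) := by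
  simp only [rttMixed, geomInv, Matrix.map_sub _ (map_sub (serMap (f : A →+* B))), Matrix.map_mul,
    map_leg1, map_leg2, map_rBarMatrix, map_outer_matrix, map_inner_matrix, map_tPlusMatrix,
    map_tMatrix, map_mul, serMap_X, serMap_mk, laurentMap_single, map_one, map_pow, map_sub,
    map_add, laurentMap_C, map_hbar, map_scal]
  rfl

lemma map_mem_coeffSet {M : Matrix (Fin N × Fin N) (Fin N × Fin N) (Ser A)}
    (hM : M.map (serMap (f : A →+* B)) = 0) {x : A} (hx : x ∈ coeffSet M) : f x = 0 := by
  obtain ⟨p, q, n, m, rfl⟩ := hx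
  have := congrArg (fun z ↦ (PowerSeries.coeff n (z p q)).coeff m) hM
  simpa [coeff_serMap] using this

/-- A solution of the `RTT` relations with zero central charge in an `h`-torsion-free algebra
defines a representation of the double Yangian. -/
theorem exists_doubleYangian_hom (htf : ∀ b : B, hbar B * b = 0 → b = 0)
    (t t' : Fin N → Fin N → ℕ+ → B) (h : rttYangian t = 0) (h' : rttDual t' = 0)
    (h'' : rttMixed 0 t t' = 0) :
    ∃ φ : DoubleYangian N →ₐ[ℂ⟦X⟧] B, ∀ i j r, φ (dyMinus i j r) = t' i j r := by
  let g : DYGen N → B := fun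
    | .C => 0
    | .t i j r => t i j r
    | .tMinus i j r => t' i j r
  let F : FreeDY N →ₐ[ℂ⟦X⟧] B := FreeAlgebra.lift ℂ⟦X⟧ g
  have hF : ∀ x, F (FreeAlgebra.ι ℂ⟦X⟧ x) = g x := FreeAlgebra.lift_ι_apply g
  have key : ∀ x y : FreeDY N, DYRel N x y → F x = F y := by
    intro x y hxy
    induction hxy with
    | central x => rw [map_mul, map_mul, hF, show g .C = 0 from rfl, zero_mul, mul_zero]
    | rtt y hy =>
      have h0 : F (hbar (FreeDY N) ^ 2 * y) = 0 := by
        rcases hy with (hy | hy) | hy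
        · refine map_mem_coeffSet F ?_ hy
          rw [map_rttYangian]
          simpa only [hF] using h
        · refine map_mem_coeffSet F ?_ hy
          rw [map_rttDual]
          simpa only [hF] using h'
        · refine map_mem_coeffSet F ?_ hy
          rw [map_rttMixed]
          simpa only [hF] using h''
      rw [map_mul, map_pow, show F (hbar _) = hbar B from F.commutes _, pow_two, mul_assoc] at h0
      -- The relation imposed is a coefficient divided by `h²`, so torsion-freeness is applied
      -- twice.
      rw [htf _ (htf _ h0), map_zero]
  refine ⟨RingQuot.liftAlgHom ℂ⟦X⟧ ⟨F, key⟩, fun i j r ↦ ?_⟩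
  exact (RingQuot.liftAlgHom_mkAlgHom_apply ℂ⟦X⟧ F key _).trans (hF _)

end SerMap

/-! ### Central elements and geometric series in noncommutative power series rings -/

section Center

variable {S : Type*} [Ring S]

/-- All nine elements are central, so the identity of fractions can be checked in the commutative
ring `Subring.center S`. -/
lemma mul_sub_eq_of_center {c c₁ c₂ d d₁ d₂ e e₁ e₂ : S} (hc : c ∈ Subring.center S)
    (hc₁ : c₁ ∈ Subring.center S) (hc₂ : c₂ ∈ Subring.center S) (hd : d ∈ Subring.center S)
    (hd₁ : d₁ ∈ Subring.center S) (hd₂ : d₂ ∈ Subring.center S) (he : e ∈ Subring.center S)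
    (he₁ : e₁ ∈ Subring.center S) (he₂ : e₂ ∈ Subring.center S) (hed : e * d = 1)
    (hed₁ : e₁ * d₁ = 1) (hed₂ : e₂ * d₂ = 1) (h : c * c₂ * d₁ - c * c₁ * d₂ = c₁ * c₂ * d) :
    c * e * (c₂ * e₂ - c₁ * e₁) = c₁ * e₁ * (c₂ * e₂) := by
  lift c to Subring.center S using hc
  lift c₁ to Subring.center S using hc₁
  lift c₂ to Subring.center S using hc₂
  lift d to Subring.center S using hd
  lift d₁ to Subring.center S using hd₁
  lift d₂ to Subring.center S using hd₂
  lift e to Subring.center S using he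
  lift e₁ to Subring.center S using he₁
  lift e₂ to Subring.center S using he₂
  norm_cast at *
  refine mul_sub_eq_of_regular (d := d) (d₁ := d₁) (d₂ := d₂) ?_ ?_ ?_ hed hed₁ hed₂ h
  · rw [mul_assoc, hed, mul_one]
  · rw [mul_assoc, hed₁, mul_one]
  · rw [mul_assoc, hed₂, mul_one]

lemma powerSeries_mem_center {f : S⟦X⟧} (h : ∀ n, PowerSeries.coeff n f ∈ Subring.center S) :
    f ∈ Subring.center S⟦X⟧ := by
  rw [Subring.mem_center_iff]
  intro g
  ext n
  rw [PowerSeries.coeff_mul, PowerSeries.coeff_mul, ← Finset.Nat.sum_antidiagonal_swap]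
  exact Finset.sum_congr rfl fun x _ ↦ Subring.mem_center_iff.1 (h _) _

lemma single_mem_center (m : ℤ) {b : S} (hb : b ∈ Subring.center S) :
    (HahnSeries.single m b : LaurentSeries S) ∈ Subring.center (LaurentSeries S) := by
  rw [Subring.mem_center_iff]
  intro g
  ext n
  obtain ⟨k, rfl⟩ : ∃ k, n = k + m := ⟨n - m, by ring⟩
  rw [HahnSeries.coeff_mul_single_add, HahnSeries.coeff_single_mul_add]
  exact Subring.mem_center_iff.1 hb _


lemma coeff_mem_center {f : S⟦X⟧} (h : f ∈ Subring.center S⟦X⟧) (n : ℕ) :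
    PowerSeries.coeff n f ∈ Subring.center S := by
  rw [Subring.mem_center_iff]
  intro g
  have := congrArg (PowerSeries.coeff n) (Subring.mem_center_iff.1 h (PowerSeries.C g))
  rwa [PowerSeries.coeff_C_mul, PowerSeries.coeff_mul_C] at this

lemma C_mem_center {b : S} (hb : b ∈ Subring.center S) :
    PowerSeries.C b ∈ Subring.center S⟦X⟧ := by
  refine powerSeries_mem_center fun n ↦ ?_
  rw [PowerSeries.coeff_C]
  split_ifs
  exacts [hb, zero_mem _]

lemma X_mem_center : (PowerSeries.X : S⟦X⟧) ∈ Subring.center S⟦X⟧ := by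
  rw [Subring.mem_center_iff]
  exact fun f ↦ (PowerSeries.X_mul).symm

lemma mem_center_of_mul_eq_one {d e : S} (hd : d ∈ Subring.center S) (h : e * d = 1) :
    e ∈ Subring.center S := by
  rw [Subring.mem_center_iff] at hd ⊢
  intro x
  calc x * e = (e * d) * x * e := by rw [h, one_mul]
    _ = e * (x * (e * d)) := by rw [mul_assoc e, ← hd x]; simp only [mul_assoc]; rw [hd e]
    _ = e * x := by rw [h, mul_one]

/-- The geometric series `∑ bˡ Xˡ`. -/
def geo (b : S) : S⟦X⟧ := PowerSeries.mk fun l ↦ b ^ l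

lemma geo_mul (b : S) : geo b * (1 - PowerSeries.X * PowerSeries.C b) = 1 := by
  rw [mul_sub, mul_one, ← mul_assoc, ← PowerSeries.X_mul, mul_assoc]
  ext n
  cases n with
  | zero => simp [geo]
  | succ n =>
    rw [map_sub, PowerSeries.coeff_succ_X_mul, PowerSeries.coeff_mul_C]
    simp [geo, PowerSeries.coeff_one, pow_succ]

lemma IsRTT.map {S' : Type*} [Ring S'] {N : ℕ} (f : S →+* S') {q : S}
    {T T' : Matrix (Fin N) (Fin N) S} (h : IsRTT q T T') : IsRTT (f q) (T.map f) (T'.map f) := by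
  have := congrArg (fun M ↦ M.map f) h
  simpa only [IsRTT, Matrix.map_mul, Matrix.map_sub _ (map_sub f), map_leg1, map_leg2,
    map_smul_matrix, map_permMatrix, Matrix.map_one _ (map_zero f) (map_one f)] using this

end Center

/-! ### The three expansions of `(u - v)⁻¹` -/

section Variables

variable {B : Type*} [Ring B]

variable (B) in
/-- The expansion of `(u - v)⁻¹` in the variables `u⁻¹` (outer) and `v⁻¹` (inner). -/
def wYangian : Ser B :=
  PowerSeries.X * PowerSeries.mk fun l ↦ HahnSeries.single (-(l : ℤ)) 1

variable (B) in
/-- The expansion of `(u - v)⁻¹` in the variables `v` (outer) and `u` (inner). -/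
def wDual : Ser B := PowerSeries.mk fun l ↦ HahnSeries.single (-(l : ℤ) - 1) 1

variable (B) in
/-- The expansion of `(u - v)⁻¹` in the variables `u⁻¹` (outer) and `v` (inner). -/
def wMixed : Ser B := geomInv (HahnSeries.single 1 1)

lemma constSer_mem_center {b : B} (hb : b ∈ Subring.center B) :
    constSer b ∈ Subring.center (Ser B) := C_mem_center (single_mem_center 0 hb)

lemma inner_mem_center (m : ℤ) :
    PowerSeries.C (HahnSeries.single m 1) ∈ Subring.center (Ser B) :=
  C_mem_center (single_mem_center m (one_mem _))

lemma wYangian_eq :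
    wYangian B = PowerSeries.X * geo (HahnSeries.single (-1) 1) := by
  simp [wYangian, geo]

lemma wMixed_eq : wMixed B = PowerSeries.X * geo (HahnSeries.single 1 1) := rfl

lemma wDual_eq :
    wDual B = PowerSeries.C (HahnSeries.single (-1) 1) * geo (HahnSeries.single (-1) 1) := by
  ext n : 1
  simp only [wDual, geo, PowerSeries.coeff_mk, PowerSeries.coeff_C_mul, HahnSeries.single_pow,
    HahnSeries.single_mul_single, one_pow, mul_one]
  rw [show -(n : ℤ) - 1 = -1 + n • (-1 : ℤ) by simp; ring]

lemma geo_single_mem_center (m : ℤ) :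
    geo (HahnSeries.single m 1) ∈ Subring.center (Ser B) :=
  mem_center_of_mul_eq_one (sub_mem (one_mem _) (mul_mem X_mem_center (inner_mem_center m)))
    (geo_mul _)

lemma wMixed_mem_center : wMixed B ∈ Subring.center (Ser B) :=
  mul_mem X_mem_center (geo_single_mem_center 1)

lemma outerSer_geo_mul (b : B) :
    outerSer (geo b) * (1 - PowerSeries.X * constSer b) = 1 := by
  have := congrArg outerSer (geo_mul b)
  rw [map_mul, map_sub, map_mul, map_one] at this
  simpa [outerSer, constSer] using this

lemma innerSer_geo_mul (b : B) :
    innerSer (geo b) * (1 - PowerSeries.C (HahnSeries.single 1 1) * constSer b) = 1 := by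
  have := congrArg innerSer (geo_mul b)
  rw [map_mul, map_sub, map_mul, map_one] at this
  simpa [innerSer, constSer, HahnSeries.ofPowerSeries_X, HahnSeries.ofPowerSeries_C] using this

lemma outerSer_C (b : B) : outerSer (PowerSeries.C b) = constSer b := by
  simp [outerSer, constSer]

lemma innerSer_C (b : B) : innerSer (PowerSeries.C b) = constSer b := by
  simp [innerSer, constSer, HahnSeries.ofPowerSeries_C]

lemma outerSer_X : outerSer (PowerSeries.X : B⟦X⟧) = PowerSeries.X := by
  simp [outerSer]

lemma innerSer_X : innerSer (PowerSeries.X : B⟦X⟧) = PowerSeries.C (HahnSeries.single 1 1) := by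
  simp [innerSer, HahnSeries.ofPowerSeries_X]

variable {N : ℕ} {E : Fin N → Fin N → B} {a : B}

lemma const_comm_rel (hE : ∀ i j k l, E i j * E k l - E k l * E i j =
      (if k = j then E i l else 0) - (if i = l then E k j else 0)) (i j k l : Fin N) :
    constSer (E i j) * constSer (E k l) - constSer (E k l) * constSer (E i j) =
      (if k = j then constSer (E i l) else 0) - (if i = l then constSer (E k j) else 0) := by
  rw [← map_mul, ← map_mul, ← map_sub, hE, map_sub, apply_ite constSer, apply_ite constSer,
    map_zero]

lemma outer_geo_mem_center (ha : a ∈ Subring.center B) :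
    outerSer (geo a) ∈ Subring.center (Ser B) :=
  mem_center_of_mul_eq_one (sub_mem (one_mem _) (mul_mem X_mem_center (constSer_mem_center ha)))
    (outerSer_geo_mul _)

lemma inner_geo_mem_center (ha : a ∈ Subring.center B) :
    innerSer (geo a) ∈ Subring.center (Ser B) :=
  mem_center_of_mul_eq_one
    (sub_mem (one_mem _) (mul_mem (inner_mem_center 1) (constSer_mem_center ha)))
    (innerSer_geo_mul _)

lemma inner_mul_inner : (PowerSeries.C (HahnSeries.single (-1) 1) : Ser B) *
    PowerSeries.C (HahnSeries.single 1 1) = 1 := by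
  rw [← map_mul, HahnSeries.single_mul_single]
  simp

end Variables

/-! ### The ternary relations at zero central charge -/

section TernaryRelations

variable {A B : Type*} [Ring A] [Ring B] [Algebra ℂ⟦X⟧ A] [Algebra ℂ⟦X⟧ B] {N : ℕ}

/-- The ternary relation for `T(u)` and `T(v)`. -/
def YangianRTT (t : Fin N → Fin N → ℕ+ → B) : Prop :=
  IsRTT (constSer (hbar B) * wYangian B) ((tMatrix t).map outerSer) ((tMatrix t).map innerSer)

/-- The ternary relation for `T⁺(u)` and `T⁺(v)`. -/
def DualRTT (t : Fin N → Fin N → ℕ+ → B) : Prop :=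
  IsRTT (constSer (hbar B) * wDual B) ((tPlusMatrix t).map innerSer) ((tPlusMatrix t).map outerSer)

/-- The ternary relation for `T(u)` and `T⁺(v)` at zero central charge, without the scalar
factor. -/
def MixedRTT (t t' : Fin N → Fin N → ℕ+ → B) : Prop :=
  IsRTT (constSer (hbar B) * wMixed B) ((tMatrix t).map outerSer) ((tPlusMatrix t').map innerSer)

lemma YangianRTT.map (f : A →ₐ[ℂ⟦X⟧] B) {t : Fin N → Fin N → ℕ+ → A} (h : YangianRTT t) :
    YangianRTT fun i j r ↦ f (t i j r) := by
  have := IsRTT.map (serMap (f : A →+* B)) h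
  rw [YangianRTT]
  simpa only [map_outer_matrix, map_inner_matrix, map_tMatrix, map_mul, serMap_constSer, map_hbar,
    wYangian, serMap_X, serMap_mk, laurentMap_single, map_one] using this

lemma DualRTT.map (f : A →ₐ[ℂ⟦X⟧] B) {t : Fin N → Fin N → ℕ+ → A} (h : DualRTT t) :
    DualRTT fun i j r ↦ f (t i j r) := by
  have := IsRTT.map (serMap (f : A →+* B)) h
  rw [DualRTT]
  simpa only [map_outer_matrix, map_inner_matrix, map_tPlusMatrix, map_mul, serMap_constSer,
    map_hbar, wDual, serMap_mk, laurentMap_single, map_one] using this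

lemma MixedRTT.map (f : A →ₐ[ℂ⟦X⟧] B) {t t' : Fin N → Fin N → ℕ+ → A} (h : MixedRTT t t') :
    MixedRTT (fun i j r ↦ f (t i j r)) fun i j r ↦ f (t' i j r) := by
  have := IsRTT.map (serMap (f : A →+* B)) h
  rw [MixedRTT]
  simpa only [map_outer_matrix, map_inner_matrix, map_tPlusMatrix, map_tMatrix, map_mul,
    serMap_constSer, map_hbar, wMixed, geomInv, serMap_X, serMap_mk, laurentMap_single, map_pow,
    map_one] using this

variable (B) in
lemma hbar_mem_center : hbar B ∈ Subring.center B := by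
  rw [Subring.mem_center_iff]
  exact fun x ↦ (Algebra.commutes _ _).symm

lemma scal_mem_center (c : ℂ) : scal B c ∈ Subring.center B := by
  rw [Subring.mem_center_iff]
  exact fun x ↦ (Algebra.commutes _ _).symm

lemma normEval_mem_center {w : Ser B} (hw : w ∈ Subring.center (Ser B)) :
    normEval N w ∈ Subring.center (Ser B) :=
  powerSeries_mem_center fun n ↦ by
    rw [normEval, PowerSeries.coeff_mk]
    refine Subring.sum_mem _ fun m _ ↦ ?_
    have hm : constSer (scal B (PowerSeries.coeff m (normSeries N))) *
        (constSer (hbar B) * w) ^ m ∈ Subring.center (Ser B) :=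
      mul_mem (constSer_mem_center (scal_mem_center _))
        (pow_mem (mul_mem (constSer_mem_center (hbar_mem_center B)) hw) _)
    exact coeff_mem_center (S := LaurentSeries B) hm n

/-- At `C = 0` the two arguments of the normalized `R`-matrix coincide, and its scalar factor is
central, so it can be taken out of the difference. Nothing about the series `g` beyond having
complex coefficients is needed. -/
lemma MixedRTT.rttMixed_eq_zero {t t' : Fin N → Fin N → ℕ+ → B} (h : MixedRTT t t') :
    rttMixed 0 t t' = 0 := by
  have hn : normEval N (wMixed B) ∈ Subring.center (Ser B) := normEval_mem_center wMixed_mem_center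
  have e : ∀ M M' : Matrix (Fin N × Fin N) (Fin N × Fin N) (Ser B),
      M * (normEval N (wMixed B) • M') = normEval N (wMixed B) • (M * M') := by
    intro M M'
    ext1 p r
    rw [Matrix.smul_apply, Matrix.mul_apply, Matrix.mul_apply, smul_eq_mul, Finset.mul_sum]
    refine Finset.sum_congr rfl fun x _ ↦ ?_
    rw [Matrix.smul_apply, smul_eq_mul, ← mul_assoc, Subring.mem_center_iff.1 hn, mul_assoc]
  rw [rttMixed]
  simp only [mul_zero, map_zero, sub_zero, add_zero]
  change rBarMatrix N (wMixed B) * _ * _ - _ * rBarMatrix N (wMixed B) = 0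
  rw [rBarMatrix, e, smul_mul_assoc, smul_mul_assoc, ← smul_sub]
  have h' : rMatrix N (wMixed B) * leg1 ((tMatrix t).map outerSer) *
      leg2 ((tPlusMatrix t').map innerSer) - leg2 ((tPlusMatrix t').map innerSer) *
      leg1 ((tMatrix t).map outerSer) * rMatrix N (wMixed B) = 0 := sub_eq_zero.2 h
  rw [h', smul_zero]

end TernaryRelations

/-! ### Products of solutions and evaluation solutions -/

section EvaluationMatrices

variable {B : Type*} [Ring B] [Algebra ℂ⟦X⟧ B] {N : ℕ}

/-- The `r`-th coefficient of the product of the series `∑ x_r u^(r-1)` and `∑ y_r u^(r-1)` of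
matrices. -/
def convCoeff (x y : Fin N → Fin N → ℕ+ → B) (i j : Fin N) (r : ℕ+) : B :=
  ∑ k, PowerSeries.coeff r.natPred
    ((PowerSeries.mk fun m ↦ x i k m.succPNat) * PowerSeries.mk fun m ↦ y k j m.succPNat)

/-- The coefficients of the product of two matrices `T⁺(u)`. -/
def mulPlus (x y : Fin N → Fin N → ℕ+ → B) (i j : Fin N) (r : ℕ+) : B :=
  x i j r + y i j r - hbar B * convCoeff x y i j r

/-- The coefficients of the product of two matrices `T(u)`. -/
def mulYangian (x y : Fin N → Fin N → ℕ+ → B) (i j : Fin N) (r : ℕ+) : B :=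
  x i j r + y i j r + hbar B * ∑ k, PowerSeries.coeff r.natPred
    ((PowerSeries.mk fun m ↦ x i k m.succPNat) * (PowerSeries.X *
      PowerSeries.mk fun m ↦ y k j m.succPNat))

lemma C_hbar_comm (f : B⟦X⟧) : f * PowerSeries.C (hbar B) = PowerSeries.C (hbar B) * f :=
  Subring.mem_center_iff.1 (C_mem_center (hbar_mem_center B)) f

/-- This is `(1 - hτ)(1 - hτ') = 1 - h(τ + τ' - hττ')`: the product again has the shape of a matrix
`T⁺(u)`. -/
lemma tPlusMatrix_mulPlus (x y : Fin N → Fin N → ℕ+ → B) :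
    tPlusMatrix (mulPlus x y) = tPlusMatrix x * tPlusMatrix y := by
  have h1 : ∀ t : Fin N → Fin N → ℕ+ → B, tPlusMatrix t =
      1 - PowerSeries.C (hbar B) • tauMatrix t := fun t ↦ by
    ext i j
    simp [tPlusMatrix, tauMatrix]
  have hs : ∀ M M' : Matrix (Fin N) (Fin N) B⟦X⟧,
      M * (PowerSeries.C (hbar B) • M') = PowerSeries.C (hbar B) • (M * M') := by
    intro M M'
    ext1 i j
    simp only [Matrix.mul_apply, Matrix.smul_apply, smul_eq_mul, Finset.mul_sum]
    exact Finset.sum_congr rfl fun k _ ↦ by rw [← mul_assoc, C_hbar_comm, mul_assoc]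
  have h2 : tauMatrix (mulPlus x y) = tauMatrix x + tauMatrix y -
      PowerSeries.C (hbar B) • (tauMatrix x * tauMatrix y) := by
    ext i j n
    simp [tauMatrix, mulPlus, convCoeff, Matrix.mul_apply]
  rw [h1, h1, h1, h2]
  simp only [sub_mul, mul_sub, one_mul, mul_one, hs, smul_mul_assoc, smul_sub, smul_add]
  abel

lemma tMatrix_mulYangian (x y : Fin N → Fin N → ℕ+ → B) :
    tMatrix (mulYangian x y) = tMatrix x * tMatrix y := by
  set c : B⟦X⟧ := PowerSeries.C (hbar B) * PowerSeries.X with hc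
  have hcc : ∀ f, f * c = c * f := fun f ↦ Subring.mem_center_iff.1
    (mul_mem (C_mem_center (hbar_mem_center B)) X_mem_center) f
  have h1 : ∀ t : Fin N → Fin N → ℕ+ → B, tMatrix t = 1 + c • tauMatrix t := fun t ↦ by
    ext i j
    simp [tMatrix, tauMatrix, hc, mul_assoc]
  have hs : ∀ M M' : Matrix (Fin N) (Fin N) B⟦X⟧, M * (c • M') = c • (M * M') := by
    intro M M'
    ext1 i j
    simp only [Matrix.mul_apply, Matrix.smul_apply, smul_eq_mul, Finset.mul_sum]
    exact Finset.sum_congr rfl fun k _ ↦ by rw [← mul_assoc, hcc, mul_assoc]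
  have h2 : tauMatrix (mulYangian x y) = tauMatrix x + tauMatrix y +
      c • (tauMatrix x * tauMatrix y) := by
    have e : c • (tauMatrix x * tauMatrix y) =
        PowerSeries.C (hbar B) • Matrix.of fun i j ↦ ∑ k, tauMatrix x i k *
          (PowerSeries.X * tauMatrix y k j) := by
      ext1 i j
      simp only [Matrix.mul_apply, Matrix.smul_apply, smul_eq_mul, Matrix.of_apply, hc, mul_assoc,
        Finset.mul_sum]
      refine Finset.sum_congr rfl fun k _ ↦ ?_
      rw [← mul_assoc PowerSeries.X, PowerSeries.X_mul, mul_assoc]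
    rw [e]
    ext i j n
    simp [tauMatrix, mulYangian]
  rw [h1, h1, h1, h2]
  simp only [add_mul, mul_add, one_mul, mul_one, hs, smul_mul_assoc, smul_add]
  abel

/-- Powers of `a` times matrix units: the coefficients of `1 + h (u - a)⁻¹ E` in `u⁻¹`. -/
def evalYangian (E : Fin N → Fin N → B) (a : B) (i j : Fin N) (r : ℕ+) : B := a ^ r.natPred * E i j

/-- Powers of `b = a⁻¹` times matrix units: the coefficients of `1 + h (u - a)⁻¹ E` in `u`. -/
def evalPlus (E : Fin N → Fin N → B) (b : B) (i j : Fin N) (r : ℕ+) : B := b ^ (r : ℕ) * E i j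

lemma map_tMatrix_evalYangian {S : Type*} [Ring S] (f : B⟦X⟧ →+* S) (E : Fin N → Fin N → B)
    (a : B) : (tMatrix (evalYangian E a)).map f =
      Matrix.of fun i j ↦ (1 : Matrix (Fin N) (Fin N) S) i j + f (PowerSeries.C (hbar B)) *
        ((f PowerSeries.X * f (geo a)) * f (PowerSeries.C (E i j))) := by
  ext1 i j
  have : (PowerSeries.mk fun m ↦ evalYangian E a i j m.succPNat) =
      geo a * PowerSeries.C (E i j) := by
    ext n
    simp [evalYangian, geo]
  simp only [tMatrix, Matrix.map_apply, Matrix.of_apply, this, map_add, map_mul, mul_assoc,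
    Matrix.one_apply]
  congr 1
  split_ifs <;> simp

/-- As `b` stands for `a⁻¹`, the expansion of `(u - a)⁻¹` at `u = 0` is `-b (1 - b u)⁻¹`. This
explains the factor `-b` and gives the shape required by `isRTT_eval`. -/
lemma map_tPlusMatrix_evalPlus {S : Type*} [Ring S] (f : B⟦X⟧ →+* S) (E : Fin N → Fin N → B)
    (b : B) : (tPlusMatrix (evalPlus E b)).map f =
      Matrix.of fun i j ↦ (1 : Matrix (Fin N) (Fin N) S) i j + f (PowerSeries.C (hbar B)) *
        ((f (PowerSeries.C (-b)) * f (geo b)) * f (PowerSeries.C (E i j))) := by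
  ext1 i j
  have : (PowerSeries.mk fun m ↦ evalPlus E b i j m.succPNat) =
      PowerSeries.C b * (geo b * PowerSeries.C (E i j)) := by
    ext n
    simp [evalPlus, geo, pow_succ', mul_assoc]
  simp only [tPlusMatrix, Matrix.map_apply, Matrix.of_apply, this, mul_assoc,
    Matrix.one_apply, map_neg, neg_mul, mul_neg, sub_eq_add_neg]
  split_ifs <;> simp

section Evaluation

variable {E : Fin N → Fin N → B} {a b : B}

variable (ha : a ∈ Subring.center B) (hb : b ∈ Subring.center B)
  (hE : ∀ i j k l, E i j * E k l - E k l * E i j =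
    (if k = j then E i l else 0) - (if i = l then E k j else 0))
include hE

-- With `x = u⁻¹` and `y = v⁻¹` the three fractions are `x / (1 - x y⁻¹)`, `x / (1 - x a)` and `y /
-- (1 - y a)`. After clearing denominators both sides of the required identity are `x y - x²`.
include ha in
lemma yangianRTT_eval : YangianRTT (evalYangian E a) := by
  rw [YangianRTT, map_tMatrix_evalYangian, map_tMatrix_evalYangian, outerSer_C, innerSer_C]
  simp only [outerSer_C, innerSer_C, outerSer_X, innerSer_X]
  have hc := constSer_mem_center ha
  have hX : (PowerSeries.X : Ser B) ∈ Subring.center (Ser B) := X_mem_center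
  have hY : (PowerSeries.C (HahnSeries.single 1 1) : Ser B) ∈ Subring.center (Ser B) :=
    inner_mem_center 1
  have hY' : (PowerSeries.C (HahnSeries.single (-1) 1) : Ser B) ∈ Subring.center (Ser B) :=
    inner_mem_center (-1)
  refine isRTT_eval (constSer_mem_center (hbar_mem_center B)) ?_
    (mul_mem hX (outer_geo_mem_center ha)) (mul_mem hY (inner_geo_mem_center ha)) ?_
    (const_comm_rel hE)
  · rw [wYangian_eq]
    exact mul_mem hX (geo_single_mem_center _)
  · rw [wYangian_eq]
    refine mul_sub_eq_of_center hX hX hY ?_ ?_ ?_ (geo_single_mem_center _)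
      (outer_geo_mem_center ha) (inner_geo_mem_center ha) (geo_mul _) (outerSer_geo_mul a)
      (innerSer_geo_mul a) ?_
    · exact sub_mem (one_mem _) (mul_mem hX hY')
    · exact sub_mem (one_mem _) (mul_mem hX hc)
    · exact sub_mem (one_mem _) (mul_mem hY hc)
    · have h1 := inner_mul_inner (B := B)
      have h2 := Subring.mem_center_iff.1 hX
      have h3 := Subring.mem_center_iff.1 hY
      generalize (PowerSeries.C (HahnSeries.single 1 1) : Ser B) = y at *
      generalize (PowerSeries.C (HahnSeries.single (-1) 1) : Ser B) = y' at *
      generalize constSer a = c at *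
      generalize (PowerSeries.X : Ser B) = x at *
      have e1 : x * y * (x * y') = x * x := by
        rw [mul_assoc, ← h3, mul_assoc, h1, mul_one]
      have e2 : x * y * (x * c) = x * x * (y * c) := by
        rw [mul_assoc, ← mul_assoc y, h2 y]; simp only [mul_assoc]
      rw [mul_sub, mul_sub, mul_sub, e1, e2]
      noncomm_ring

-- The condition `a b = 1` makes `-b / (1 - b v)` the expansion of `(v - a)⁻¹`, so that `T` and `T⁺`
-- are two expansions of the same rational matrix. The relation between two copies of `T⁺` involves
-- `b` only.
include ha hb in
lemma mixedRTT_eval (hab : a * b = 1) : MixedRTT (evalYangian E a) (evalPlus E b) := by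
  rw [MixedRTT, map_tMatrix_evalYangian, map_tPlusMatrix_evalPlus, outerSer_C, innerSer_C]
  simp only [outerSer_C, innerSer_C, outerSer_X]
  have hc := constSer_mem_center ha
  have hd := constSer_mem_center hb
  have hd' := constSer_mem_center (neg_mem hb)
  have hX : (PowerSeries.X : Ser B) ∈ Subring.center (Ser B) := X_mem_center
  have hY : (PowerSeries.C (HahnSeries.single 1 1) : Ser B) ∈ Subring.center (Ser B) :=
    inner_mem_center 1
  refine isRTT_eval (constSer_mem_center (hbar_mem_center B)) wMixed_mem_center
    (mul_mem hX (outer_geo_mem_center ha)) (mul_mem hd' (inner_geo_mem_center hb)) ?_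
    (const_comm_rel hE)
  rw [wMixed_eq]
  refine mul_sub_eq_of_center hX hX hd' ?_ ?_ ?_ (geo_single_mem_center _)
    (outer_geo_mem_center ha) (inner_geo_mem_center hb) (geo_mul _) (outerSer_geo_mul a)
    (innerSer_geo_mul b) ?_
  · exact sub_mem (one_mem _) (mul_mem hX hY)
  · exact sub_mem (one_mem _) (mul_mem hX hc)
  · exact sub_mem (one_mem _) (mul_mem hY hd)
  · have h1 : constSer a * constSer b = 1 := by rw [← map_mul, hab, map_one]
    have h2 := Subring.mem_center_iff.1 hX
    have h3 := Subring.mem_center_iff.1 hY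
    have h4 := Subring.mem_center_iff.1 hd
    rw [map_neg]
    generalize (PowerSeries.C (HahnSeries.single 1 1) : Ser B) = y at *
    generalize constSer a = c at *
    generalize constSer b = d at *
    generalize (PowerSeries.X : Ser B) = x at *
    have e1 : x * d * (x * c) = x * x := by
      rw [mul_assoc, ← h4, mul_assoc, h1, mul_one]
    have e2 : x * d * (x * y) = x * x * (y * d) := by
      rw [mul_assoc, ← h4]; simp only [mul_assoc]
    simp only [mul_neg, neg_mul, mul_sub, mul_one, e1, e2]
    noncomm_ring

include hb in
lemma dualRTT_eval : DualRTT (evalPlus E b) := by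
  rw [DualRTT, map_tPlusMatrix_evalPlus, map_tPlusMatrix_evalPlus, outerSer_C, innerSer_C]
  simp only [outerSer_C, innerSer_C]
  have hd := constSer_mem_center hb
  have hd' := constSer_mem_center (neg_mem hb)
  have hX : (PowerSeries.X : Ser B) ∈ Subring.center (Ser B) := X_mem_center
  have hY : (PowerSeries.C (HahnSeries.single 1 1) : Ser B) ∈ Subring.center (Ser B) :=
    inner_mem_center 1
  have hY' : (PowerSeries.C (HahnSeries.single (-1) 1) : Ser B) ∈ Subring.center (Ser B) :=
    inner_mem_center (-1)
  refine isRTT_eval (constSer_mem_center (hbar_mem_center B)) ?_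
    (mul_mem hd' (inner_geo_mem_center hb)) (mul_mem hd' (outer_geo_mem_center hb)) ?_
    (const_comm_rel hE)
  · rw [wDual_eq]
    exact mul_mem hY' (geo_single_mem_center _)
  · rw [wDual_eq]
    refine mul_sub_eq_of_center hY' hd' hd' ?_ ?_ ?_ (geo_single_mem_center _)
      (inner_geo_mem_center hb) (outer_geo_mem_center hb) (geo_mul _) (innerSer_geo_mul b)
      (outerSer_geo_mul b) ?_
    · exact sub_mem (one_mem _) (mul_mem hX hY')
    · exact sub_mem (one_mem _) (mul_mem hY hd)
    · exact sub_mem (one_mem _) (mul_mem hX hd)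
    · have h1 := inner_mul_inner (B := B)
      have h2 := Subring.mem_center_iff.1 hX
      have h4 := Subring.mem_center_iff.1 hd
      rw [map_neg]
      generalize (PowerSeries.C (HahnSeries.single 1 1) : Ser B) = y at *
      generalize (PowerSeries.C (HahnSeries.single (-1) 1) : Ser B) = y' at *
      generalize constSer b = d at *
      generalize (PowerSeries.X : Ser B) = x at *
      have e1 : y' * d * (y * d) = d * d := by
        rw [h4 y', mul_assoc, ← mul_assoc y', h1, one_mul]
      have e2 : y' * d * (x * d) = d * d * (x * y') := by
        rw [h4 y', mul_assoc, ← mul_assoc y', h4 (y' * x), h2 y', ← mul_assoc]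
      simp only [mul_neg, neg_mul, mul_sub, mul_one, e1, e2]
      noncomm_ring

end Evaluation

end EvaluationMatrices

/-! ### Laurent polynomials and graded representations of the double Yangian -/

section

/-- Laurent polynomials over a ring that need not be commutative, with the ring structure as the
only source of algebraic instances. -/
def Laur (A : Type*) [Ring A] : Type _ := LaurentPolynomial A

namespace Laur

section Ring

variable {A A' : Type*} [Ring A] [Ring A']

instance : Ring (Laur A) := inferInstanceAs (Ring (LaurentPolynomial A))

instance [Algebra ℂ⟦X⟧ A] : Algebra ℂ⟦X⟧ (Laur A) :=
  inferInstanceAs (Algebra ℂ⟦X⟧ (LaurentPolynomial A))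

/-- The Laurent polynomial `a T ^ m`. -/
def single (m : ℤ) : A →+ Laur A := AddMonoidAlgebra.singleAddHom m

/-- The coefficient of `T ^ m`. -/
def coeff (m : ℤ) : Laur A →+ A where
  toFun x := AddMonoidAlgebra.coeff x m
  map_zero' := rfl
  map_add' _ _ := rfl

lemma coeff_single (m n : ℤ) (a : A) : coeff m (single n a) = if n = m then a else 0 :=
  Finsupp.single_apply

lemma single_mul_single (m n : ℤ) (a b : A) :
    single m a * single n b = single (m + n) (a * b) :=
  AddMonoidAlgebra.single_mul_single m n a b

lemma single_zero_one : (single 0 1 : Laur A) = 1 := rfl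

@[ext]
lemma ext {x y : Laur A} (h : ∀ m, coeff m x = coeff m y) : x = y :=
  LaurentPolynomial.ext h

lemma induction {p : Laur A → Prop} (h : ∀ m a, p (single m a))
    (hadd : ∀ x y, p x → p y → p (x + y)) (x : Laur A) : p x := by
  refine AddMonoidAlgebra.induction_linear (motive := p) x ?_ hadd h
  have := h 0 0
  rwa [map_zero] at this

/-- The homomorphism induced by a homomorphism of coefficient rings. -/
def map (f : A →+* A') : Laur A →+* Laur A' := AddMonoidAlgebra.mapRingHom ℤ f

lemma coeff_map (f : A →+* A') (x : Laur A) (m : ℤ) : coeff m (map f x) = f (coeff m x) :=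
  AddMonoidAlgebra.coeff_mapRingHom f x m

lemma map_single (f : A →+* A') (m : ℤ) (a : A) : map f (single m a) = single m (f a) := by
  ext n
  rw [coeff_map, coeff_single, coeff_single]
  split_ifs <;> simp

/-- The constant Laurent polynomials. -/
def C : A →+* Laur A where
  toFun := single 0
  map_zero' := map_zero _
  map_one' := rfl
  map_add' := map_add _
  map_mul' a b := by rw [single_mul_single, add_zero]

lemma C_apply (a : A) : C a = single 0 a := rfl

/-- The inclusion of polynomials. -/
def ofPoly : Polynomial A →+* Laur A := Polynomial.toLaurent

lemma ofPoly_monomial (n : ℕ) (a : A) : ofPoly (Polynomial.monomial n a) = single n a := by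
  change Polynomial.toLaurent _ = _
  rw [← Polynomial.C_mul_X_pow_eq_monomial, Polynomial.toLaurent_C_mul_X_pow,
    ← LaurentPolynomial.single_eq_C_mul_T]
  rfl

lemma single_one_comm (m : ℤ) (x : Laur A) : x * single m 1 = single m 1 * x := by
  induction x using induction with
  | h k a => rw [single_mul_single, single_mul_single, add_comm, one_mul, mul_one]
  | hadd x y hx hy => rw [add_mul, mul_add, hx, hy]

end Ring

variable {A A' : Type*} [Ring A] [Ring A'] [Algebra ℂ⟦X⟧ A] [Algebra ℂ⟦X⟧ A']

lemma algebraMap_eq (r : ℂ⟦X⟧) : algebraMap ℂ⟦X⟧ (Laur A) r = C (algebraMap ℂ⟦X⟧ A r) := rfl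

lemma coeff_smul (r : ℂ⟦X⟧) (x : Laur A) (m : ℤ) : coeff m (r • x) = r • coeff m x := rfl

/-- The homomorphism induced by a homomorphism of coefficient algebras. -/
def mapAlg (f : A →ₐ[ℂ⟦X⟧] A') : Laur A →ₐ[ℂ⟦X⟧] Laur A' :=
  { map (f : A →+* A') with
    commutes' := fun r ↦ by
      change map (f : A →+* A') (algebraMap _ _ r) = _
      rw [algebraMap_eq, C_apply, map_single]
      change single 0 (f _) = _
      rw [f.commutes]
      rfl }

lemma mapAlg_single (f : A →ₐ[ℂ⟦X⟧] A') (m : ℤ) (a : A) :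
    mapAlg f (single m a) = single m (f a) := map_single _ _ _

lemma coeff_mapAlg (f : A →ₐ[ℂ⟦X⟧] A') (x : Laur A) (m : ℤ) :
    coeff m (mapAlg f x) = f (coeff m x) := coeff_map _ _ _

end Laur

open Laur

section LowOrder

variable {K : Type*} [Ring K] [Algebra ℂ⟦X⟧ K]

variable (K) in
/-- Laurent polynomials of order at least `d`. -/
def lowOrder (d : ℤ) : Submodule ℂ⟦X⟧ (Laur K) where
  carrier := {x | ∃ p : Polynomial K, x = single d 1 * ofPoly p}
  zero_mem' := ⟨0, by simp⟩
  add_mem' := by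
    rintro _ _ ⟨p, rfl⟩ ⟨q, rfl⟩
    exact ⟨p + q, by rw [map_add, mul_add]⟩
  smul_mem' := by
    rintro c _ ⟨p, rfl⟩
    refine ⟨Polynomial.monomial 0 (algebraMap _ K c) * p, ?_⟩
    rw [map_mul, ofPoly_monomial, Algebra.smul_def, algebraMap_eq, ← mul_assoc, ← mul_assoc,
      single_one_comm]
    rfl

omit [Algebra ℂ⟦X⟧ K] in
lemma coeff_single_mul_ofPoly (d : ℤ) (p : Polynomial K) (m : ℤ) (hm : m ≤ d) :
    coeff m (single d 1 * ofPoly p) = if m = d then p.coeff 0 else 0 := by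
  induction p using Polynomial.induction_on' with
  | add p q hp hq =>
    rw [map_add, mul_add, map_add, hp, hq, Polynomial.coeff_add]
    split_ifs <;> simp
  | monomial n a =>
    rw [ofPoly_monomial, single_mul_single, one_mul, coeff_single, Polynomial.coeff_monomial]
    rcases Nat.eq_zero_or_pos n with rfl | hn
    · simp [eq_comm]
    · rw [if_neg (by omega), if_neg hn.ne', ite_self]

lemma coeff_of_mem_lowOrder {d : ℤ} {x : Laur K} (hx : x ∈ lowOrder K d) {m : ℤ}
    (hm : m < d) : coeff m x = 0 := by
  obtain ⟨p, rfl⟩ := hx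
  rw [coeff_single_mul_ofPoly d p m hm.le, if_neg hm.ne]

omit [Algebra ℂ⟦X⟧ K] in
lemma single_mul_ofPoly_mul (d e : ℤ) (p q : Polynomial K) :
    single d 1 * ofPoly p * (single e 1 * ofPoly q) = single (d + e) 1 * ofPoly (p * q) := by
  rw [map_mul, mul_assoc, ← mul_assoc _ (single e 1), single_one_comm, mul_assoc, ← mul_assoc,
    single_mul_single, one_mul]

lemma mul_mem_lowOrder {d e : ℤ} {x y : Laur K} (hx : x ∈ lowOrder K d)
    (hy : y ∈ lowOrder K e) : x * y ∈ lowOrder K (d + e) := by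
  obtain ⟨p, rfl⟩ := hx
  obtain ⟨q, rfl⟩ := hy
  exact ⟨p * q, single_mul_ofPoly_mul d e p q⟩

/-- The coefficients at the lower ends `d` and `e` are constant terms of the polynomial factors, and
constant terms are multiplicative. This is what makes the passage to leading coefficients a
homomorphism. -/
lemma coeff_mul_of_mem_lowOrder {d e : ℤ} {x y : Laur K} (hx : x ∈ lowOrder K d)
    (hy : y ∈ lowOrder K e) : coeff (d + e) (x * y) = coeff d x * coeff e y := by
  obtain ⟨p, rfl⟩ := hx
  obtain ⟨q, rfl⟩ := hy
  rw [single_mul_ofPoly_mul, coeff_single_mul_ofPoly _ _ _ le_rfl,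
    coeff_single_mul_ofPoly _ _ _ le_rfl, coeff_single_mul_ofPoly _ _ _ le_rfl, if_pos rfl,
    if_pos rfl, if_pos rfl, Polynomial.mul_coeff_zero]

lemma lowOrder_antitone {d e : ℤ} (h : d ≤ e) : lowOrder K e ≤ lowOrder K d := by
  rintro _ ⟨p, rfl⟩
  refine ⟨Polynomial.monomial (e - d).toNat 1 * p, ?_⟩
  rw [map_mul, ofPoly_monomial, ← mul_assoc, single_mul_single, one_mul]
  congr 3
  omega

lemma single_mem_lowOrder (d : ℤ) (a : K) : single d a ∈ lowOrder K d :=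
  ⟨Polynomial.monomial 0 a, by
    rw [ofPoly_monomial, single_mul_single, one_mul, Nat.cast_zero, add_zero]⟩

/-- The coefficient of `u^(r-1)` in a product of two series pairs indices `r'` and `r''` with `r' +
r'' = r + 1`, so the order is one more than that of `t_ij^(-r)`. -/
lemma convCoeff_mem_lowOrder {N : ℕ} {x y : Fin N → Fin N → ℕ+ → Laur K}
    (hx : ∀ i j (r : ℕ+), x i j r ∈ lowOrder K (r : ℕ)) (hy : ∀ i j (r : ℕ+), y i j r ∈ lowOrder K (r : ℕ))
    (i j : Fin N) (r : ℕ+) : convCoeff x y i j r ∈ lowOrder K ((r : ℕ) + 1) := by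
  refine Submodule.sum_mem _ fun k _ ↦ ?_
  rw [PowerSeries.coeff_mul]
  refine Submodule.sum_mem _ fun p hp ↦ ?_
  rw [Finset.HasAntidiagonal.mem_antidiagonal] at hp
  have := mul_mem_lowOrder (hx i k p.1.succPNat) (hy k j p.2.succPNat)
  simp only [PowerSeries.coeff_mk]
  convert this using 2
  simp only [Nat.succPNat_coe]
  have := PNat.natPred_add_one r
  omega

end LowOrder

/-- A solution of the `RTT` relations at zero central charge in the Laurent polynomials over an
`h`-torsion-free algebra, such that `t_ij^(-r)` has order at least `r`. -/
structure GradedRep (N : ℕ) where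
  /-- The coefficient algebra. -/
  K : Type
  [ring : Ring K]
  [algebra : Algebra ℂ⟦X⟧ K]
  torsionFree : ∀ x : K, hbar K * x = 0 → x = 0
  /-- The images of the generators `t_ij^(r)`. -/
  t : Fin N → Fin N → ℕ+ → Laur K
  /-- The images of the generators `t_ij^(-r)`. -/
  t' : Fin N → Fin N → ℕ+ → Laur K
  yangian : YangianRTT t
  dual : DualRTT t'
  mixed : MixedRTT t t'
  order : ∀ i j (r : ℕ+), t' i j r ∈ lowOrder K (r : ℕ)

attribute [instance] GradedRep.ring GradedRep.algebra

lemma hbar_mul_laurent {K : Type*} [Ring K] [Algebra ℂ⟦X⟧ K] (x : Laur K) (m : ℤ) :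
    coeff m (hbar (Laur K) * x) = hbar K * coeff m x := by
  rw [hbar, ← Algebra.smul_def, coeff_smul, Algebra.smul_def, hbar]

lemma laurent_torsionFree {K : Type*} [Ring K] [Algebra ℂ⟦X⟧ K]
    (h : ∀ x : K, hbar K * x = 0 → x = 0) (x : Laur K)
    (hx : hbar (Laur K) * x = 0) : x = 0 := by
  ext m
  refine h _ ?_
  rw [← hbar_mul_laurent, hx, map_zero]

lemma matrix_torsionFree {K : Type*} [Ring K] [Algebra ℂ⟦X⟧ K] {N : ℕ}
    (h : ∀ x : K, hbar K * x = 0 → x = 0) (x : Matrix (Fin N) (Fin N) K)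
    (hx : hbar (Matrix (Fin N) (Fin N) K) * x = 0) : x = 0 := by
  ext i j
  refine h _ ?_
  have := congrFun (congrFun hx i) j
  rw [hbar, ← Algebra.smul_def, Matrix.smul_apply, Algebra.smul_def] at this
  exact this

lemma isRTT_one {S : Type*} [Ring S] {N : ℕ} (q : S) :
    IsRTT q (1 : Matrix (Fin N) (Fin N) S) 1 := by
  have h1 : leg1 (1 : Matrix (Fin N) (Fin N) S) = 1 := Matrix.one_kronecker_one
  have h2 : leg2 (1 : Matrix (Fin N) (Fin N) S) = 1 := Matrix.one_kronecker_one
  rw [IsRTT, h1, h2]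
  simp

lemma tMatrix_zero {A : Type*} [Ring A] [Algebra ℂ⟦X⟧ A] {N : ℕ} :
    tMatrix (0 : Fin N → Fin N → ℕ+ → A) = 1 := by
  have : (PowerSeries.mk fun _ ↦ 0 : A⟦X⟧) = 0 := rfl
  ext1 i j
  simp [tMatrix, this]

lemma tPlusMatrix_zero {A : Type*} [Ring A] [Algebra ℂ⟦X⟧ A] {N : ℕ} :
    tPlusMatrix (0 : Fin N → Fin N → ℕ+ → A) = 1 := by
  have : (PowerSeries.mk fun _ ↦ 0 : A⟦X⟧) = 0 := rfl
  ext1 i j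
  simp [tPlusMatrix, this]

lemma one_matrix_map {S S' : Type*} [Ring S] [Ring S'] {N : ℕ} (f : S →+* S') :
    (1 : Matrix (Fin N) (Fin N) S).map f = 1 := Matrix.map_one _ (map_zero _) (map_one _)

/-- The trivial representation. -/
def GradedRep.trivial (N : ℕ) : GradedRep N where
  K := ℂ⟦X⟧
  torsionFree x hx := by
    have : (PowerSeries.X : ℂ⟦X⟧) ≠ 0 := PowerSeries.X_ne_zero
    exact (mul_eq_zero.1 hx).resolve_left this
  t := 0
  t' := 0
  yangian := by
    rw [YangianRTT, tMatrix_zero, one_matrix_map, one_matrix_map]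
    exact isRTT_one _
  dual := by
    rw [DualRTT, tPlusMatrix_zero, one_matrix_map, one_matrix_map]
    exact isRTT_one _
  mixed := by
    rw [MixedRTT, tMatrix_zero, tPlusMatrix_zero, one_matrix_map, one_matrix_map]
    exact isRTT_one _
  order _ _ _ := zero_mem _

section Extend

/-- Laurent polynomials with matrix coefficients. -/
abbrev Slot (K : Type*) [Ring K] (N : ℕ) : Type _ := Laur (Matrix (Fin N) (Fin N) K)

variable (K : Type*) [Ring K] [Algebra ℂ⟦X⟧ K] (N : ℕ)

/-- The inclusion of `K` as constant scalar matrices. -/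
def slotIncl : K →ₐ[ℂ⟦X⟧] Slot K N :=
  { C.comp (Matrix.scalar (Fin N)) with commutes' := fun _ ↦ rfl }

/-- The inclusion of Laurent polynomials induced by `slotIncl`. -/
def extendIncl : Laur K →ₐ[ℂ⟦X⟧] Laur (Slot K N) := mapAlg (slotIncl K N)

omit [Algebra ℂ⟦X⟧ K] in
/-- The constant matrix units. -/
def extendUnit (i j : Fin N) : Laur (Slot K N) := C (C (Matrix.single i j 1))

/-- The product of the `m`-th powers of both variables. -/
def bothT (m : ℤ) : Laur (Slot K N) := single m (single m 1)

variable {K N}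

omit [Algebra ℂ⟦X⟧ K] in
lemma matrixUnit_comm_rel {S : Type*} [Ring S] (f : Matrix (Fin N) (Fin N) K →+* S)
    (i j k l : Fin N) :
    f (Matrix.single i j 1) * f (Matrix.single k l 1) -
      f (Matrix.single k l 1) * f (Matrix.single i j 1) =
    (if k = j then f (Matrix.single i l 1) else 0) -
      (if i = l then f (Matrix.single k j 1) else 0) := by
  rw [← map_mul, ← map_mul]
  by_cases h1 : j = k <;> by_cases h2 : l = i
  · subst h1 h2
    simp
  · subst h1
    simp [Matrix.single_mul_single_of_ne _ _ _ _ h2, Ne.symm h2]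
  · subst h2
    simp [Matrix.single_mul_single_of_ne _ _ _ _ h1, Ne.symm h1]
  · simp [Matrix.single_mul_single_of_ne _ _ _ _ h2, Matrix.single_mul_single_of_ne _ _ _ _ h1,
      Ne.symm h2, Ne.symm h1]

omit [Algebra ℂ⟦X⟧ K] in
lemma extendUnit_comm_rel (i j k l : Fin N) :
    extendUnit K N i j * extendUnit K N k l - extendUnit K N k l * extendUnit K N i j =
      (if k = j then extendUnit K N i l else 0) - (if i = l then extendUnit K N k j else 0) := by
  have := matrixUnit_comm_rel (S := Laur (Slot K N)) (RingHom.comp (C : Slot K N →+* Laur (Slot K N))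
    (C : Matrix (Fin N) (Fin N) K →+* Slot K N)) i j k l
  exact this

lemma slotIncl_commute (x : K) (i j : Fin N) :
    Commute (slotIncl K N x) (C (Matrix.single i j 1)) := by
  have : Commute (Matrix.scalar (Fin N) x) (Matrix.single i j 1) := by
    rw [Commute, SemiconjBy, Matrix.scalar_apply]
    ext a b
    rw [Matrix.diagonal_mul, Matrix.mul_diagonal, Matrix.single_apply]
    split_ifs <;> simp
  exact this.map C

lemma extendIncl_commute (x : Laur K) (i j : Fin N) :
    Commute (extendIncl K N x) (extendUnit K N i j) := by
  induction x using Laur.induction with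
  | hadd x y hx hy =>
    rw [map_add]
    exact hx.add_left hy
  | h m a =>
    rw [extendIncl, mapAlg_single, extendUnit, C_apply (C _), Commute, SemiconjBy,
      single_mul_single, single_mul_single, add_comm, (slotIncl_commute a i j).eq]

omit [Algebra ℂ⟦X⟧ K] in
lemma bothT_mem_center (m : ℤ) : bothT K N m ∈ Subring.center (Laur (Slot K N)) := by
  rw [Subring.mem_center_iff]
  intro x
  induction x using Laur.induction with
  | hadd x y hx hy => rw [add_mul, mul_add, hx, hy]
  | h k a => rw [bothT, single_mul_single, single_mul_single, add_comm, single_one_comm]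

omit [Algebra ℂ⟦X⟧ K] in
lemma bothT_mul (m n : ℤ) : bothT K N m * bothT K N n = bothT K N (m + n) := by
  rw [bothT, bothT, single_mul_single, single_mul_single, one_mul, bothT]

omit [Algebra ℂ⟦X⟧ K] in
lemma bothT_pow (m : ℤ) (n : ℕ) : bothT K N m ^ n = bothT K N (n * m) := by
  induction n with
  | zero => rw [pow_zero, Nat.cast_zero, zero_mul]; rfl
  | succ n ih => rw [pow_succ, ih, bothT_mul]; congr 1; push_cast; ring

omit [Algebra ℂ⟦X⟧ K] in
lemma commute_bothT_pow_mul (m : ℤ) (n : ℕ) {x y : Laur (Slot K N)} (h : Commute x y) :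
    Commute x (bothT K N m ^ n * y) :=
  (Commute.pow_right (Subring.mem_center_iff.1 (bothT_mem_center m) x) n).mul_right h

-- The inverse evaluation point is the product of the grading variable (outer) and of a new formal
-- variable (inner). The outer power records the degree; the inner power remains visible in the
-- leading coefficient.
omit [Algebra ℂ⟦X⟧ K] in
lemma evalPlus_extendUnit (i j : Fin N) (r : ℕ+) :
    evalPlus (extendUnit K N) (bothT K N 1) i j r =
      single (r : ℕ) (single (r : ℕ) (Matrix.single i j 1)) := by
  rw [evalPlus, bothT_pow, mul_one, bothT, extendUnit, C_apply, C_apply, single_mul_single,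
    single_mul_single, one_mul, add_zero]

lemma extendIncl_mem_lowOrder {d : ℤ} {x : Laur K} (hx : x ∈ lowOrder K d) :
    extendIncl K N x ∈ lowOrder (Slot K N) d := by
  obtain ⟨p, rfl⟩ := hx
  induction p using Polynomial.induction_on' with
  | add p q hp hq =>
    rw [map_add, mul_add, map_add]
    exact add_mem hp hq
  | monomial n a =>
    rw [ofPoly_monomial, single_mul_single, extendIncl, mapAlg_single]
    exact lowOrder_antitone (by omega) (single_mem_lowOrder _ _)

end Extend

section Commute

variable {B : Type*} [Ring B]

lemma commute_outer_inner {f g : B⟦X⟧}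
    (h : ∀ m n, Commute (PowerSeries.coeff m f) (PowerSeries.coeff n g)) :
    Commute (outerSer f) (innerSer g) := by
  refine ser_ext fun n m ↦ ?_
  simp only [outerSer, innerSer, RingHom.comp_apply, PowerSeries.coeff_mul_C,
    PowerSeries.coeff_C_mul, PowerSeries.coeff_map, HahnSeries.C_apply,
    HahnSeries.coeff_mul_single_zero, HahnSeries.coeff_single_zero_mul, PowerSeries.coeff_coe]
  split_ifs
  · simp
  · exact h _ _

variable [Algebra ℂ⟦X⟧ B] {N : ℕ}

lemma commute_hbar (z : B) : Commute z (hbar B) :=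
  Subring.mem_center_iff.1 (hbar_mem_center B) z

lemma commute_coeff_tMatrix {z : B} {x : Fin N → Fin N → ℕ+ → B}
    (h : ∀ i j r, Commute z (x i j r)) (i j : Fin N) (m : ℕ) :
    Commute z (PowerSeries.coeff m (tMatrix x i j)) := by
  rw [tMatrix, Matrix.of_apply, map_add, PowerSeries.coeff_C_mul]
  refine Commute.add_right ?_ ((commute_hbar z).mul_right ?_)
  · rw [Matrix.one_apply]
    split_ifs
    · rw [PowerSeries.coeff_one]
      split_ifs <;> simp
    · simp
  · cases m with
    | zero => simp
    | succ m =>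
      rw [PowerSeries.coeff_succ_X_mul, PowerSeries.coeff_mk]
      exact h _ _ _

lemma commute_coeff_tPlusMatrix {z : B} {x : Fin N → Fin N → ℕ+ → B}
    (h : ∀ i j r, Commute z (x i j r)) (i j : Fin N) (m : ℕ) :
    Commute z (PowerSeries.coeff m (tPlusMatrix x i j)) := by
  rw [tPlusMatrix, Matrix.of_apply, map_sub, PowerSeries.coeff_C_mul]
  refine Commute.sub_right ?_ ((commute_hbar z).mul_right ?_)
  · rw [Matrix.one_apply]
    split_ifs
    · rw [PowerSeries.coeff_one]
      split_ifs <;> simp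
    · simp
  · rw [PowerSeries.coeff_mk]
    exact h _ _ _

variable {x x' y y' : Fin N → Fin N → ℕ+ → B}

lemma YangianRTT.mul (hx : YangianRTT x) (hy : YangianRTT y)
    (h : ∀ i j r k l s, Commute (x i j r) (y k l s)) : YangianRTT (mulYangian x y) := by
  rw [YangianRTT, tMatrix_mulYangian, Matrix.map_mul, Matrix.map_mul]
  refine IsRTT.mul hx hy (fun i j k l ↦ commute_outer_inner fun m n ↦ ?_)
    (fun i j k l ↦ commute_outer_inner fun m n ↦ ?_)
  · exact commute_coeff_tMatrix (fun _ _ _ ↦ (commute_coeff_tMatrix (fun _ _ _ ↦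
      (h _ _ _ _ _ _)) i j m).symm) k l n
  · exact commute_coeff_tMatrix (fun _ _ _ ↦ (commute_coeff_tMatrix (fun _ _ _ ↦
      (h _ _ _ _ _ _).symm) i j m).symm) k l n

lemma DualRTT.mul (hx : DualRTT x) (hy : DualRTT y)
    (h : ∀ i j r k l s, Commute (x i j r) (y k l s)) : DualRTT (mulPlus x y) := by
  rw [DualRTT, tPlusMatrix_mulPlus, Matrix.map_mul, Matrix.map_mul]
  refine IsRTT.mul hx hy (fun i j k l ↦ (commute_outer_inner fun m n ↦ ?_).symm)
    (fun i j k l ↦ (commute_outer_inner fun m n ↦ ?_).symm)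
  · exact commute_coeff_tPlusMatrix (fun _ _ _ ↦ (commute_coeff_tPlusMatrix (fun _ _ _ ↦
      (h _ _ _ _ _ _).symm) k l m).symm) i j n
  · exact commute_coeff_tPlusMatrix (fun _ _ _ ↦ (commute_coeff_tPlusMatrix (fun _ _ _ ↦
      (h _ _ _ _ _ _)) k l m).symm) i j n

/-- Only entries in opposite tensor factors are exchanged: `y` passes `x'`, and `x` passes `y'`. -/
lemma MixedRTT.mul (hx : MixedRTT x x') (hy : MixedRTT y y')
    (h : ∀ i j r k l s, Commute (x' i j r) (y k l s))
    (h' : ∀ i j r k l s, Commute (x i j r) (y' k l s)) :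
    MixedRTT (mulYangian x y) (mulPlus x' y') := by
  rw [MixedRTT, tMatrix_mulYangian, tPlusMatrix_mulPlus, Matrix.map_mul, Matrix.map_mul]
  refine IsRTT.mul hx hy (fun i j k l ↦ commute_outer_inner fun m n ↦ ?_)
    (fun i j k l ↦ commute_outer_inner fun m n ↦ ?_)
  · exact commute_coeff_tPlusMatrix (fun _ _ _ ↦ (commute_coeff_tMatrix (fun _ _ _ ↦
      (h _ _ _ _ _ _)) i j m).symm) k l n
  · exact commute_coeff_tPlusMatrix (fun _ _ _ ↦ (commute_coeff_tMatrix (fun _ _ _ ↦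
      (h' _ _ _ _ _ _).symm) i j m).symm) k l n

end Commute

section ExtendRelations

variable {K : Type*} [Ring K] [Algebra ℂ⟦X⟧ K] {N : ℕ}

lemma commute_evalYangian (x : Laur K) (m : ℤ) (i j : Fin N) (r : ℕ+) :
    Commute (extendIncl K N x) (evalYangian (extendUnit K N) (bothT K N m) i j r) :=
  commute_bothT_pow_mul _ _ (extendIncl_commute x i j)

lemma commute_evalPlus (x : Laur K) (m : ℤ) (i j : Fin N) (r : ℕ+) :
    Commute (extendIncl K N x) (evalPlus (extendUnit K N) (bothT K N m) i j r) :=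
  commute_bothT_pow_mul _ _ (extendIncl_commute x i j)

lemma YangianRTT.extend {t : Fin N → Fin N → ℕ+ → Laur K} (h : YangianRTT t) :
    YangianRTT (mulYangian (fun i j r ↦ extendIncl K N (t i j r))
      (evalYangian (extendUnit K N) (bothT K N (-1)))) :=
  YangianRTT.mul (h.map (extendIncl K N))
    (yangianRTT_eval (bothT_mem_center _) extendUnit_comm_rel)
    fun _ _ _ _ _ _ ↦ commute_evalYangian _ _ _ _ _

lemma DualRTT.extend {t : Fin N → Fin N → ℕ+ → Laur K} (h : DualRTT t) :
    DualRTT (mulPlus (fun i j r ↦ extendIncl K N (t i j r))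
      (evalPlus (extendUnit K N) (bothT K N 1))) :=
  DualRTT.mul (h.map (extendIncl K N)) (dualRTT_eval (bothT_mem_center _) extendUnit_comm_rel)
    fun _ _ _ _ _ _ ↦ commute_evalPlus _ _ _ _ _

lemma MixedRTT.extend {t t' : Fin N → Fin N → ℕ+ → Laur K} (h : MixedRTT t t') :
    MixedRTT (mulYangian (fun i j r ↦ extendIncl K N (t i j r))
        (evalYangian (extendUnit K N) (bothT K N (-1))))
      (mulPlus (fun i j r ↦ extendIncl K N (t' i j r))
        (evalPlus (extendUnit K N) (bothT K N 1))) :=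
  MixedRTT.mul (h.map (extendIncl K N))
    (mixedRTT_eval (bothT_mem_center _) (bothT_mem_center _) extendUnit_comm_rel
      ((bothT_mul _ _).trans (by rw [neg_add_cancel]; rfl)))
    (fun _ _ _ _ _ _ ↦ commute_evalYangian _ _ _ _ _)
    fun _ _ _ _ _ _ ↦ commute_evalPlus _ _ _ _ _

end ExtendRelations

/-- The tensor product of a representation with an evaluation representation. -/
def GradedRep.extend {N : ℕ} (ρ : GradedRep N) : GradedRep N where
  K := Slot ρ.K N
  torsionFree := laurent_torsionFree (matrix_torsionFree ρ.torsionFree)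
  t := mulYangian (fun i j r ↦ extendIncl ρ.K N (ρ.t i j r))
    (evalYangian (extendUnit ρ.K N) (bothT ρ.K N (-1)))
  t' := mulPlus (fun i j r ↦ extendIncl ρ.K N (ρ.t' i j r))
    (evalPlus (extendUnit ρ.K N) (bothT ρ.K N 1))
  yangian := ρ.yangian.extend
  dual := ρ.dual.extend
  mixed := ρ.mixed.extend
  order i j r := by
    have h1 : ∀ i j (r : ℕ+), extendIncl ρ.K N (ρ.t' i j r) ∈ lowOrder (Slot ρ.K N) (r : ℕ) :=
      fun i j r ↦ extendIncl_mem_lowOrder (ρ.order i j r)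
    have h2 : ∀ i j (r : ℕ+), evalPlus (extendUnit ρ.K N)
        (bothT ρ.K N 1) i j r ∈ lowOrder (Slot ρ.K N) (r : ℕ) := fun i j r ↦ by
      rw [evalPlus_extendUnit]
      exact single_mem_lowOrder _ _
    refine sub_mem (add_mem (h1 i j r) (h2 i j r)) ?_
    rw [hbar, ← Algebra.smul_def]
    exact Submodule.smul_mem _ _ (lowOrder_antitone (by omega) (convCoeff_mem_lowOrder h1 h2 i j r))

/-- The leading coefficient of the image of `t_ij^(-r)`. -/
def GradedRep.lead {N : ℕ} (ρ : GradedRep N) (i j : Fin N) (r : ℕ+) : ρ.K :=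
  coeff (r : ℕ) (ρ.t' i j r)

/-- The quadratic term of `mulPlus` has order at least `r + 1` and does not reach the coefficient of
`T^r`. The matrix coproduct of the dual Yangian thus degenerates to the primitive coproduct of an
enveloping algebra. -/
lemma GradedRep.lead_extend {N : ℕ} (ρ : GradedRep N) (i j : Fin N) (r : ℕ+) :
    ρ.extend.lead i j r =
      slotIncl ρ.K N (ρ.lead i j r) + single (r : ℕ) (Matrix.single i j 1) := by
  have h1 : ∀ i j (r : ℕ+), extendIncl ρ.K N (ρ.t' i j r) ∈ lowOrder (Slot ρ.K N) (r : ℕ) :=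
    fun i j r ↦ extendIncl_mem_lowOrder (ρ.order i j r)
  have h2 : ∀ i j (r : ℕ+), evalPlus (extendUnit ρ.K N)
      (bothT ρ.K N 1) i j r ∈ lowOrder (Slot ρ.K N) (r : ℕ) := fun i j r ↦ by
    rw [evalPlus_extendUnit]
    exact single_mem_lowOrder _ _
  have h3 : coeff (r : ℕ) (extendIncl ρ.K N (ρ.t' i j r) + evalPlus (extendUnit ρ.K N)
      (bothT ρ.K N 1) i j r - hbar (Laur (Slot ρ.K N)) * convCoeff (fun i j r ↦
        extendIncl ρ.K N (ρ.t' i j r)) (evalPlus (extendUnit ρ.K N) (bothT ρ.K N 1)) i j r) =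
      slotIncl ρ.K N (coeff (r : ℕ) (ρ.t' i j r)) + single (r : ℕ) (Matrix.single i j 1) := by
    rw [map_sub, hbar_mul_laurent,
      coeff_of_mem_lowOrder (convCoeff_mem_lowOrder h1 h2 i j r) (by omega), mul_zero, sub_zero,
      map_add, evalPlus_extendUnit, extendIncl, coeff_mapAlg, coeff_single, if_pos rfl]
  exact h3

end

/-! ### Representations of the associated graded algebra -/

section

open Laur

section GradedHom

variable {N : ℕ} (ρ : GradedRep N)

lemma GradedRep.exists_hom : ∃ φ : DualYangian N →ₐ[ℂ⟦X⟧] Laur ρ.K,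
    ∀ i j r, φ (tMinus i j r) = ρ.t' i j r := by
  obtain ⟨φ, hφ⟩ := exists_doubleYangian_hom (laurent_torsionFree ρ.torsionFree) ρ.t ρ.t'
    (sub_eq_zero.2 ρ.yangian) (sub_eq_zero.2 ρ.dual) ρ.mixed.rttMixed_eq_zero
  exact ⟨φ.comp (dualYangian N).val, hφ⟩

/-- The homomorphism from the dual Yangian defined by a graded representation. -/
def GradedRep.hom : DualYangian N →ₐ[ℂ⟦X⟧] Laur ρ.K := ρ.exists_hom.choose

lemma GradedRep.hom_tMinus (i j : Fin N) (r : ℕ+) : ρ.hom (tMinus i j r) = ρ.t' i j r :=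
  ρ.exists_hom.choose_spec i j r

lemma one_mem_lowOrder {K : Type*} [Ring K] [Algebra ℂ⟦X⟧ K] : (1 : Laur K) ∈ lowOrder K 0 :=
  single_mem_lowOrder 0 1

lemma GradedRep.hom_monomial_mem (l : List (Fin N × Fin N × ℕ+)) :
    ρ.hom (monomialMinus l) ∈ lowOrder ρ.K (-monomialDeg l) := by
  induction l with
  | nil =>
    simp only [monomialMinus, monomialDeg, List.map_nil, List.prod_nil, List.sum_nil, map_one,
      neg_zero]
    exact one_mem_lowOrder
  | cons g l ih =>
    have h1 : monomialMinus (g :: l) = tMinus g.1 g.2.1 g.2.2 * monomialMinus l := by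
      simp [monomialMinus]
    have h2 : -monomialDeg (g :: l) = ((g.2.2 : ℕ) : ℤ) + -monomialDeg l := by
      simp [monomialDeg]
      ring
    rw [h1, h2, map_mul, hom_tMinus]
    exact mul_mem_lowOrder (ρ.order _ _ _) ih

/-- Degrees become negative orders, so the filtration step `p` has its leading coefficient at
`T^(-p)`, and step `p - 1` does not contribute there. -/
lemma GradedRep.hom_mem {p : ℤ} {x : DualYangian N} (hx : x ∈ degFiltration N p) :
    ρ.hom x ∈ lowOrder ρ.K (-p) := by
  have : degFiltration N p ≤ (lowOrder ρ.K (-p)).comap ρ.hom.toLinearMap := by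
    refine Submodule.span_le.2 ?_
    rintro _ ⟨l, hl, rfl⟩
    exact lowOrder_antitone (by omega) (ρ.hom_monomial_mem l)
  exact this hx

/-- The coefficient of `T ^ m` as a linear map. -/
def Laur.coeffₗ {K : Type*} [Ring K] [Algebra ℂ⟦X⟧ K] (m : ℤ) : Laur K →ₗ[ℂ⟦X⟧] K :=
  { coeff m with map_smul' := fun _ _ ↦ rfl }

/-- The graded component of a graded representation. -/
def GradedRep.grPieceHom (p : ℤ) : GrPiece (degFiltration N) p →ₗ[ℂ⟦X⟧] ρ.K :=
  Submodule.liftQ _ (coeffₗ (-p) ∘ₗ ρ.hom.toLinearMap ∘ₗ (degFiltration N p).subtype) (by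
    intro x hx
    have hx' : (x : DualYangian N) ∈ degFiltration N (p - 1) := hx
    exact coeff_of_mem_lowOrder (ρ.hom_mem hx') (by omega))

/-- The homomorphism from the associated graded algebra of the dual Yangian defined by a graded
representation. -/
def GradedRep.grHom : Gr (degFiltration N) →ₐ[ℂ⟦X⟧] ρ.K :=
  DirectSum.toAlgebra ℂ⟦X⟧ (GrPiece (degFiltration N)) ρ.grPieceHom
    (by
      change coeff (-0) (ρ.hom 1) = 1
      rw [map_one ρ.hom, neg_zero, ← single_zero_one, coeff_single, if_pos rfl])
    (by
      intro p q x y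
      obtain ⟨x, rfl⟩ := grMk_surjective p x
      obtain ⟨y, rfl⟩ := grMk_surjective q y
      have h := coeff_mul_of_mem_lowOrder (ρ.hom_mem x.2) (ρ.hom_mem y.2)
      change coeff (-(p + q)) (ρ.hom ((x : DualYangian N) * y)) =
        coeff (-p) (ρ.hom (x : DualYangian N)) * coeff (-q) (ρ.hom (y : DualYangian N))
      rw [← h, neg_add, map_mul ρ.hom])

lemma GradedRep.grHom_symbol (p : ℤ) (x : degFiltration N p) :
    ρ.grHom (symbol _ p x) = coeff (-p) (ρ.hom x) := by
  have h : ρ.grHom (symbol _ p x) = ρ.grPieceHom p (grMk _ p x) :=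
    DirectSum.toAddMonoid_of (fun p ↦ (ρ.grPieceHom p).toAddMonoidHom) p (grMk _ p x)
  exact h

lemma GradedRep.grHom_symbol_tMinus (i j : Fin N) (r : ℕ+) :
    ρ.grHom (symbol _ _ ⟨tMinus i j r, tMinus_mem i j r⟩) = ρ.lead i j r := by
  rw [grHom_symbol, hom_tMinus, neg_neg]
  rfl

end GradedHom

end

/-! ### Induction over the current Lie algebra -/

section Current

variable {N : ℕ}

lemma current.single_add (A B : Matrix (Fin N) (Fin N) ℂ) (r : ℕ+) :
    current.single (A + B) r = current.single A r + current.single B r :=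
  Subtype.ext (map_add (Polynomial.monomial (r : ℕ)) A B)

lemma current.single_smul (c : ℂ) (A : Matrix (Fin N) (Fin N) ℂ) (r : ℕ+) :
    current.single (c • A) r = c • current.single A r :=
  Subtype.ext (Polynomial.smul_monomial c (r : ℕ) A).symm

/-- `current.single` as a linear map. -/
def current.singleₗ (r : ℕ+) : Matrix (Fin N) (Fin N) ℂ →ₗ[ℂ] current N where
  toFun A := current.single A r
  map_add' A B := current.single_add A B r
  map_smul' c A := current.single_smul c A r

lemma current_eq_sum (a : current N) :
    a = ∑ m ∈ (a : Polynomial (Matrix (Fin N) (Fin N) ℂ)).support.attach,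
      current.single ((a : Polynomial (Matrix (Fin N) (Fin N) ℂ)).coeff m) ⟨m, Nat.pos_of_ne_zero
        fun h ↦ Polynomial.mem_support_iff.1 m.2 (by rw [h]; exact a.2)⟩ := by
  apply Subtype.ext
  rw [AddSubmonoidClass.coe_finsetSum]
  conv_lhs => rw [Polynomial.as_sum_support (a : Polynomial (Matrix (Fin N) (Fin N) ℂ)),
    ← Finset.sum_attach]
  rfl

lemma current_induction {P : current N → Prop} (h0 : P 0)
    (hadd : ∀ a b, P a → P b → P (a + b)) (h : ∀ A r, P (current.single A r)) (a : current N) :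
    P a := by
  rw [current_eq_sum a]
  exact Finset.sum_induction _ P hadd h0 fun _ _ ↦ h _ _

lemma current_induction_unit {P : current N → Prop} (h0 : P 0)
    (hadd : ∀ a b, P a → P b → P (a + b)) (hsmul : ∀ (c : ℂ) a, P a → P (c • a))
    (h : ∀ i j r, P (current.single (Matrix.single i j 1) r)) (a : current N) : P a := by
  refine current_induction h0 hadd (fun A r ↦ ?_) a
  induction A using Matrix.induction_on' with
  | h_zero =>
    rwa [← map_zero (current.singleₗ r)] at h0
  | h_add p q hp hq =>
    rw [current.single_add]
    exact hadd _ _ hp hq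
  | h_std_basis i j x =>
    have := hsmul x _ (h i j r)
    rwa [← current.single_smul, Matrix.smul_single, smul_eq_mul, mul_one] at this

end Current

/-! ### Submodules stable under the coproduct -/

section Faithful

open Polynomial

variable {N : ℕ} {E : Type*} [Ring E] [Algebra ℂ⟦X⟧ E]

lemma scal_add (c d : ℂ) : scal E (c + d) = scal E c + scal E d := by
  simp [scal]

lemma scal_mul (c d : ℂ) : scal E (c * d) = scal E c * scal E d := by
  simp [scal]

variable (E N) in
/-- Complex matrices as matrices over a `ℂ[[h]]`-algebra. -/
def constMap : Matrix (Fin N) (Fin N) ℂ →+* Matrix (Fin N) (Fin N) E :=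
  ((algebraMap ℂ⟦X⟧ E).comp PowerSeries.C).mapMatrix

lemma constMap_apply (A : Matrix (Fin N) (Fin N) ℂ) (i j : Fin N) :
    constMap N E A i j = scal E (A i j) := rfl

/-- Contraction of a polynomial with matrix coefficients against a family of elements. -/
def contract (b : ℕ → Fin N → Fin N → E) : (Matrix (Fin N) (Fin N) E)[X] →+ E where
  toFun q := q.sum fun m A ↦ ∑ i, ∑ j, A i j * b m i j
  map_zero' := Polynomial.sum_zero_index _
  map_add' p q := Polynomial.sum_add_index _ _ _ (by simp)
    (by simp [add_mul, Finset.sum_add_distrib])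

variable (b b' : ℕ → Fin N → Fin N → E)

omit [Algebra ℂ⟦X⟧ E] in
lemma contract_monomial (m : ℕ) (A : Matrix (Fin N) (Fin N) E) :
    contract b (monomial m A) = ∑ i, ∑ j, A i j * b m i j :=
  (Polynomial.sum_monomial_index (f := fun m A ↦ ∑ i, ∑ j, A i j * b m i j) A (by simp))

omit [Algebra ℂ⟦X⟧ E] in
lemma contract_C_scalar_mul (y : E) (q : (Matrix (Fin N) (Fin N) E)[X]) :
    contract b (C (Matrix.scalar (Fin N) y) * q) = y * contract b q := by
  induction q using Polynomial.induction_on' with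
  | add p q hp hq => rw [mul_add, map_add, map_add, hp, hq, mul_add]
  | monomial m A =>
    rw [C_mul_monomial, contract_monomial, contract_monomial]
    simp [Finset.mul_sum, mul_assoc, Matrix.scalar_apply, Matrix.diagonal_mul]

-- Moving `z` past the elements `b m i j` costs their commutators with `z`. For `z` and `b m i j` in
-- a Lie algebra these are again in the Lie algebra, so the error has lower degree than expected
-- from a product.
omit [Algebra ℂ⟦X⟧ E] in
lemma contract_mul_C_scalar_sub (z : E) (q : (Matrix (Fin N) (Fin N) E)[X]) :
    contract b (q * C (Matrix.scalar (Fin N) z)) - contract b q * z =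
      contract (fun m i j ↦ z * b m i j - b m i j * z) q := by
  induction q using Polynomial.induction_on' with
  | add p q hp hq => rw [add_mul, map_add, map_add, map_add, ← hp, ← hq, add_mul]; abel
  | monomial m A =>
    rw [monomial_mul_C, contract_monomial, contract_monomial, contract_monomial]
    simp [Finset.sum_mul, mul_assoc, Matrix.scalar_apply, Matrix.mul_diagonal, mul_sub]

lemma contract_mem {W M₁ : Submodule ℂ⟦X⟧ E} (hb : ∀ m i j, b m i j ∈ M₁)
    {q : (Matrix (Fin N) (Fin N) E)[X]} (hq : ∀ m i j, q.coeff m i j ∈ W) :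
    contract b q ∈ W * M₁ :=
  Submodule.sum_mem _ fun m _ ↦ Submodule.sum_mem _ fun i _ ↦ Submodule.sum_mem _ fun j _ ↦
    Submodule.mul_mem_mul (hq m i j) (hb m i j)

variable {L : Type*} [LieRing L] [LieAlgebra ℂ L]

/-- Data comparing an algebra generated by a Lie algebra `L`, which is a retract of the current Lie
algebra, with polynomials with matrix coefficients, along a homomorphism that behaves like a
coproduct. -/
structure CoproductData (N : ℕ) (E L : Type*) [Ring E] [Algebra ℂ⟦X⟧ E] [LieRing L]
    [LieAlgebra ℂ L] where
  e : L →+ E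
  e_smul : ∀ (c : ℂ) x, e (c • x) = scal E c * e x
  e_lie : ∀ x y, e ⁅x, y⁆ = e x * e y - e y * e x
  adjoin : Algebra.adjoin ℂ⟦X⟧ (Set.range e) = ⊤
  f : L → current N
  p : current N →ₗ[ℂ] L
  p_f : ∀ x, p (f x) = x
  Δ : E →+* (Matrix (Fin N) (Fin N) E)[X]
  Δ_algebraMap : ∀ r, Δ (algebraMap ℂ⟦X⟧ E r) = C (Matrix.scalar (Fin N) (algebraMap ℂ⟦X⟧ E r))
  Δ_e : ∀ x, Δ (e x) = C (Matrix.scalar (Fin N) (e x)) +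
    Polynomial.map (constMap N E) (f x : (Matrix (Fin N) (Fin N) ℂ)[X])

namespace CoproductData

variable (D : CoproductData N E L)

/-- The span of the unit and of the Lie algebra. -/
def gens : Submodule ℂ⟦X⟧ E := Submodule.span ℂ⟦X⟧ (insert 1 (Set.range D.e))

lemma one_mem_gens : 1 ∈ D.gens := Submodule.subset_span (Set.mem_insert _ _)

lemma e_mem_gens (x : L) : D.e x ∈ D.gens :=
  Submodule.subset_span (Set.mem_insert_of_mem _ ⟨x, rfl⟩)

/-- The standard filtration, with the index shifted by one. -/
def fil : ℕ → Submodule ℂ⟦X⟧ E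
  | 0 => ⊥
  | n + 1 => D.gens ^ n

lemma fil_mul_gens (n : ℕ) : D.fil n * D.gens ≤ D.fil (n + 1) := by
  cases n with
  | zero => simp [fil]
  | succ n => exact (pow_succ D.gens n).ge

lemma fil_le_succ (n : ℕ) : D.fil n ≤ D.fil (n + 1) := fun x hx ↦ by
  have := D.fil_mul_gens n (Submodule.mul_mem_mul hx D.one_mem_gens)
  rwa [mul_one] at this

/-- The elements of the Lie algebra dual to the coefficients of the matrix entries. -/
def basisElt (m : ℕ) (i j : Fin N) : E :=
  if h : 0 < m then D.e (D.p (current.single (Matrix.single i j 1) ⟨m, h⟩)) else 0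

lemma basisElt_mem (m : ℕ) (i j : Fin N) : D.basisElt m i j ∈ D.gens := by
  rw [basisElt]
  split_ifs
  · exact D.e_mem_gens _
  · exact zero_mem _

lemma commutator_mem (z : L) (m : ℕ) (i j : Fin N) :
    D.e z * D.basisElt m i j - D.basisElt m i j * D.e z ∈ D.gens := by
  rw [basisElt]
  split_ifs
  · rw [← D.e_lie]
    exact D.e_mem_gens _
  · simp

/-- The elements `basisElt` are the images of the `e_ij ⊗ t^(-m)` under `e ∘ p`, so contraction
inverts the embedding into matrix polynomials up to the retraction `p`. For `a = f z` it returns `e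
z`, the source of each unit in the eigenvalue `n` of `red_mem`. -/
lemma contract_map (a : current N) :
    contract D.basisElt (Polynomial.map (constMap N E) (a : (Matrix (Fin N) (Fin N) ℂ)[X])) =
      D.e (D.p a) := by
  induction a using current_induction_unit with
  | h0 =>
    change contract D.basisElt (Polynomial.map (constMap N E) 0) = _
    simp
  | hadd a b ha hb =>
    change contract D.basisElt (Polynomial.map (constMap N E) ((a : (Matrix (Fin N) (Fin N) ℂ)[X])
      + (b : (Matrix (Fin N) (Fin N) ℂ)[X]))) = _
    rw [Polynomial.map_add, map_add, ha, hb, map_add, map_add]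
  | hsmul c a ha =>
    have h : Polynomial.map (constMap N E) ((c • a : current N) : (Matrix (Fin N) (Fin N) ℂ)[X]) =
        C (Matrix.scalar (Fin N) (scal E c)) *
          Polynomial.map (constMap N E) (a : (Matrix (Fin N) (Fin N) ℂ)[X]) := by
      ext m i j
      rw [coeff_C_mul, coeff_map, coeff_map, Matrix.scalar_apply, Matrix.diagonal_mul,
        constMap_apply, constMap_apply, ← scal_mul]
      rfl
    rw [h, contract_C_scalar_mul, ha, map_smul, D.e_smul]
  | h i j r =>
    change contract D.basisElt (Polynomial.map (constMap N E) (monomial r (Matrix.single i j 1))) = _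
    rw [map_monomial, contract_monomial, Finset.sum_eq_single i, Finset.sum_eq_single j]
    · rw [constMap_apply, Matrix.single_apply, if_pos ⟨rfl, rfl⟩, basisElt, dif_pos r.pos]
      simp [scal]
      rfl
    · intro k _ hk
      simp [constMap_apply, hk.symm, scal]
    · simp
    · intro k _ hk
      simp [constMap_apply, hk.symm, scal]
    · simp

/-- The reduced coproduct. -/
def red : E →+ (Matrix (Fin N) (Fin N) E)[X] :=
  D.Δ.toAddMonoidHom - ((C.comp (Matrix.scalar (Fin N))).toAddMonoidHom)

lemma red_apply (x : E) : D.red x = D.Δ x - C (Matrix.scalar (Fin N) x) := rfl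

lemma red_algebraMap (r : ℂ⟦X⟧) : D.red (algebraMap ℂ⟦X⟧ E r) = 0 := by
  rw [red_apply, Δ_algebraMap, sub_self]

lemma red_smul (r : ℂ⟦X⟧) (x : E) :
    D.red (r • x) = C (Matrix.scalar (Fin N) (algebraMap ℂ⟦X⟧ E r)) * D.red x := by
  rw [red_apply, red_apply, Algebra.smul_def, map_mul, map_mul, D.Δ_algebraMap, map_mul, mul_sub]

lemma red_mul_e (y : E) (z : L) : D.red (y * D.e z) =
    C (Matrix.scalar (Fin N) y) * Polynomial.map (constMap N E) (D.f z : (Matrix (Fin N) (Fin N) ℂ)[X]) +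
    D.red y * C (Matrix.scalar (Fin N) (D.e z)) +
    D.red y * Polynomial.map (constMap N E) (D.f z : (Matrix (Fin N) (Fin N) ℂ)[X]) := by
  have h : D.Δ y = C (Matrix.scalar (Fin N) y) + D.red y := by rw [red_apply]; abel
  rw [red_apply (x := y * _), map_mul, D.Δ_e, h, map_mul, map_mul]
  noncomm_ring

lemma smul_coeff_mem {W : Submodule ℂ⟦X⟧ E} {x : E} (hx : x ∈ W) (c : ℂ) : x * scal E c ∈ W := by
  rw [scal, ← Algebra.commutes, ← Algebra.smul_def]
  exact W.smul_mem _ hx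

/-- The contracted reduced coproduct acts as an Euler operator. For `y` in `gens ^ n` and `z` in the
Lie algebra, the three terms of `red_mul_e` for `y e(z)` contract as follows: `y ⊗ f(z)` gives `y
e(z)`; `red y` times `e(z) ⊗ 1` gives `n y e(z)` up to commutators, which have lower degree; `red y`
times `f(z)` gives only lower degree. The eigenvalue grows by one with each factor. The shifted
index of `fil` makes the lower terms for `n = 0` equal to zero. -/
lemma red_mem {n : ℕ} {x : E} (hx : x ∈ D.gens ^ n) :
    (∀ m i j, (D.red x).coeff m i j ∈ D.fil n) ∧
      contract D.basisElt (D.red x) - n • x ∈ D.fil n := by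
  induction n generalizing x with
  | zero =>
    rw [pow_zero, Submodule.mem_one] at hx
    obtain ⟨r, rfl⟩ := hx
    rw [red_algebraMap]
    simp
  | succ n ih =>
    rw [pow_succ] at hx
    induction hx using Submodule.mul_induction_on' with
    | add x hx y hy h1 h2 =>
      refine ⟨fun m i j ↦ ?_, ?_⟩
      · rw [map_add, coeff_add]
        exact add_mem (h1.1 m i j) (h2.1 m i j)
      · rw [map_add, map_add, smul_add, add_sub_add_comm]
        exact add_mem h1.2 h2.2
    | mem_mul_mem y hy z hz =>
      obtain ⟨h1, h2⟩ := ih hy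
      induction hz using Submodule.span_induction with
      | zero => simp
      | add z w hz hw h1 h2 =>
        rw [mul_add]
        refine ⟨fun m i j ↦ ?_, ?_⟩
        · rw [map_add, coeff_add]
          exact add_mem (h1.1 m i j) (h2.1 m i j)
        · rw [map_add, map_add, smul_add, add_sub_add_comm]
          exact add_mem h1.2 h2.2
      | smul r z hz h =>
        rw [mul_smul_comm, red_smul]
        refine ⟨fun m i j ↦ ?_, ?_⟩
        · rw [coeff_C_mul, Matrix.scalar_apply, Matrix.diagonal_mul, ← Algebra.smul_def]
          exact Submodule.smul_mem _ _ (h.1 m i j)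
        · rw [contract_C_scalar_mul, ← Algebra.smul_def, smul_comm, ← smul_sub]
          exact Submodule.smul_mem _ _ h.2
      | mem z hz =>
        rcases hz with rfl | ⟨z, rfl⟩
        -- As `gens` contains `1`, the last factor may be trivial; the additional multiple of `y` is
        -- then of lower degree, since `y ∈ gens ^ n = fil (n + 1)`.
        · rw [mul_one]
          refine ⟨fun m i j ↦ D.fil_le_succ n (h1 m i j), ?_⟩
          rw [succ_nsmul, ← sub_sub]
          exact sub_mem (D.fil_le_succ n h2) hy
        · have hJ : ∀ m i j, (D.red y * Polynomial.map (constMap N E)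
              (D.f z : (Matrix (Fin N) (Fin N) ℂ)[X])).coeff m i j ∈ D.fil n := by
            intro m i j
            rw [coeff_mul, Matrix.sum_apply]
            refine sum_mem fun k _ ↦ ?_
            rw [Matrix.mul_apply]
            refine sum_mem fun l _ ↦ ?_
            rw [coeff_map, constMap_apply]
            exact smul_coeff_mem (h1 _ _ _) _
          rw [red_mul_e]
          refine ⟨fun m i j ↦ ?_, ?_⟩
          · rw [coeff_add, coeff_add, Matrix.add_apply, Matrix.add_apply]
            refine add_mem (add_mem ?_ ?_) (D.fil_le_succ n (hJ m i j))
            · rw [coeff_C_mul, Matrix.scalar_apply, Matrix.diagonal_mul, coeff_map, constMap_apply]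
              exact smul_coeff_mem hy _
            · rw [coeff_mul_C, Matrix.scalar_apply, Matrix.mul_diagonal]
              exact D.fil_mul_gens n (Submodule.mul_mem_mul (h1 m i j) (D.e_mem_gens z))
          · have h3 := D.fil_mul_gens n (contract_mem _ (fun m i j ↦ D.commutator_mem z m i j) h1)
            rw [← contract_mul_C_scalar_sub] at h3
            have h4 := D.fil_mul_gens n (contract_mem _ D.basisElt_mem hJ)
            have h5 := D.fil_mul_gens n (Submodule.mul_mem_mul h2 (D.e_mem_gens z))
            rw [map_add, map_add, contract_C_scalar_mul, contract_map, D.p_f]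
            convert add_mem (add_mem h3 h4) h5 using 1
            rw [sub_mul, smul_mul_assoc, succ_nsmul]
            abel

lemma exists_mem_gens_pow (x : E) : ∃ n, x ∈ D.gens ^ n := by
  have hx : x ∈ Algebra.adjoin ℂ⟦X⟧ (Set.range D.e) := by rw [D.adjoin]; trivial
  have hle : ∀ {m n : ℕ}, m ≤ n → D.gens ^ m ≤ D.gens ^ n := by
    intro m n h
    exact pow_le_pow_right' (Submodule.one_le.2 D.one_mem_gens) h
  induction hx using Algebra.adjoin_induction with
  | mem x hx =>
    obtain ⟨z, rfl⟩ := hx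
    exact ⟨1, by rw [pow_one]; exact D.e_mem_gens z⟩
  | algebraMap r => exact ⟨0, by rw [pow_zero]; exact Submodule.mem_one.2 ⟨r, rfl⟩⟩
  | add x y _ _ hx hy =>
    obtain ⟨m, hm⟩ := hx
    obtain ⟨n, hn⟩ := hy
    exact ⟨max m n, add_mem (hle (le_max_left _ _) hm) (hle (le_max_right _ _) hn)⟩
  | mul x y _ _ hx hy =>
    obtain ⟨m, hm⟩ := hx
    obtain ⟨n, hn⟩ := hy
    exact ⟨m + n, by rw [pow_add]; exact Submodule.mul_mem_mul hm hn⟩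

/-- A submodule that is stable under the coproduct and meets the scalars trivially is zero. -/
theorem eq_zero_of_stable (D : CoproductData N E L) (K : Submodule ℂ⟦X⟧ E)
    (hK : ∀ x ∈ K, ∀ m i j, (D.Δ x).coeff m i j ∈ K)
    (h0 : ∀ r, algebraMap ℂ⟦X⟧ E r ∈ K → algebraMap ℂ⟦X⟧ E r = 0) {x : E} (hx : x ∈ K) : x = 0 := by
  obtain ⟨n, hn⟩ := D.exists_mem_gens_pow x
  induction n generalizing x with
  | zero =>
    rw [pow_zero, Submodule.mem_one] at hn
    obtain ⟨r, rfl⟩ := hn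
    exact h0 r hx
  | succ n ih =>
    obtain ⟨h1, h2⟩ := D.red_mem hn
    -- The coefficients of `red x` lie in `K`, because `K` is stable and contains `x`, and they lie
    -- in `gens ^ n`. The induction hypothesis annihilates them.
    have h3 : D.red x = 0 := by
      ext m i j
      refine ih ?_ (h1 m i j)
      rw [red_apply, coeff_sub, Matrix.sub_apply]
      refine sub_mem (hK x hx m i j) ?_
      rw [coeff_C]
      split_ifs
      · rw [Matrix.scalar_apply, Matrix.diagonal_apply]
        split_ifs
        · exact hx
        · exact zero_mem _
      · exact zero_mem _
    -- The Euler formula now says that `(n + 1) x` is in `gens ^ n`, and `n + 1` is invertible in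
    -- `ℂ`.
    rw [h3, map_zero, zero_sub, neg_mem_iff] at h2
    refine ih hx ?_
    have h4 := Submodule.smul_mem _ (PowerSeries.C ((n : ℂ) + 1)⁻¹) h2
    have h5 : (PowerSeries.C ((n : ℂ) + 1)⁻¹ : ℂ⟦X⟧) • ((n + 1) • x) = x := by
      rw [← Nat.cast_smul_eq_nsmul ℂ⟦X⟧, smul_smul]
      have : (((n + 1 : ℕ) : ℂ⟦X⟧)) = PowerSeries.C ((n : ℂ) + 1) := by simp
      rw [this, ← map_mul, inv_mul_cancel₀ (by exact_mod_cast n.succ_ne_zero), map_one, one_smul]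
    rwa [h5] at h4

end CoproductData

end Faithful

/-- The algebra `U(L) ⊗ ℂ[[h]]`, with the `ℂ[[h]]`-algebra structure as the only source of algebraic
instances. -/
def Env (L : Type*) [LieRing L] [LieAlgebra ℂ L] : Type _ :=
  ℂ⟦X⟧ ⊗[ℂ] UniversalEnvelopingAlgebra ℂ L

/-! ### Enveloping algebras over `ℂ[[h]]` and their coproducts -/

namespace Env

section Basic

variable {L : Type*} [LieRing L] [LieAlgebra ℂ L]

instance : Ring (Env L) := inferInstanceAs (Ring (ℂ⟦X⟧ ⊗[ℂ] UniversalEnvelopingAlgebra ℂ L))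

instance : Algebra ℂ⟦X⟧ (Env L) :=
  inferInstanceAs (Algebra ℂ⟦X⟧ (ℂ⟦X⟧ ⊗[ℂ] UniversalEnvelopingAlgebra ℂ L))

/-- The inclusion of the enveloping algebra. -/
def ofU : UniversalEnvelopingAlgebra ℂ L →+* Env L :=
  let f : UniversalEnvelopingAlgebra ℂ L →+* ℂ⟦X⟧ ⊗[ℂ] UniversalEnvelopingAlgebra ℂ L :=
    (Algebra.TensorProduct.includeRight : UniversalEnvelopingAlgebra ℂ L →ₐ[ℂ]
      ℂ⟦X⟧ ⊗[ℂ] UniversalEnvelopingAlgebra ℂ L).toRingHom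
  f

lemma ofU_smul (c : ℂ) (u : UniversalEnvelopingAlgebra ℂ L) : ofU (c • u) = scal (Env L) c * ofU u := by
  rw [Algebra.smul_def, map_mul]
  congr 1
  have h := (Algebra.TensorProduct.includeRight : UniversalEnvelopingAlgebra ℂ L →ₐ[ℂ]
    ℂ⟦X⟧ ⊗[ℂ] UniversalEnvelopingAlgebra ℂ L).commutes c
  exact h

lemma smul_ofU (r : ℂ⟦X⟧) (u : UniversalEnvelopingAlgebra ℂ L) :
    r • ofU u = (r ⊗ₜ[ℂ] u : ℂ⟦X⟧ ⊗[ℂ] UniversalEnvelopingAlgebra ℂ L) := by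
  refine (TensorProduct.smul_tmul' (R := ℂ) r (1 : ℂ⟦X⟧) u).trans ?_
  rw [smul_eq_mul, mul_one]

/-- The inclusion of the Lie algebra. -/
def ι : L →+ Env L :=
  ofU.toAddMonoidHom.comp (UniversalEnvelopingAlgebra.ι ℂ).toLinearMap.toAddMonoidHom

lemma ι_apply (x : L) : ι x = ofU (UniversalEnvelopingAlgebra.ι ℂ x) := rfl

lemma ι_smul (c : ℂ) (x : L) : ι (c • x) = scal (Env L) c * ι x := by
  rw [ι_apply, ι_apply, map_smul, ofU_smul]

lemma ι_lie (x y : L) : ι ⁅x, y⁆ = ι x * ι y - ι y * ι x := by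
  rw [ι_apply, LieHom.map_lie, Ring.lie_def, map_sub, map_mul, map_mul]
  rfl

lemma adjoin_ι : Algebra.adjoin ℂ⟦X⟧ (Set.range (ι : L →+ Env L)) = ⊤ := by
  rw [eq_top_iff]
  rintro x -
  have key : ∀ u : UniversalEnvelopingAlgebra ℂ L, ofU u ∈
        Algebra.adjoin ℂ⟦X⟧ (Set.range (ι : L →+ Env L)) := by
    intro u
    obtain ⟨u, rfl⟩ : ∃ v, UniversalEnvelopingAlgebra.mkAlgHom ℂ L v = u :=
      Quotient.exists_rep u
    induction u using TensorAlgebra.induction with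
    | algebraMap c =>
      rw [AlgHom.commutes, Algebra.algebraMap_eq_smul_one, ofU_smul, map_one, mul_one]
      exact Subalgebra.algebraMap_mem _ _
    | ι x => exact Algebra.subset_adjoin ⟨x, rfl⟩
    | mul a b ha hb =>
      rw [map_mul, map_mul]
      exact mul_mem ha hb
    | add a b ha hb =>
      rw [map_add, map_add]
      exact add_mem ha hb
  refine TensorProduct.induction_on (R := ℂ) (M := ℂ⟦X⟧) (N := UniversalEnvelopingAlgebra ℂ L)
    (motive := fun x ↦ x ∈ Algebra.adjoin ℂ⟦X⟧ (Set.range (ι : L →+ Env L))) x (zero_mem _)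
    (fun r u ↦ ?_) fun x y hx hy ↦ add_mem hx hy
  have := Subalgebra.smul_mem _ (key u) r
  rwa [smul_ofU] at this

variable {B : Type*} [Ring B]

lemma hom_ext {F F' : Env L →+* B}
    (h : ∀ r, F (algebraMap ℂ⟦X⟧ _ r) = F' (algebraMap ℂ⟦X⟧ _ r)) (h' : ∀ x, F (ι x) = F' (ι x)) :
    F = F' := by
  ext x
  have hx : x ∈ Algebra.adjoin ℂ⟦X⟧ (Set.range (ι : L →+ Env L)) := by rw [adjoin_ι]; trivial
  induction hx using Algebra.adjoin_induction with
  | mem x hx =>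
    obtain ⟨z, rfl⟩ := hx
    exact h' z
  | algebraMap r => exact h r
  | add x y _ _ hx hy => rw [map_add, map_add, hx, hy]
  | mul x y _ _ hx hy => rw [map_mul, map_mul, hx, hy]

variable [Algebra ℂ⟦X⟧ B]

lemma exists_lift (φ : L →+ B) (hsmul : ∀ (c : ℂ) x, φ (c • x) = scal B c * φ x)
    (hlie : ∀ x y, φ ⁅x, y⁆ = φ x * φ y - φ y * φ x) :
    ∃ F : Env L →ₐ[ℂ⟦X⟧] B, ∀ x, F (ι x) = φ x := by
  -- The universal property of the enveloping algebra is over `ℂ`; the structure used is the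
  -- restriction of scalars along `ℂ → ℂ[[h]]`.
  let _ : Algebra ℂ B := Algebra.compHom B (PowerSeries.C : ℂ →+* ℂ⟦X⟧)
  have _ : IsScalarTower ℂ ℂ⟦X⟧ B := IsScalarTower.of_algebraMap_eq fun _ ↦ rfl
  let φ' : L →ₗ⁅ℂ⁆ B :=
    { φ with
      map_smul' := fun c x ↦ (hsmul c x).trans (Algebra.smul_def _ _).symm
      map_lie' := fun {x y} ↦ hlie x y }
  let F : ℂ⟦X⟧ ⊗[ℂ] UniversalEnvelopingAlgebra ℂ L →ₐ[ℂ⟦X⟧] B :=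
    Algebra.TensorProduct.lift (Algebra.ofId ℂ⟦X⟧ B) (UniversalEnvelopingAlgebra.lift ℂ φ')
      fun r x ↦ Algebra.commutes _ _
  refine ⟨F, fun x ↦ ?_⟩
  have h : F (ι x) = Algebra.ofId ℂ⟦X⟧ B 1 *
      UniversalEnvelopingAlgebra.lift ℂ φ' (UniversalEnvelopingAlgebra.ι ℂ x) := rfl
  refine h.trans ?_
  rw [map_one, one_mul, UniversalEnvelopingAlgebra.lift_ι_apply]
  rfl

/-- The augmentation, which kills the Lie algebra, is a left inverse. -/
lemma algebraMap_injective : Function.Injective (algebraMap ℂ⟦X⟧ (Env L)) := by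
  obtain ⟨F, hF⟩ := exists_lift (L := L) (B := ℂ⟦X⟧) 0 (by simp) (by simp)
  intro r s h
  have := congrArg F h
  rwa [F.commutes, F.commutes] at this

end Basic

section Coproduct

open Polynomial

variable {N : ℕ} {E : Type*} [Ring E] [Algebra ℂ⟦X⟧ E] {L : Type*} [LieRing L] [LieAlgebra ℂ L]

lemma commute_constMap (x : E) (q : (Matrix (Fin N) (Fin N) ℂ)[X]) :
    Commute (C (Matrix.scalar (Fin N) x)) (Polynomial.map (constMap N E) q) := by
  rw [Commute, SemiconjBy]
  ext m i j
  rw [coeff_C_mul, coeff_mul_C, Matrix.scalar_apply, Matrix.diagonal_mul, Matrix.mul_diagonal,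
    coeff_map, constMap_apply]
  exact (Algebra.commutes _ _).symm

/-- The values of the coproduct on the Lie algebra. -/
def coprodMap (e : L →+ E) (f : L →ₗ⁅ℂ⁆ current N) : L →+ (Matrix (Fin N) (Fin N) E)[X] where
  toFun x := C (Matrix.scalar (Fin N) (e x)) +
    Polynomial.map (constMap N E) (f x : (Matrix (Fin N) (Fin N) ℂ)[X])
  map_zero' := by simp
  map_add' x y := by
    rw [map_add, map_add, map_add, map_add, AddSubmonoid.coe_add, Polynomial.map_add]
    abel

lemma coprodMap_smul {e : L →+ E} (he : ∀ (c : ℂ) x, e (c • x) = scal E c * e x)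
    (f : L →ₗ⁅ℂ⁆ current N) (c : ℂ) (x : L) : coprodMap e f (c • x) =
      C (Matrix.scalar (Fin N) (scal E c)) * coprodMap e f x := by
  change C (Matrix.scalar (Fin N) (e (c • x))) + Polynomial.map (constMap N E)
    (f (c • x) : (Matrix (Fin N) (Fin N) ℂ)[X]) = C (Matrix.scalar (Fin N) (scal E c)) *
    (C (Matrix.scalar (Fin N) (e x)) + Polynomial.map (constMap N E)
    (f x : (Matrix (Fin N) (Fin N) ℂ)[X]))
  rw [he, mul_add, map_mul, map_mul, map_smul]
  congr 1
  ext m i j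
  rw [coeff_C_mul, coeff_map, coeff_map, Matrix.scalar_apply, Matrix.diagonal_mul,
    constMap_apply, constMap_apply, ← scal_mul]
  rfl

lemma coprodMap_lie {e : L →+ E} (he : ∀ x y, e ⁅x, y⁆ = e x * e y - e y * e x)
    (f : L →ₗ⁅ℂ⁆ current N) (x y : L) : coprodMap e f ⁅x, y⁆ =
      coprodMap e f x * coprodMap e f y - coprodMap e f y * coprodMap e f x := by
  have h : (f ⁅x, y⁆ : (Matrix (Fin N) (Fin N) ℂ)[X]) = (f x : (Matrix (Fin N) (Fin N) ℂ)[X]) * f y -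
      f y * f x := by
    rw [LieHom.map_lie]
    rfl
  change C (Matrix.scalar (Fin N) (e _)) + Polynomial.map (constMap N E) _ =
    (C (Matrix.scalar (Fin N) (e x)) + Polynomial.map (constMap N E) _) *
    (C (Matrix.scalar (Fin N) (e y)) + Polynomial.map (constMap N E) _) -
    (C (Matrix.scalar (Fin N) (e y)) + Polynomial.map (constMap N E) _) *
    (C (Matrix.scalar (Fin N) (e x)) + Polynomial.map (constMap N E) _)
  rw [h, he, map_sub, map_sub, map_mul, map_mul, map_mul, map_mul, Polynomial.map_sub,
    Polynomial.map_mul, Polynomial.map_mul]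
  simp only [mul_add, add_mul]
  rw [(commute_constMap (e y) _).eq, (commute_constMap (e x) _).eq]
  abel

variable (f : L →ₗ⁅ℂ⁆ current N)

/-- This is the comultiplication, with the second tensor factor represented by matrix polynomials
through `f`. Complex matrix polynomials commute with scalar matrices over `Env L`, so the sum of the
two Lie homomorphisms is again one. -/
lemma exists_coprod : ∃ F : Env L →+* (Matrix (Fin N) (Fin N) (Env L))[X],
    (∀ r, F (algebraMap ℂ⟦X⟧ _ r) = C (Matrix.scalar (Fin N) (algebraMap ℂ⟦X⟧ _ r))) ∧
      ∀ x, F (ι x) = coprodMap ι f x := by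
  obtain ⟨F, hF⟩ := exists_lift (L := L) (coprodMap ι f) (coprodMap_smul ι_smul f)
    (coprodMap_lie ι_lie f)
  exact ⟨F, F.commutes, hF⟩

/-- The coproduct of `U(L) ⊗ ℂ[[h]]` with values in polynomials with matrix coefficients. -/
def coproductData (p : current N →ₗ[ℂ] L) (hp : ∀ x, p (f x) = x) :
    CoproductData N (Env L) L where
  e := ι
  e_smul := ι_smul
  e_lie := ι_lie
  adjoin := adjoin_ι
  f := f
  p := p
  p_f := hp
  Δ := (exists_coprod f).choose
  Δ_algebraMap := (exists_coprod f).choose_spec.1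
  Δ_e := (exists_coprod f).choose_spec.2

/-- Homomorphisms of Lie algebras compatible with embeddings into the current Lie algebra induce
injective homomorphisms. -/
lemma injective_of_comp {L' : Type*} [LieRing L'] [LieAlgebra ℂ L'] (p : current N →ₗ[ℂ] L)
    (hp : ∀ x, p (f x) = x) (f' : L' →ₗ⁅ℂ⁆ current N) (g : L → L') (hg : ∀ x, f' (g x) = f x)
    (F : Env L →ₐ[ℂ⟦X⟧] Env L') (hF : ∀ x, F (ι x) = ι (g x)) : Function.Injective F := by
  obtain ⟨F', h1, h2⟩ := exists_coprod f'
  let D := coproductData f p hp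
  -- `F` intertwines the two coproducts because `f' ∘ g = f`; hence its kernel is stable under the
  -- coproduct of `Env L`.
  have hc : F'.comp (F : Env L →+* Env L') =
      (Polynomial.mapRingHom (F : Env L →+* Env L').mapMatrix).comp D.Δ := by
    refine hom_ext (fun r ↦ ?_) fun x ↦ ?_
    · simp only [RingHom.comp_apply, RingHom.coe_coe, F.commutes, h1, D.Δ_algebraMap,
        coe_mapRingHom, Polynomial.map_C]
      congr 1
      ext i j
      simp only [RingHom.mapMatrix_apply, Matrix.map_apply, Matrix.scalar_apply,
        Matrix.diagonal_apply]
      split_ifs <;> simp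
    · have h3 : D.Δ (ι x) = _ := D.Δ_e x
      simp only [RingHom.comp_apply, RingHom.coe_coe, hF, h2, h3, coe_mapRingHom,
        Polynomial.map_add, Polynomial.map_C, Polynomial.map_map]
      change C _ + Polynomial.map _ _ = _
      rw [hg]
      congr 1
      · congr 1
        ext i j
        simp only [RingHom.mapMatrix_apply, Matrix.map_apply, Matrix.scalar_apply,
          Matrix.diagonal_apply]
        split_ifs
        · exact (hF x).symm
        · simp
      · congr 1
        ext A i j
        exact (F.commutes _).symm
  rw [injective_iff_map_eq_zero]
  intro x hx
  refine D.eq_zero_of_stable (LinearMap.ker F.toLinearMap) (fun y hy m i j ↦ ?_) (fun r hr ↦ ?_) hx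
  · have h4 := congrArg (fun q ↦ q.coeff m i j) (RingHom.congr_fun hc y)
    have hy' : F y = 0 := hy
    simp only [RingHom.comp_apply, RingHom.coe_coe, hy', map_zero, coe_mapRingHom, coeff_map,
      coeff_zero, RingHom.mapMatrix_apply, Matrix.map_apply, Matrix.zero_apply] at h4
    exact h4.symm
  · have hr' : F (algebraMap ℂ⟦X⟧ _ r) = 0 := hr
    rw [F.commutes] at hr'
    rw [algebraMap_injective (hr'.trans (map_zero _).symm), map_zero]

end Coproduct

end Env

/-- `envInclusion` between the algebras `Env`. -/
def envIncl {N : ℕ} (G : GL (Fin N) ℂ) : Env (twistedCurrent G) →ₐ[ℂ⟦X⟧] Env (current N) :=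
  envInclusion G

lemma envIncl_ι {N : ℕ} (G : GL (Fin N) ℂ) (x : twistedCurrent G) :
    envIncl G (Env.ι x) = Env.ι (x : current N) := by
  have h : envIncl G (Env.ι x) = ((1 : ℂ⟦X⟧) ⊗ₜ[ℂ] UniversalEnvelopingAlgebra.lift ℂ
      ((UniversalEnvelopingAlgebra.ι ℂ).comp (twistedCurrent G).incl)
        (UniversalEnvelopingAlgebra.ι ℂ x) :
        ℂ⟦X⟧ ⊗[ℂ] UniversalEnvelopingAlgebra ℂ (current N)) := rfl
  rw [h, UniversalEnvelopingAlgebra.lift_ι_apply]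
  rfl

/-- A linear complement of the Lie subalgebra provides the retraction `p`. It need not respect
brackets, as the contraction argument uses `p` only linearly. -/
lemma envIncl_injective {N : ℕ} (G : GL (Fin N) ℂ) : Function.Injective (envIncl G) := by
  obtain ⟨p, hp⟩ := LinearMap.exists_leftInverse_of_injective
    ((twistedCurrent G).incl : twistedCurrent G →ₗ[ℂ] current N)
    (LinearMap.ker_eq_bot.2 Subtype.val_injective)
  exact Env.injective_of_comp (twistedCurrent G).incl p (LinearMap.congr_fun hp) LieHom.id
    (fun x ↦ x) (fun _ ↦ rfl) _ (envIncl_ι G)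

/-! ### Commutation relations of the `t_ij^(-r)` -/

section DualRelation

variable {A B : Type*} [Ring A] [Ring B] [Algebra ℂ⟦X⟧ A] [Algebra ℂ⟦X⟧ B] {N : ℕ}

variable (A) in
omit [Algebra ℂ⟦X⟧ A] in
lemma wDual_mem_center : wDual A ∈ Subring.center (Ser A) := by
  rw [wDual_eq]
  exact mul_mem (inner_mem_center (-1)) (geo_single_mem_center _)

omit [Algebra ℂ⟦X⟧ A] in
lemma coeff_inner_mul_outer (f g : A⟦X⟧) (r s : ℕ) :
    (PowerSeries.coeff s (innerSer f * outerSer g)).coeff (r : ℤ) =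
      PowerSeries.coeff r f * PowerSeries.coeff s g := by
  simp only [outerSer, innerSer, RingHom.comp_apply, PowerSeries.coeff_C_mul,
    PowerSeries.coeff_map, HahnSeries.C_apply, HahnSeries.coeff_mul_single_zero]
  simp [PowerSeries.coeff_coe]

omit [Algebra ℂ⟦X⟧ A] in
lemma coeff_outer_mul_inner (f g : A⟦X⟧) (r s : ℕ) :
    (PowerSeries.coeff s (outerSer g * innerSer f)).coeff (r : ℤ) =
      PowerSeries.coeff s g * PowerSeries.coeff r f := by
  simp only [outerSer, innerSer, RingHom.comp_apply, PowerSeries.coeff_mul_C,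
    PowerSeries.coeff_map, HahnSeries.C_apply, HahnSeries.coeff_single_zero_mul]
  simp [PowerSeries.coeff_coe]

omit [Algebra ℂ⟦X⟧ A] in
lemma coeff_wDual_mul (x : Ser A) (r s : ℕ) :
    (PowerSeries.coeff s (wDual A * x)).coeff (r : ℤ) =
      ∑ p ∈ Finset.HasAntidiagonal.antidiagonal s,
        (PowerSeries.coeff p.2 x).coeff ((r + p.1 + 1 : ℕ) : ℤ) := by
  rw [PowerSeries.coeff_mul, HahnSeries.coeff_sum]
  refine Finset.sum_congr rfl fun p _ ↦ ?_
  rw [wDual, PowerSeries.coeff_mk, HahnSeries.coeff_single_mul, one_mul]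
  congr 1
  push_cast
  ring

omit [Algebra ℂ⟦X⟧ A] in
lemma coeff_constSer_mul (a : A) (x : Ser A) (r : ℤ) (s : ℕ) :
    (PowerSeries.coeff s (constSer a * x)).coeff r = a * (PowerSeries.coeff s x).coeff r := by
  rw [constSer, RingHom.comp_apply, PowerSeries.coeff_C_mul, HahnSeries.C_apply,
    HahnSeries.coeff_single_zero_mul]

/-- The coefficients of `T⁺(u)`. -/
def plusCoeff (t : Fin N → Fin N → ℕ+ → A) (i j : Fin N) (a : ℕ) : A :=
  PowerSeries.coeff a (tPlusMatrix t i j)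

lemma plusCoeff_succ (t : Fin N → Fin N → ℕ+ → A) (i j : Fin N) (a : ℕ) :
    plusCoeff t i j (a + 1) = -(hbar A * t i j (a + 1).succPNat) := by
  rw [plusCoeff, tPlusMatrix, Matrix.of_apply, map_sub, PowerSeries.coeff_C_mul,
    PowerSeries.coeff_mk, Matrix.one_apply]
  split_ifs <;> simp [PowerSeries.coeff_one]

lemma plusCoeff_eq (t : Fin N → Fin N → ℕ+ → A) (i j : Fin N) (a : ℕ) :
    plusCoeff t i j a = (if a = 0 then if i = j then 1 else 0 else 0) -
      hbar A * t i j a.succPNat := by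
  rw [plusCoeff, tPlusMatrix, Matrix.of_apply, map_sub, PowerSeries.coeff_C_mul,
    PowerSeries.coeff_mk, Matrix.one_apply]
  split_ifs with h1 h2 h2 <;> simp [PowerSeries.coeff_one, h2]

/-- The difference of the two sides of the ternary relation for the coefficients of `T⁺`. -/
def plusComm (t : Fin N → Fin N → ℕ+ → A) (i j k l : Fin N) (r s : ℕ) : A :=
  plusCoeff t i j r * plusCoeff t k l s - plusCoeff t k l s * plusCoeff t i j r -
    hbar A * ∑ p ∈ Finset.HasAntidiagonal.antidiagonal s,
      (plusCoeff t k j (r + p.1 + 1) * plusCoeff t i l p.2 -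
        plusCoeff t k j p.2 * plusCoeff t i l (r + p.1 + 1))

lemma coeff_rttDual (t : Fin N → Fin N → ℕ+ → A) (i j k l : Fin N) (r s : ℕ) :
    (PowerSeries.coeff s (rttDual t (i, k) (j, l))).coeff (r : ℤ) = plusComm t i j k l r s := by
  have h := IsRTT.sub_apply (mul_mem (constSer_mem_center (hbar_mem_center A)) (wDual_mem_center A))
    ((tPlusMatrix t).map innerSer) ((tPlusMatrix t).map outerSer) i j k l
  have h' : rttDual t (i, k) (j, l) = _ := h
  rw [h', mul_assoc]
  simp only [map_sub, HahnSeries.coeff_sub, Matrix.map_apply, coeff_constSer_mul, coeff_wDual_mul,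
    coeff_inner_mul_outer, coeff_outer_mul_inner, mul_sub, plusComm, plusCoeff,
    Finset.sum_sub_distrib]

/-- The difference of the two sides of the commutation relation of the `t_ij^(-r)`. -/
def dualComm (t : Fin N → Fin N → ℕ+ → A) (i j k l : Fin N) (r s : ℕ) : A :=
  t i j r.succPNat * t k l s.succPNat - t k l s.succPNat * t i j r.succPNat -
    ((if k = j then t i l (r + s + 1).succPNat else 0) -
      (if i = l then t k j (r + s + 1).succPNat else 0)) -
    hbar A * ∑ p ∈ Finset.HasAntidiagonal.antidiagonal s,
      (t k j (r + p.1 + 1).succPNat * t i l p.2.succPNat -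
        t k j p.2.succPNat * t i l (r + p.1 + 1).succPNat)

/-- All coefficients of `T⁺` carry a factor `h` except for the deltas in the constant terms. In a
commutator the deltas drop out. In the exchange sum the index `r + p.1 + 1` is positive, so a delta
can occur only in the other factor, at `p = (s, 0)`; with the `h` in front of the sum it yields the
terms linear in `t`, again with factor `h²`. -/
lemma hbar_sq_mul_dualComm (t : Fin N → Fin N → ℕ+ → A) (i j k l : Fin N) (r s : ℕ) :
    hbar A ^ 2 * dualComm t i j k l r s = plusComm t i j k l r s := by
  have hc : ∀ x : A, x * hbar A = hbar A * x := Subring.mem_center_iff.1 (hbar_mem_center A)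
  have h0 : (s, 0) ∈ Finset.HasAntidiagonal.antidiagonal s := by
    rw [Finset.HasAntidiagonal.mem_antidiagonal]; rfl
  have e : ∑ p ∈ Finset.HasAntidiagonal.antidiagonal s,
      (plusCoeff t k j (r + p.1 + 1) * plusCoeff t i l p.2 -
        plusCoeff t k j p.2 * plusCoeff t i l (r + p.1 + 1)) =
      hbar A ^ 2 * ∑ p ∈ Finset.HasAntidiagonal.antidiagonal s,
      (t k j (r + p.1 + 1).succPNat * t i l p.2.succPNat -
        t k j p.2.succPNat * t i l (r + p.1 + 1).succPNat) +
      hbar A * ((if k = j then t i l (r + s + 1).succPNat else 0) -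
      (if i = l then t k j (r + s + 1).succPNat else 0)) := by
    have e1 : ∀ p ∈ Finset.HasAntidiagonal.antidiagonal s,
      (plusCoeff t k j (r + p.1 + 1) * plusCoeff t i l p.2 -
        plusCoeff t k j p.2 * plusCoeff t i l (r + p.1 + 1)) =
      hbar A ^ 2 * (t k j (r + p.1 + 1).succPNat * t i l p.2.succPNat -
        t k j p.2.succPNat * t i l (r + p.1 + 1).succPNat) +
      if p = (s, 0) then hbar A * ((if k = j then t i l (r + s + 1).succPNat else 0) -
        (if i = l then t k j (r + s + 1).succPNat else 0)) else 0 := by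
      rintro ⟨a, b⟩ hp
      rw [Finset.HasAntidiagonal.mem_antidiagonal] at hp
      simp only at hp
      rw [plusCoeff_succ, plusCoeff_succ, plusCoeff_eq, plusCoeff_eq, pow_two]
      have m : ∀ x y : A, hbar A * x * (hbar A * y) = hbar A * hbar A * (x * y) := by
        intro x y
        rw [mul_assoc, ← mul_assoc x, hc, mul_assoc, mul_assoc]
      by_cases hb : b = 0
      · have ha : a = s := by omega
        subst ha hb
        simp only [if_true, neg_mul, mul_neg, mul_sub, sub_mul, m]
        split_ifs <;> simp <;> abel
      · have hb' : ((a, b) : ℕ × ℕ) ≠ (s, 0) := fun h ↦ hb (congrArg Prod.snd h)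
        simp only [if_neg hb, if_neg hb', zero_sub, neg_mul_neg, m, mul_sub, add_zero]
    rw [Finset.sum_congr rfl e1, Finset.sum_add_distrib, ← Finset.mul_sum,
      Finset.sum_ite_eq' _ _ _, if_pos h0]
  rw [plusComm, e, dualComm, plusCoeff_eq, plusCoeff_eq]
  generalize ∑ p ∈ Finset.HasAntidiagonal.antidiagonal s,
      (t k j (r + p.1 + 1).succPNat * t i l p.2.succPNat -
        t k j p.2.succPNat * t i l (r + p.1 + 1).succPNat) = Q
  generalize ((if k = j then t i l (r + s + 1).succPNat else 0) -
      (if i = l then t k j (r + s + 1).succPNat else 0)) = Q'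
  generalize t i j r.succPNat = x
  generalize t k l s.succPNat = y
  have m : ∀ x y : A, hbar A * x * (hbar A * y) = hbar A * hbar A * (x * y) := by
    intro x y
    rw [mul_assoc, ← mul_assoc x, hc, mul_assoc, mul_assoc]
  have hd : ∀ (P P' : Prop) [Decidable P] [Decidable P'] (z : A),
      z * (if P then if P' then (1 : A) else 0 else 0) =
      (if P then if P' then (1 : A) else 0 else 0) * z := by
    intro P P' _ _ z
    split_ifs <;> simp
  have h1 := hd (r = 0) (i = j)
  have h2 := hd (s = 0) (k = l)
  generalize (if r = 0 then if i = j then (1 : A) else 0 else 0) = d at *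
  generalize (if s = 0 then if k = l then (1 : A) else 0 else 0) = d' at *
  simp only [sub_mul, mul_sub, mul_add, m, pow_two, mul_assoc]
  rw [h1 d', ← h1 (hbar A * y), ← h2 (hbar A * x), mul_assoc, mul_assoc]
  abel

lemma map_dualComm (f : A →ₐ[ℂ⟦X⟧] B) (t : Fin N → Fin N → ℕ+ → A) (i j k l : Fin N) (r s : ℕ) :
    f (dualComm t i j k l r s) = dualComm (fun i j r ↦ f (t i j r)) i j k l r s := by
  have h := map_hbar f
  simp only [RingHom.coe_coe] at h
  simp only [dualComm, map_sub, map_mul, map_sum, h, apply_ite f, map_zero]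

/-- In the free algebra `h²` times this expression is a coefficient of the `RTT` relation, so it is
itself one of the imposed relations. The identity therefore holds exactly, and not only up to
torsion. -/
lemma dualComm_dyMinus (i j k l : Fin N) (r s : ℕ) :
    dualComm (dyMinus (N := N)) i j k l r s = 0 := by
  have h1 : DYRel N (dualComm (fun i j r ↦ FreeAlgebra.ι ℂ⟦X⟧ (.tMinus i j r)) i j k l r s) 0 := by
    refine DYRel.rtt _ (Or.inl (Or.inr ⟨(i, k), (j, l), s, r, ?_⟩))
    rw [coeff_rttDual, hbar_sq_mul_dualComm]
  have h2 := RingQuot.mkAlgHom_rel ℂ⟦X⟧ h1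
  have h3 : toDY N (dualComm (fun i j r ↦ FreeAlgebra.ι ℂ⟦X⟧ (.tMinus i j r)) i j k l r s) = 0 :=
    h2.trans (map_zero _)
  rwa [map_dualComm] at h3

lemma dualComm_tMinus (i j k l : Fin N) (r s : ℕ) :
    dualComm (tMinus (N := N)) i j k l r s = 0 := by
  have h1 := map_dualComm (dualYangian N).val (tMinus (N := N)) i j k l r s
  have h2 := h1.trans (dualComm_dyMinus i j k l r s)
  exact Subtype.ext h2

lemma plusComm_tMinus (i j k l : Fin N) (r s : ℕ) :
    plusComm (tMinus (N := N)) i j k l r s = 0 := by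
  rw [← hbar_sq_mul_dualComm, dualComm_tMinus, mul_zero]

end DualRelation

/-! ### Symbols and generators of associated graded algebras -/

section GradedAlgebra

variable {A : Type*} [Ring A] [Algebra ℂ⟦X⟧ A]

/-- The associated graded algebra as a ring. -/
def GrAlg (F : ℤ → Submodule ℂ⟦X⟧ A) [IsRingFiltration F (fun n ↦ F (n - 1))] : Type _ := Gr F

namespace GrAlg

variable (F : ℤ → Submodule ℂ⟦X⟧ A) [IsRingFiltration F (fun n ↦ F (n - 1))]

instance : Ring (GrAlg F) :=
  { (inferInstance : Semiring (Gr F)), (inferInstance : AddCommGroup (Gr F)) with }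

instance : Algebra ℂ⟦X⟧ (GrAlg F) := (inferInstance : Algebra ℂ⟦X⟧ (Gr F))

/-- The principal symbol. -/
def sym (p : ℤ) : F p →+ GrAlg F where
  toFun := symbol F p
  map_zero' := by rw [symbol, map_zero, map_zero]; rfl
  map_add' x y := by rw [symbol, map_add, map_add]; rfl

variable {F}

lemma sym_mul (p q : ℤ) (x : F p) (y : F q) :
    sym F p x * sym F q y = sym F (p + q) ⟨(x : A) * y, SetLike.mul_mem_graded x.2 y.2⟩ :=
  (DirectSum.of_mul_of (A := GrPiece F) (grMk F p x) (grMk F q y)).trans rfl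

lemma sym_congr {p q : ℤ} (h : p = q) (x : F p) (y : F q) (hxy : (x : A) = y) :
    sym F p x = sym F q y := by
  subst h
  rw [Subtype.ext hxy]

lemma smul_sym (r : ℂ⟦X⟧) (p : ℤ) (x : F p) : r • sym F p x = sym F p (r • x) := by
  have h : sym F p (r • x) = DirectSum.lof ℂ⟦X⟧ ℤ (GrPiece F) p (grMk F p (r • x)) := rfl
  rw [h, map_smul, map_smul]
  rfl

lemma sym_eq_zero (p : ℤ) (x : F p) : sym F p x = 0 ↔ (x : A) ∈ F (p - 1) := by
  rw [← grMk_eq_zero]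
  constructor
  · intro h
    have h' : DirectSum.of (GrPiece F) p (grMk F p x) = DirectSum.of (GrPiece F) p 0 :=
      h.trans (map_zero _).symm
    exact DirectSum.of_injective p h'
  · intro h
    have h' : sym F p x = DirectSum.of (GrPiece F) p (grMk F p x) := rfl
    rw [h', h, map_zero]
    rfl

lemma induction {P : GrAlg F → Prop} (h : ∀ p x, P (sym F p x))
    (hadd : ∀ x y, P x → P y → P (x + y)) (x : GrAlg F) : P x := by
  refine DirectSum.induction_on (motive := P) x ?_ (fun p y ↦ ?_) hadd
  · have := h 0 0
    rwa [map_zero] at this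
  · obtain ⟨y, rfl⟩ := grMk_surjective p y
    exact h p y

section Generators

variable {I : Type*} (γ : I → A) (d : I → ℤ)

lemma list_prod_mem (hγ : ∀ i, γ i ∈ F (d i)) (l : List I) :
    (l.map γ).prod ∈ F (l.map d).sum := by
  induction l with
  | nil => exact SetLike.one_mem_graded F
  | cons i l ih =>
    rw [List.map_cons, List.map_cons, List.prod_cons, List.sum_cons]
    exact SetLike.mul_mem_graded (hγ i) ih

lemma sym_list_prod_mem (hγ : ∀ i, γ i ∈ F (d i)) (l : List I) :
    sym F (l.map d).sum ⟨(l.map γ).prod, list_prod_mem γ d hγ l⟩ ∈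
      Algebra.adjoin ℂ⟦X⟧ (Set.range fun i ↦ sym F (d i) ⟨γ i, hγ i⟩) := by
  induction l with
  | nil => exact one_mem _
  | cons i l ih =>
    have h : sym F ((i :: l).map d).sum ⟨((i :: l).map γ).prod, list_prod_mem γ d hγ _⟩ =
        sym F (d i) ⟨γ i, hγ i⟩ * sym F (l.map d).sum ⟨(l.map γ).prod, list_prod_mem γ d hγ l⟩ := by
      rw [sym_mul]
      exact sym_congr (by simp) _ _ (by simp)
    rw [h]
    exact mul_mem (Algebra.subset_adjoin ⟨i, rfl⟩) ih

/-- The associated graded algebra is generated by the symbols of generators, when the filtration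
is spanned by monomials and elements of lower degree. -/
lemma adjoin_eq_top (hF : Monotone F) (hγ : ∀ i, γ i ∈ F (d i)) (J : ℤ → Submodule ℂ⟦X⟧ A)
    (hJ : ∀ p, J p ≤ F (p - 1))
    (h : ∀ p, F p ≤ Submodule.span ℂ⟦X⟧ {x | ∃ l : List I, (l.map d).sum ≤ p ∧ x = (l.map γ).prod}
      ⊔ J p) :
    Algebra.adjoin ℂ⟦X⟧ (Set.range fun i ↦ sym F (d i) ⟨γ i, hγ i⟩) = ⊤ := by
  rw [eq_top_iff]
  rintro x -
  induction x using GrAlg.induction with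
  | hadd x y hx hy => exact add_mem hx hy
  | h p x =>
    obtain ⟨x, hx⟩ := x
    obtain ⟨y, hy, z, hz, rfl⟩ := Submodule.mem_sup.1 (h p hx)
    have hz' : z ∈ F p := hF (by omega) (hJ p hz)
    have key : ∃ hy' : y ∈ F p, sym F p ⟨y, hy'⟩ ∈
        Algebra.adjoin ℂ⟦X⟧ (Set.range fun i ↦ sym F (d i) ⟨γ i, hγ i⟩) := by
      clear hx
      induction hy using Submodule.span_induction with
      | zero =>
        have e : sym F p ⟨0, zero_mem _⟩ = 0 := map_zero (sym F p)
        exact ⟨zero_mem _, by rw [e]; exact Subalgebra.zero_mem _⟩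
      | add y y' _ _ h1 h2 =>
        obtain ⟨h1, h1'⟩ := h1
        obtain ⟨h2, h2'⟩ := h2
        refine ⟨add_mem h1 h2, ?_⟩
        have h3 := add_mem h1' h2'
        rwa [← map_add] at h3
      | smul r y _ h1 =>
        obtain ⟨h1, h1'⟩ := h1
        refine ⟨Submodule.smul_mem _ r h1, ?_⟩
        have h3 := Subalgebra.smul_mem _ h1' r
        rwa [smul_sym] at h3
      | mem y hy =>
        obtain ⟨l, hl, rfl⟩ := hy
        refine ⟨hF hl (list_prod_mem γ d hγ l), ?_⟩
        rcases hl.lt_or_eq with hl | rfl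
        · rw [(sym_eq_zero p _).2 (hF (by omega) (list_prod_mem γ d hγ l))]
          exact Subalgebra.zero_mem _
        · exact sym_list_prod_mem γ d hγ l
    obtain ⟨hy', hy''⟩ := key
    have e : sym F p ⟨y + z, hx⟩ = sym F p ⟨y, hy'⟩ + sym F p ⟨z, hz'⟩ :=
      map_add (sym F p) ⟨y, hy'⟩ ⟨z, hz'⟩
    rw [e, (sym_eq_zero p ⟨z, hz'⟩).2 (hJ p hz), add_zero]
    exact hy''

end Generators

end GrAlg

end GradedAlgebra

/-! ### Homomorphisms from enveloping algebras to graded algebras -/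

section EnvToGr

open Polynomial

variable {A : Type*} [Ring A] [Algebra ℂ⟦X⟧ A] (F : ℤ → Submodule ℂ⟦X⟧ A)
  [IsRingFiltration F (fun n ↦ F (n - 1))] {N : ℕ} (lam : ℕ+ → Matrix (Fin N) (Fin N) ℂ →+ A)
  (hlam : ∀ (m : ℕ+) B, lam m B ∈ F (-((m : ℕ) : ℤ)))

/-- The symbol of the image of a homogeneous matrix-valued polynomial. -/
def homSym (m : ℕ) : Matrix (Fin N) (Fin N) ℂ →+ GrAlg F :=
  if h : 0 < m then
    (GrAlg.sym F (-((⟨m, h⟩ : ℕ+) : ℕ) : ℤ)).comp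
      ((lam ⟨m, h⟩).codRestrict (F (-((⟨m, h⟩ : ℕ+) : ℕ) : ℤ)).toAddSubmonoid (hlam ⟨m, h⟩))
  else 0

lemma homSym_pos (m : ℕ+) (B : Matrix (Fin N) (Fin N) ℂ) :
    homSym F lam hlam m B = GrAlg.sym F (-((m : ℕ) : ℤ)) ⟨lam m B, hlam m B⟩ := by
  rw [homSym, dif_pos m.pos]
  rfl

/-- The sum of the symbols of the images of the coefficients of a matrix-valued polynomial. -/
def polySym : (Matrix (Fin N) (Fin N) ℂ)[X] →+ GrAlg F where
  toFun q := q.sum fun m B ↦ homSym F lam hlam m B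
  map_zero' := Polynomial.sum_zero_index _
  map_add' p q := Polynomial.sum_add_index _ _ _ (by simp) (by simp)

lemma polySym_monomial (m : ℕ) (B : Matrix (Fin N) (Fin N) ℂ) :
    polySym F lam hlam (monomial m B) = homSym F lam hlam m B :=
  Polynomial.sum_monomial_index (f := fun m B ↦ homSym F lam hlam m B) B (by simp)

variable (hscal : ∀ (m : ℕ+) (c : ℂ) B, lam m (c • B) = scal A c * lam m B)

include hscal in
lemma polySym_smul (c : ℂ) (q : (Matrix (Fin N) (Fin N) ℂ)[X]) :
    polySym F lam hlam (c • q) = scal (GrAlg F) c * polySym F lam hlam q := by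
  induction q using Polynomial.induction_on' with
  | add p q hp hq => rw [smul_add, map_add, map_add, hp, hq, mul_add]
  | monomial m B =>
    rw [smul_monomial, polySym_monomial, polySym_monomial]
    rcases Nat.eq_zero_or_pos m with rfl | hm
    · simp [homSym]
    · lift m to ℕ+ using hm
      rw [homSym_pos, homSym_pos, scal, ← Algebra.smul_def, GrAlg.smul_sym]
      refine GrAlg.sym_congr rfl _ _ ?_
      change lam m (c • B) = _ • lam m B
      rw [hscal, scal, ← Algebra.smul_def]

variable (V : ℕ+ → Set (Matrix (Fin N) (Fin N) ℂ))
  (hlie : ∀ (m n : ℕ+) B B', B ∈ V m → B' ∈ V n → lam m B * lam n B' - lam n B' * lam m B -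
    lam (m + n) (B * B' - B' * B) ∈ F (-((m : ℕ) : ℤ) + -((n : ℕ) : ℤ) - 1))

include hlie in
lemma homSym_lie {m n : ℕ} (hm : 0 < m) (hn : 0 < n) {B B' : Matrix (Fin N) (Fin N) ℂ}
    (hB : B ∈ V ⟨m, hm⟩) (hB' : B' ∈ V ⟨n, hn⟩) :
    homSym F lam hlam (m + n) (B * B' - B' * B) =
      homSym F lam hlam m B * homSym F lam hlam n B' -
        homSym F lam hlam n B' * homSym F lam hlam m B := by
  lift m to ℕ+ using hm
  lift n to ℕ+ using hn
  have h1 : homSym F lam hlam (m + n : ℕ) (B * B' - B' * B) = _ :=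
    homSym_pos F lam hlam (m + n) (B * B' - B' * B)
  rw [h1, homSym_pos, homSym_pos, GrAlg.sym_mul, GrAlg.sym_mul]
  have hc : -((n : ℕ) : ℤ) + -((m : ℕ) : ℤ) = -((m : ℕ) : ℤ) + -((n : ℕ) : ℤ) := add_comm _ _
  have h2 : lam n B' * lam m B ∈ F (-((m : ℕ) : ℤ) + -((n : ℕ) : ℤ)) := by
    rw [← hc]
    exact SetLike.mul_mem_graded (hlam n B') (hlam m B)
  have h3 : lam (m + n) (B * B' - B' * B) ∈ F (-((m : ℕ) : ℤ) + -((n : ℕ) : ℤ)) := by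
    have := hlam (m + n) (B * B' - B' * B)
    rwa [PNat.add_coe, Nat.cast_add, neg_add] at this
  rw [GrAlg.sym_congr hc _ ⟨_, h2⟩ rfl, GrAlg.sym_congr (p := -(((m + n : ℕ+) : ℕ) : ℤ))
    (q := -((m : ℕ) : ℤ) + -((n : ℕ) : ℤ)) (by push_cast; ring) _ ⟨_, h3⟩ rfl, ← map_sub, eq_comm, ← sub_eq_zero, ← map_sub,
    GrAlg.sym_eq_zero]
  exact hlie m n B B' hB hB'

lemma sum_mul_sum_sub_sum_mul_sum {B : Type*} [Ring B] (s t : Finset ℕ) (f g : ℕ → B) :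
    (∑ m ∈ s, f m) * (∑ n ∈ t, g n) - (∑ n ∈ t, g n) * ∑ m ∈ s, f m =
      ∑ m ∈ s, ∑ n ∈ t, (f m * g n - g n * f m) := by
  simp only [Finset.sum_sub_distrib]
  rw [Finset.sum_mul_sum, Finset.sum_mul_sum, Finset.sum_comm (s := t)]

-- By additivity the bracket relation reduces to homogeneous components. It is required only for
-- coefficients in the sets `V m`: all matrices in the untwisted case, eigenspaces of `σ` in the
-- twisted one.
include hlie in
lemma polySym_lie {p q : (Matrix (Fin N) (Fin N) ℂ)[X]} (hp0 : p.coeff 0 = 0) (hq0 : q.coeff 0 = 0)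
    (hp : ∀ m : ℕ+, p.coeff m ∈ V m) (hq : ∀ m : ℕ+, q.coeff m ∈ V m) :
    polySym F lam hlam (p * q - q * p) =
      polySym F lam hlam p * polySym F lam hlam q - polySym F lam hlam q * polySym F lam hlam p := by
  have hpos : ∀ {p : (Matrix (Fin N) (Fin N) ℂ)[X]}, p.coeff 0 = 0 → ∀ m ∈ p.support, 0 < m :=
    fun h0 m hm ↦ Nat.pos_of_ne_zero fun h ↦ Polynomial.mem_support_iff.1 hm (by rw [h]; exact h0)
  have e : ∀ p : (Matrix (Fin N) (Fin N) ℂ)[X], polySym F lam hlam p =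
      ∑ m ∈ p.support, homSym F lam hlam m (p.coeff m) := fun p ↦ rfl
  have e' : p * q - q * p = ∑ m ∈ p.support, ∑ n ∈ q.support,
      monomial (m + n) (p.coeff m * q.coeff n - q.coeff n * p.coeff m) := by
    conv_lhs => rw [p.as_sum_support, q.as_sum_support, sum_mul_sum_sub_sum_mul_sum]
    refine Finset.sum_congr rfl fun m _ ↦ Finset.sum_congr rfl fun n _ ↦ ?_
    rw [monomial_mul_monomial, monomial_mul_monomial, add_comm n m, ← map_sub]
  rw [e', map_sum, e p, e q]
  refine Eq.trans ?_ (sum_mul_sum_sub_sum_mul_sum _ _ _ _).symm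
  refine Finset.sum_congr rfl fun m hm ↦ ?_
  rw [map_sum]
  refine Finset.sum_congr rfl fun n hn ↦ ?_
  rw [polySym_monomial]
  exact homSym_lie F lam hlam V hlie (hpos hp0 m hm) (hpos hq0 n hn) (hp ⟨m, hpos hp0 m hm⟩)
    (hq ⟨n, hpos hq0 n hn⟩)

include hscal hlie in
lemma exists_envToGr {L : Type*} [LieRing L] [LieAlgebra ℂ L] (c : L →ₗ⁅ℂ⁆ current N)
    (hV : ∀ x (m : ℕ+), (c x : (Matrix (Fin N) (Fin N) ℂ)[X]).coeff m ∈ V m) :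
    ∃ Θ : Env L →ₐ[ℂ⟦X⟧] GrAlg F, ∀ x, Θ (Env.ι x) = polySym F lam hlam (c x) := by
  refine Env.exists_lift ((polySym F lam hlam).comp
    ((current N).subtype.toAddMonoidHom.comp c.toLinearMap.toAddMonoidHom)) (fun a x ↦ ?_)
    fun x y ↦ ?_
  · change polySym F lam hlam (c (a • x) : (Matrix (Fin N) (Fin N) ℂ)[X]) =
      _ * polySym F lam hlam (c x)
    rw [map_smul]
    exact polySym_smul F lam hlam hscal a _
  · change polySym F lam hlam (c ⁅x, y⁆ : (Matrix (Fin N) (Fin N) ℂ)[X]) =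
      polySym F lam hlam (c x) * polySym F lam hlam (c y) -
        polySym F lam hlam (c y) * polySym F lam hlam (c x)
    rw [LieHom.map_lie]
    exact polySym_lie F lam hlam V hlie (c x).2 (c y).2 (hV x) (hV y)

end EnvToGr

/-! ### The associated graded algebra of `Y⁺(gl_N)` -/

section UntwistedLift

variable {N : ℕ}

/-- The linear combination of the `t_ij^(-m)` with coefficients given by a matrix. -/
def tLin (m : ℕ+) : Matrix (Fin N) (Fin N) ℂ →+ DualYangian N where
  toFun B := ∑ i, ∑ j, scal (DualYangian N) (B i j) * tMinus i j m
  map_zero' := by simp [scal]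
  map_add' B B' := by simp [scal_add, add_mul, Finset.sum_add_distrib]

lemma tLin_apply (m : ℕ+) (B : Matrix (Fin N) (Fin N) ℂ) :
    tLin m B = ∑ i, ∑ j, scal (DualYangian N) (B i j) * tMinus i j m := rfl

lemma scal_mul_mem {A : Type*} [Ring A] [Algebra ℂ⟦X⟧ A] (W : Submodule ℂ⟦X⟧ A) (c : ℂ) {x : A}
    (hx : x ∈ W) : scal A c * x ∈ W := by
  rw [scal, ← Algebra.smul_def]
  exact W.smul_mem _ hx

lemma hbar_mul_mem {A : Type*} [Ring A] [Algebra ℂ⟦X⟧ A] (W : Submodule ℂ⟦X⟧ A) {x : A}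
    (hx : x ∈ W) : hbar A * x ∈ W := by
  rw [hbar, ← Algebra.smul_def]
  exact W.smul_mem _ hx

lemma tLin_mem (m : ℕ+) (B : Matrix (Fin N) (Fin N) ℂ) :
    tLin m B ∈ degFiltration N (-((m : ℕ) : ℤ)) := by
  rw [tLin_apply]
  exact Submodule.sum_mem _ fun i _ ↦ Submodule.sum_mem _ fun j _ ↦
    scal_mul_mem _ _ (tMinus_mem i j m)

lemma tLin_smul (m : ℕ+) (c : ℂ) (B : Matrix (Fin N) (Fin N) ℂ) :
    tLin m (c • B) = scal (DualYangian N) c * tLin m B := by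
  simp only [tLin_apply, Matrix.smul_apply, smul_eq_mul, scal_mul, Finset.mul_sum, mul_assoc]

lemma tLin_single (m : ℕ+) (i j : Fin N) : tLin m (Matrix.single i j 1) = tMinus i j m := by
  rw [tLin_apply, Finset.sum_eq_single i, Finset.sum_eq_single j]
  · simp [scal]
  · intro k _ hk
    simp [hk.symm, scal]
  · simp
  · intro k _ hk
    simp [hk.symm, scal]
  · simp

/-- In the part of the commutation relation with factor `h` the indices of the two generators add up
to `m + n + 1`, so the degree drops by one. -/
lemma tMinus_commutator_mem (m n : ℕ+) (i j k l : Fin N) :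
    tMinus i j m * tMinus k l n - tMinus k l n * tMinus i j m -
      ((if k = j then tMinus i l (m + n) else 0) - (if i = l then tMinus k j (m + n) else 0)) ∈
        degFiltration N (-((m : ℕ) : ℤ) + -((n : ℕ) : ℤ) - 1) := by
  have h := dualComm_tMinus i j k l m.natPred n.natPred
  rw [dualComm, sub_eq_zero] at h
  have e : (m.natPred + n.natPred + 1).succPNat = m + n := by
    apply PNat.eq
    have h1 := PNat.natPred_add_one m
    have h2 := PNat.natPred_add_one n
    rw [Nat.succPNat_coe, PNat.add_coe]
    omega
  rw [PNat.succPNat_natPred, PNat.succPNat_natPred, e] at h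
  rw [h]
  refine hbar_mul_mem _ (Submodule.sum_mem _ fun p hp ↦ ?_)
  rw [Finset.HasAntidiagonal.mem_antidiagonal] at hp
  have h1 := PNat.natPred_add_one m
  have h2 := PNat.natPred_add_one n
  refine sub_mem ?_ ?_
  · refine degFiltration_mono N ?_ (SetLike.mul_mem_graded (tMinus_mem _ _ _) (tMinus_mem _ _ _))
    simp only [Nat.succPNat_coe]
    omega
  · refine degFiltration_mono N ?_ (SetLike.mul_mem_graded (tMinus_mem _ _ _) (tMinus_mem _ _ _))
    simp only [Nat.succPNat_coe]
    omega

lemma matrix_induction_unit {P : Matrix (Fin N) (Fin N) ℂ → Prop} (h0 : P 0)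
    (hadd : ∀ a b, P a → P b → P (a + b)) (hsmul : ∀ (c : ℂ) a, P a → P (c • a))
    (h : ∀ i j, P (Matrix.single i j 1)) (B : Matrix (Fin N) (Fin N) ℂ) : P B := by
  induction B using Matrix.induction_on' with
  | h_zero => exact h0
  | h_add p q hp hq => exact hadd _ _ hp hq
  | h_std_basis i j x =>
    have := hsmul x _ (h i j)
    rwa [Matrix.smul_single, smul_eq_mul, mul_one] at this

lemma scal_mul_comm {A : Type*} [Ring A] [Algebra ℂ⟦X⟧ A] (c : ℂ) (x : A) :
    x * scal A c = scal A c * x := Subring.mem_center_iff.1 (scal_mem_center c) x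

lemma tLin_commutator_mem (m n : ℕ+) (B B' : Matrix (Fin N) (Fin N) ℂ) :
    tLin m B * tLin n B' - tLin n B' * tLin m B - tLin (m + n) (B * B' - B' * B) ∈
      degFiltration N (-((m : ℕ) : ℤ) + -((n : ℕ) : ℤ) - 1) := by
  induction B using matrix_induction_unit with
  | h0 => simp
  | hadd a b ha hb =>
    convert add_mem ha hb using 1
    simp only [map_add, add_mul, mul_add, map_sub]
    abel
  | hsmul c a ha =>
    convert scal_mul_mem _ c ha using 1
    rw [smul_mul_assoc, mul_smul_comm, ← smul_sub, tLin_smul, tLin_smul, mul_sub, mul_sub, mul_assoc,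
      ← mul_assoc (tLin n B'), scal_mul_comm, mul_assoc]
  | h i j =>
    induction B' using matrix_induction_unit with
    | h0 => simp
    | hadd a b ha hb =>
      convert add_mem ha hb using 1
      simp only [map_add, add_mul, mul_add, map_sub]
      abel
    | hsmul c a ha =>
      convert scal_mul_mem _ c ha using 1
      rw [smul_mul_assoc, mul_smul_comm, ← smul_sub, tLin_smul, tLin_smul, mul_sub, mul_sub,
        mul_assoc, ← mul_assoc (tLin m _), scal_mul_comm, mul_assoc]
    | h k l =>
      convert tMinus_commutator_mem m n i j k l using 2
      · simp only [tLin_single]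
      · rw [map_sub]
        congr 1
        · by_cases h : j = k
          · subst h
            rw [if_pos rfl, Matrix.single_mul_single_same, one_mul, tLin_single]
          · rw [if_neg (Ne.symm h), Matrix.single_mul_single_of_ne _ _ _ _ h, map_zero]
        · by_cases h : l = i
          · subst h
            rw [if_pos rfl, Matrix.single_mul_single_same, one_mul, tLin_single]
          · rw [if_neg (Ne.symm h), Matrix.single_mul_single_of_ne _ _ _ _ h, map_zero]

variable (N) in
lemma exists_currentLift : ∃ Θ : Env (current N) →ₐ[ℂ⟦X⟧] GrAlg (degFiltration N),
    ∀ x : current N, Θ (Env.ι x) = polySym (degFiltration N) tLin tLin_mem x :=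
  exists_envToGr (degFiltration N) tLin tLin_mem tLin_smul (fun _ ↦ Set.univ)
    (fun m n B B' _ _ ↦ tLin_commutator_mem m n B B') LieHom.id fun _ _ ↦ trivial

variable (N) in
/-- The homomorphism from the enveloping algebra of the current Lie algebra to the associated graded
algebra of the dual Yangian. -/
def currentLift : Env (current N) →ₐ[ℂ⟦X⟧] GrAlg (degFiltration N) := (exists_currentLift N).choose

lemma currentLift_single (B : Matrix (Fin N) (Fin N) ℂ) (m : ℕ+) :
    currentLift N (Env.ι (current.single B m)) =
      GrAlg.sym (degFiltration N) (-((m : ℕ) : ℤ)) ⟨tLin m B, tLin_mem m B⟩ := by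
  refine ((exists_currentLift N).choose_spec _).trans ?_
  refine (polySym_monomial _ _ _ (m : ℕ) B).trans ?_
  rw [homSym_pos]

/-- `GradedRep.grHom` on `GrAlg`. -/
def GradedRep.grAlgHom (ρ : GradedRep N) : GrAlg (degFiltration N) →ₐ[ℂ⟦X⟧] ρ.K := ρ.grHom

lemma grAlgHom_currentLift (ρ : GradedRep N) (i j : Fin N) (m : ℕ+) :
    ρ.grAlgHom (currentLift N (Env.ι (current.single (Matrix.single i j 1) m))) = ρ.lead i j m := by
  rw [currentLift_single]
  have h : (⟨tLin m (Matrix.single i j 1), tLin_mem m _⟩ : degFiltration N (-((m : ℕ) : ℤ))) =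
      ⟨tMinus i j m, tMinus_mem i j m⟩ := Subtype.ext (tLin_single m i j)
  rw [h]
  exact ρ.grHom_symbol_tMinus i j m

lemma Laur.coeff_ofPoly {K : Type*} [Ring K] (p : Polynomial K) (n : ℕ) :
    Laur.coeff n (Laur.ofPoly p) = p.coeff n := by
  induction p using Polynomial.induction_on' with
  | add p q hp hq => rw [map_add, map_add, hp, hq, Polynomial.coeff_add]
  | monomial k a =>
    rw [Laur.ofPoly_monomial, Laur.coeff_single, Polynomial.coeff_monomial]
    simp

variable (N) in
/-- The coproduct of the enveloping algebra of the current Lie algebra. -/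
def currentCoproduct : CoproductData N (Env (current N)) (current N) :=
  Env.coproductData LieHom.id LinearMap.id fun _ ↦ rfl

/-- The graded component of a representation as a homomorphism on the enveloping algebra. -/
def GradedRep.envHom (ρ : GradedRep N) : Env (current N) →ₐ[ℂ⟦X⟧] ρ.K :=
  ρ.grAlgHom.comp (currentLift N)

lemma GradedRep.envHom_single (ρ : GradedRep N) (i j : Fin N) (m : ℕ+) :
    ρ.envHom (Env.ι (current.single (Matrix.single i j 1) m)) = ρ.lead i j m :=
  grAlgHom_currentLift ρ i j m

lemma map_scalar_matrix {S S' : Type*} [Ring S] [Ring S'] (f : S →+* S') (x : S) :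
    f.mapMatrix (Matrix.scalar (Fin N) x) = Matrix.scalar (Fin N) (f x) := by
  ext i j
  simp only [RingHom.mapMatrix_apply, Matrix.map_apply, Matrix.scalar_apply, Matrix.diagonal_apply]
  split_ifs <;> simp

/-- `GradedRep.envHom` for an extended representation. -/
def GradedRep.extendHom (ρ : GradedRep N) : Env (current N) →ₐ[ℂ⟦X⟧] Slot ρ.K N := ρ.extend.envHom

lemma GradedRep.extendHom_single (ρ : GradedRep N) (i j : Fin N) (m : ℕ+) :
    ρ.extendHom (Env.ι (current.single (Matrix.single i j 1) m)) =
      slotIncl ρ.K N (ρ.lead i j m) + Laur.single (m : ℕ) (Matrix.single i j 1) :=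
  (ρ.extend.envHom_single i j m).trans (ρ.lead_extend i j m)

/-- Two homomorphisms are compared on generators, where the claim is `GradedRep.lead_extend`: adding
a tensor factor to a representation amounts to applying the coproduct. -/
lemma GradedRep.extendHom_apply (ρ : GradedRep N) (x : Env (current N)) :
    ρ.extendHom x = Laur.ofPoly (Polynomial.map (ρ.envHom : Env (current N) →+* ρ.K).mapMatrix
      ((currentCoproduct N).Δ x)) := by
  have h : (ρ.extendHom : Env (current N) →+* Slot ρ.K N) =
      (Laur.ofPoly.comp (Polynomial.mapRingHom (ρ.envHom : Env (current N) →+* ρ.K).mapMatrix)).comp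
        (currentCoproduct N).Δ := by
    have hC : ∀ y : Matrix (Fin N) (Fin N) ρ.K, Laur.ofPoly (Polynomial.C y) = Laur.C y := fun y ↦ by
      rw [← Polynomial.monomial_zero_left, Laur.ofPoly_monomial, Laur.C_apply, Nat.cast_zero]
    have h0 : ∀ r, (ρ.extendHom : Env (current N) →+* Slot ρ.K N) (algebraMap ℂ⟦X⟧ _ r) =
      (Laur.ofPoly.comp (Polynomial.mapRingHom (ρ.envHom : Env (current N) →+* ρ.K).mapMatrix)).comp
        (currentCoproduct N).Δ (algebraMap ℂ⟦X⟧ _ r) := by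
      intro r
      simp only [RingHom.comp_apply, CoproductData.Δ_algebraMap, Polynomial.coe_mapRingHom,
        Polynomial.map_C, map_scalar_matrix, hC, RingHom.coe_coe, AlgHom.commutes]
      rfl
    refine Env.hom_ext h0 fun x ↦ ?_
    induction x using current_induction_unit with
    | h0 => rw [map_zero, map_zero, map_zero]
    | hadd a b ha hb => rw [map_add, map_add, map_add, ha, hb]
    | hsmul c a ha => rw [Env.ι_smul, map_mul, map_mul, ha, scal, h0]
    | h i j r =>
      have e : (currentCoproduct N).Δ (Env.ι (current.single (Matrix.single i j 1) r)) = _ :=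
        (currentCoproduct N).Δ_e (current.single (Matrix.single i j 1) r)
      have e' : ((currentCoproduct N).f (current.single (Matrix.single i j 1) r) :
        Polynomial (Matrix (Fin N) (Fin N) ℂ)) = Polynomial.monomial r (Matrix.single i j 1) := rfl
      have e2 : (ρ.envHom : Env (current N) →+* ρ.K).mapMatrix
          (constMap N (Env (current N)) (Matrix.single i j 1)) = Matrix.single i j 1 := by
        ext a b
        simp only [RingHom.mapMatrix_apply, Matrix.map_apply, constMap_apply, Matrix.single_apply]
        split_ifs <;> simp [scal]
      have e3 : (ρ.envHom : Env (current N) →+* ρ.K) ((currentCoproduct N).e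
          (current.single (Matrix.single i j 1) r)) = ρ.lead i j r := ρ.envHom_single i j r
      simp only [RingHom.comp_apply, RingHom.coe_coe, e, e', Polynomial.coe_mapRingHom,
        Polynomial.map_C, Polynomial.map_monomial, map_scalar_matrix, map_add,
        hC, Laur.ofPoly_monomial, e2, e3, GradedRep.extendHom_single]
      rfl
  exact RingHom.congr_fun h x

/-- The common kernel of all graded representations is stable under the coproduct, because every
representation can be extended by a further tensor factor. It contains no nonzero scalar, because of
the trivial representation. -/
lemma eq_zero_of_envHom {x : Env (current N)} (hx : ∀ ρ : GradedRep N, ρ.envHom x = 0) : x = 0 := by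
  refine (currentCoproduct N).eq_zero_of_stable
    (⨅ ρ : GradedRep N, LinearMap.ker ρ.envHom.toLinearMap) (fun y hy m i j ↦ ?_) (fun r hr ↦ ?_)
    ((Submodule.mem_iInf _).2 hx)
  · refine (Submodule.mem_iInf _).2 fun ρ ↦ ?_
    have h1 : ρ.extendHom y = 0 := (Submodule.mem_iInf _).1 hy ρ.extend
    rw [ρ.extendHom_apply] at h1
    have h2 := Laur.coeff_ofPoly (Polynomial.map (ρ.envHom : Env (current N) →+* ρ.K).mapMatrix
      ((currentCoproduct N).Δ y)) m
    rw [h1, map_zero, Polynomial.coeff_map] at h2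
    exact (congrFun (congrFun h2 i) j).symm
  · have h1 : (GradedRep.trivial N).envHom (algebraMap _ _ r) = 0 :=
      (Submodule.mem_iInf _).1 hr (GradedRep.trivial N)
    rw [AlgHom.commutes] at h1
    have h2 : r = 0 := h1
    rw [h2, map_zero]

/-- Each `envHom` factors through `currentLift`, and together they separate elements. -/
lemma currentLift_injective : Function.Injective (currentLift N) := by
  rw [injective_iff_map_eq_zero]
  intro x hx
  refine eq_zero_of_envHom fun ρ ↦ ?_
  change ρ.grAlgHom (currentLift N x) = 0
  rw [hx, map_zero]

lemma currentLift_surjective : Function.Surjective (currentLift N) := by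
  have h := GrAlg.adjoin_eq_top (F := degFiltration N)
    (fun g : Fin N × Fin N × ℕ+ ↦ tMinus g.1 g.2.1 g.2.2) (fun g ↦ -((g.2.2 : ℕ) : ℤ))
    (degFiltration_mono N) (fun g ↦ tMinus_mem _ _ _) ⊥ (fun _ ↦ bot_le) fun p ↦ le_sup_left
  rw [← AlgHom.range_eq_top, eq_top_iff, ← h]
  refine Algebra.adjoin_le ?_
  rintro _ ⟨⟨i, j, m⟩, rfl⟩
  refine ⟨Env.ι (current.single (Matrix.single i j 1) m), ?_⟩
  refine (currentLift_single _ _).trans ?_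
  congr 1
  exact Subtype.ext (tLin_single m i j)

variable (N) in
/-- The isomorphism between the enveloping algebra of the current Lie algebra and the associated
graded algebra of the dual Yangian. -/
def currentEquiv : Env (current N) ≃ₐ[ℂ⟦X⟧] GrAlg (degFiltration N) :=
  AlgEquiv.ofBijective (currentLift N) ⟨currentLift_injective, currentLift_surjective⟩

lemma Env.eq_zero_of_hbar_mul {x : Env (current N)} (hx : hbar _ * x = 0) : x = 0 := by
  refine eq_zero_of_envHom fun ρ ↦ ρ.torsionFree _ ?_
  have := congrArg ρ.envHom hx
  rw [map_mul, map_zero] at this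
  have h := map_hbar ρ.envHom
  rw [RingHom.coe_coe] at h
  rwa [h] at this

lemma GrAlg.eq_zero_of_hbar_smul {y : GrAlg (degFiltration N)}
    (hy : (PowerSeries.X : ℂ⟦X⟧) • y = 0) : y = 0 := by
  obtain ⟨x, rfl⟩ := currentLift_surjective y
  rw [← map_smul] at hy
  have h := currentLift_injective (hy.trans (map_zero _).symm)
  rw [Algebra.smul_def] at h
  rw [Env.eq_zero_of_hbar_mul h, map_zero]

lemma adjoin_tMinus : Algebra.adjoin ℂ⟦X⟧ {x | ∃ (i j : Fin N) (r : ℕ+), x = tMinus i j r} = ⊤ := by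
  have h := Algebra.adjoin_adjoin_coe_preimage (R := ℂ⟦X⟧)
    (s := {x | ∃ (i j : Fin N) (r : ℕ+), x = dyMinus i j r})
  have h' : Algebra.adjoin ℂ⟦X⟧ {x : DualYangian N | ∃ i j r, (show dualYangian N from x).1 =
      dyMinus i j r} = ⊤ := h
  rw [← top_le_iff, ← h']
  refine Algebra.adjoin_mono ?_
  rintro x ⟨i, j, r, hx⟩
  exact ⟨i, j, r, Subtype.ext hx⟩

/-- Generators have negative degree, so the filtration is exhausted at `0`. Descending arguments
start here and reach a given `p` in finitely many steps, without any separatedness. -/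
lemma degFiltration_of_nonneg {p : ℤ} (hp : 0 ≤ p) : degFiltration N p = ⊤ := by
  rw [eq_top_iff]
  rintro x -
  refine degFiltration_mono N hp ?_
  have hx : x ∈ Algebra.adjoin ℂ⟦X⟧ {x | ∃ (i j : Fin N) (r : ℕ+), x = tMinus i j r} := by
    rw [adjoin_tMinus]; trivial
  induction hx using Algebra.adjoin_induction with
  | mem x hx =>
    obtain ⟨i, j, r, rfl⟩ := hx
    exact degFiltration_mono N (by simp) (tMinus_mem i j r)
  | algebraMap r =>
    rw [Algebra.algebraMap_eq_smul_one]
    exact Submodule.smul_mem _ _ (SetLike.one_mem_graded (degFiltration N))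
  | add x y _ _ hx hy => exact add_mem hx hy
  | mul x y _ _ hx hy =>
    have := SetLike.mul_mem_graded hx hy
    rwa [add_zero] at this

/-- The degree filtration is saturated with respect to `h`. -/
lemma mem_of_hbar_mul_mem {p : ℤ} {x : DualYangian N} (hx : hbar _ * x ∈ degFiltration N p) :
    x ∈ degFiltration N p := by
  rcases le_or_gt 0 p with hp | hp
  · rw [degFiltration_of_nonneg hp]; trivial
  -- If `x ∈ F_(-k)` with `p < -k`, then `h x ∈ F_p ⊆ F_(-k-1)`, so `h` kills the symbol of `x` in
  -- degree `-k`. There is no `h`-torsion in the graded algebra; hence `x ∈ F_(-k-1)`.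
  have key : ∀ k : ℕ, (k : ℤ) ≤ -p → x ∈ degFiltration N (-(k : ℤ)) := by
    intro k
    induction k with
    | zero => intro _; rw [degFiltration_of_nonneg (by simp)]; trivial
    | succ k ih =>
      intro hk
      have h1 := ih (by omega)
      have h2 : (PowerSeries.X : ℂ⟦X⟧) • GrAlg.sym (degFiltration N) _ ⟨x, h1⟩ = 0 := by
        rw [GrAlg.smul_sym, GrAlg.sym_eq_zero]
        rw [hbar, ← Algebra.smul_def] at hx
        exact degFiltration_mono N (by omega) hx
      have h3 := (GrAlg.sym_eq_zero _ _).1 (GrAlg.eq_zero_of_hbar_smul h2)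
      convert h3 using 2
      push_cast
      ring
  have := key (-p).toNat (by omega)
  rwa [show -((-p).toNat : ℤ) = p by omega] at this

/-- The matrix polynomial part of the coproduct of `ι x` is `x` itself. -/
lemma Env.ι_current_injective : Function.Injective (Env.ι : current N →+ Env (current N)) := by
  rw [injective_iff_map_eq_zero]
  intro x hx
  have h1 : (currentCoproduct N).Δ (Env.ι x) = _ := (currentCoproduct N).Δ_e x
  have h2 : (currentCoproduct N).e x = 0 := hx
  rw [hx, map_zero, h2, map_zero, map_zero, zero_add] at h1
  apply Subtype.ext
  ext m i j
  have h3 := congrArg (fun q ↦ q.coeff m i j) h1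
  simp only [Polynomial.coeff_zero, Matrix.zero_apply, Polynomial.coeff_map, constMap_apply] at h3
  have h4 := Env.algebraMap_injective (h3.symm.trans (map_zero _).symm)
  have h5 := congrArg PowerSeries.constantCoeff h4
  rw [PowerSeries.constantCoeff_C, map_zero] at h5
  exact h5

/-- `tLin` is injective modulo terms of lower degree. -/
lemma eq_of_tLin_sub_mem (m : ℕ+) {B B' : Matrix (Fin N) (Fin N) ℂ}
    (h : tLin m B - tLin m B' ∈ degFiltration N (-((m : ℕ) : ℤ) - 1)) : B = B' := by
  rw [← map_sub] at h
  have h1 := currentLift_single (B - B') m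
  rw [(GrAlg.sym_eq_zero _ _).2 h] at h1
  have h2 := Env.ι_current_injective
    ((currentLift_injective (h1.trans (map_zero _).symm)).trans (map_zero _).symm)
  have h3 := congrArg (fun x : current N ↦ (x : Polynomial (Matrix (Fin N) (Fin N) ℂ)).coeff m) h2
  have h4 : (Polynomial.monomial (m : ℕ) (B - B')).coeff m = 0 := h3
  rw [Polynomial.coeff_monomial, if_pos rfl] at h4
  exact sub_eq_zero.1 h4

end UntwistedLift

/-! ### The reflection equation for `S = T G T'ᵗ` -/

section Reflection

variable {Z B : Type*} [CommRing Z] [Ring B] [Algebra Z B] {N : ℕ}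

variable (B N) in
/-- The partial transpose of the permutation operator. -/
def permTranspose : Matrix (Fin N × Fin N) (Fin N × Fin N) B :=
  Matrix.of fun p q ↦ if p.1 = p.2 ∧ q.1 = q.2 then 1 else 0

/-- The matrix `z - h P`. -/
def yangR (B : Type*) [Ring B] [Algebra Z B] (N : ℕ) (z h : Z) :
    Matrix (Fin N × Fin N) (Fin N × Fin N) B := z • 1 - h • permMatrix B N

/-- The matrix `y + h Pᵗ`. -/
def yangRt (B : Type*) [Ring B] [Algebra Z B] (N : ℕ) (y h : Z) :
    Matrix (Fin N × Fin N) (Fin N × Fin N) B := y • 1 + h • permTranspose B N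

lemma leg1_mul_permTranspose_apply (T : Matrix (Fin N) (Fin N) B) (p q : Fin N × Fin N) :
    (leg1 T * permTranspose B N) p q = if q.1 = q.2 then T p.1 p.2 else 0 := by
  simp [Matrix.mul_apply, Fintype.sum_prod_type, leg1, Matrix.kroneckerMap_apply, Matrix.one_apply,
    permTranspose, ite_and]

lemma leg2_mul_permTranspose_apply (T : Matrix (Fin N) (Fin N) B) (p q : Fin N × Fin N) :
    (leg2 T * permTranspose B N) p q = if q.1 = q.2 then T p.2 p.1 else 0 := by
  simp [Matrix.mul_apply, Fintype.sum_prod_type, leg2, Matrix.kroneckerMap_apply, Matrix.one_apply,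
    permTranspose, ite_and]

lemma leg1_mul_permTranspose_mul_leg2_apply (T V : Matrix (Fin N) (Fin N) B) (i j k l : Fin N) :
    (leg1 T * permTranspose B N * leg2 V) (i, k) (j, l) = T i k * V j l := by
  rw [Matrix.mul_apply]
  simp [leg1_mul_permTranspose_apply, Fintype.sum_prod_type, leg2, Matrix.kroneckerMap_apply,
    Matrix.one_apply]

lemma leg2_mul_permTranspose_mul_leg1_apply (T V : Matrix (Fin N) (Fin N) B) (i j k l : Fin N) :
    (leg2 V * permTranspose B N * leg1 T) (i, k) (j, l) = V k i * T l j := by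
  rw [Matrix.mul_apply]
  simp [leg2_mul_permTranspose_apply, Fintype.sum_prod_type, leg1, Matrix.kroneckerMap_apply,
    Matrix.one_apply]

/-- The ternary relation between the entries of two matrices, with denominators cleared. -/
def TernRel (z h : Z) (T V : Matrix (Fin N) (Fin N) B) : Prop :=
  ∀ i j k l, z • (T i j * V k l - V k l * T i j) = h • (T k j * V i l - V k j * T i l)

variable {z y h : Z} {T T' V V' : Matrix (Fin N) (Fin N) B}

lemma yangR_mul_apply (M : Matrix (Fin N × Fin N) (Fin N × Fin N) B) (i k : Fin N)
    (q : Fin N × Fin N) : (yangR B N z h * M) (i, k) q = z • M (i, k) q - h • M (k, i) q := by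
  rw [yangR, sub_mul, smul_mul_assoc, smul_mul_assoc, one_mul, Matrix.sub_apply, Matrix.smul_apply,
    Matrix.smul_apply, permMatrix_mul_apply]

lemma mul_yangR_apply (M : Matrix (Fin N × Fin N) (Fin N × Fin N) B) (p : Fin N × Fin N)
    (j l : Fin N) : (M * yangR B N z h) p (j, l) = z • M p (j, l) - h • M p (l, j) := by
  rw [yangR, mul_sub, mul_smul_comm, mul_smul_comm, mul_one, Matrix.sub_apply, Matrix.smul_apply,
    Matrix.smul_apply, mul_permMatrix_apply]

lemma leg1_mul_yangRt_mul_leg2_apply (T V : Matrix (Fin N) (Fin N) B) (i j k l : Fin N) :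
    (leg1 T * yangRt B N y h * leg2 V) (i, k) (j, l) =
      y • (T i j * V k l) + h • (T i k * V j l) := by
  rw [yangRt, mul_add, mul_smul_comm, mul_smul_comm, mul_one, add_mul, smul_mul_assoc,
    smul_mul_assoc, Matrix.add_apply, Matrix.smul_apply, Matrix.smul_apply, leg1_mul_leg2_apply,
    leg1_mul_permTranspose_mul_leg2_apply]

lemma leg2_mul_yangRt_mul_leg1_apply (T V : Matrix (Fin N) (Fin N) B) (i j k l : Fin N) :
    (leg2 V * yangRt B N y h * leg1 T) (i, k) (j, l) =
      y • (V k l * T i j) + h • (V k i * T l j) := by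
  rw [yangRt, mul_add, mul_smul_comm, mul_smul_comm, mul_one, add_mul, smul_mul_assoc,
    smul_mul_assoc, Matrix.add_apply, Matrix.smul_apply, Matrix.smul_apply, leg2_mul_leg1_apply,
    leg2_mul_permTranspose_mul_leg1_apply]

lemma TernRel.yangR_comm (h1 : TernRel z h T V) :
    yangR B N z h * (leg1 T * leg2 V) = leg2 V * leg1 T * yangR B N z h := by
  ext ⟨i, k⟩ ⟨j, l⟩
  rw [yangR_mul_apply, mul_yangR_apply, leg1_mul_leg2_apply, leg1_mul_leg2_apply,
    leg2_mul_leg1_apply, leg2_mul_leg1_apply]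
  have := h1 i j k l
  rw [smul_sub, smul_sub] at this
  rw [← sub_eq_zero] at this ⊢
  rw [← this]
  abel

lemma TernRel.yangR_transpose_comm (h1 : TernRel z h V T) :
    yangR B N z h * (leg1 T.transpose * leg2 V.transpose) =
      leg2 V.transpose * leg1 T.transpose * yangR B N z h := by
  ext ⟨i, k⟩ ⟨j, l⟩
  rw [yangR_mul_apply, mul_yangR_apply, leg1_mul_leg2_apply, leg1_mul_leg2_apply,
    leg2_mul_leg1_apply, leg2_mul_leg1_apply]
  have := h1 l k j i
  rw [smul_sub, smul_sub] at this
  rw [← sub_eq_zero, ← neg_eq_zero] at this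
  rw [← sub_eq_zero, ← this]
  simp only [Matrix.transpose_apply]
  abel

/-- Transposing the first tensor factor reverses the products in it and turns `P` into `Pᵗ`; the
parameter `-y` turns `R` into `-(y + h Pᵗ)`. -/
lemma TernRel.yangRt_comm (h1 : TernRel (-y) h T V) :
    leg1 T.transpose * yangRt B N y h * leg2 V = leg2 V * yangRt B N y h * leg1 T.transpose := by
  ext ⟨i, k⟩ ⟨j, l⟩
  rw [leg1_mul_yangRt_mul_leg2_apply, leg2_mul_yangRt_mul_leg1_apply]
  have := h1 j i k l
  rw [smul_sub, smul_sub, neg_smul, neg_smul] at this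
  rw [← sub_eq_zero, ← neg_eq_zero] at this
  rw [← sub_eq_zero, ← this]
  simp only [Matrix.transpose_apply]
  abel

lemma TernRel.yangRt_comm' (h1 : TernRel (-y) h V T) :
    leg2 V.transpose * yangRt B N y h * leg1 T = leg1 T * yangRt B N y h * leg2 V.transpose := by
  ext ⟨i, k⟩ ⟨j, l⟩
  rw [leg1_mul_yangRt_mul_leg2_apply, leg2_mul_yangRt_mul_leg1_apply]
  have := h1 l k i j
  rw [smul_sub, smul_sub, neg_smul, neg_smul] at this
  rw [← sub_eq_zero, ← neg_eq_zero] at this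
  rw [← sub_eq_zero, ← this]
  simp only [Matrix.transpose_apply]
  abel

lemma yangR_yangRt_apply (S S' : Matrix (Fin N) (Fin N) B) (i j k l : Fin N) :
    (yangR B N z h * (leg1 S * yangRt B N y h * leg2 S')) (i, k) (j, l) =
      z • (y • (S i j * S' k l) + h • (S i k * S' j l)) -
        h • (y • (S k j * S' i l) + h • (S k i * S' j l)) := by
  rw [yangR_mul_apply, leg1_mul_yangRt_mul_leg2_apply, leg1_mul_yangRt_mul_leg2_apply]

lemma yangRt_yangR_apply (S S' : Matrix (Fin N) (Fin N) B) (i j k l : Fin N) :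
    (leg2 S' * yangRt B N y h * leg1 S * yangR B N z h) (i, k) (j, l) =
      z • (y • (S' k l * S i j) + h • (S' k i * S l j)) -
        h • (y • (S' k j * S i l) + h • (S' k i * S j l)) := by
  rw [mul_yangR_apply, leg2_mul_yangRt_mul_leg1_apply, leg2_mul_yangRt_mul_leg1_apply]

variable {g : Matrix (Fin N) (Fin N) Z}

/-- The hypothesis on `g` is quadratic, so it holds for symmetric and for skew-symmetric matrices: a
sign from transposition occurs twice. -/
lemma const_reflection (hg : ∀ i j k l, g i k * g j l = g k i * g l j) :
    yangR B N z h * (leg1 (g.map (algebraMap Z B)) * yangRt B N y h * leg2 (g.map (algebraMap Z B))) =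
      leg2 (g.map (algebraMap Z B)) * yangRt B N y h * leg1 (g.map (algebraMap Z B)) *
        yangR B N z h := by
  ext ⟨i, k⟩ ⟨j, l⟩
  rw [yangR_yangRt_apply, yangRt_yangR_apply]
  simp only [Matrix.map_apply, ← map_mul]
  rw [hg i j k l, mul_comm (g k l), mul_comm (g k j)]

/-- The reflection equation for `S = T G T'ᵗ`. -/
lemma reflection (hg : ∀ i j k l, g i k * g j l = g k i * g l j) (h1 : TernRel z h T V)
    (h2 : TernRel (-y) h T' V) (h3 : TernRel (-y) h V' T) (h4 : TernRel z h V' T') :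
    yangR B N z h * (leg1 (T * g.map (algebraMap Z B) * T'.transpose) * yangRt B N y h *
      leg2 (V * g.map (algebraMap Z B) * V'.transpose)) =
    leg2 (V * g.map (algebraMap Z B) * V'.transpose) * yangRt B N y h *
      leg1 (T * g.map (algebraMap Z B) * T'.transpose) * yangR B N z h := by
  have hc : ∀ M : Matrix (Fin N) (Fin N) B, leg1 (g.map (algebraMap Z B)) * leg2 M =
      leg2 M * leg1 (g.map (algebraMap Z B)) := fun M ↦
    leg1_leg2_comm fun i j k l ↦ Algebra.commutes _ _
  have hc' : ∀ M : Matrix (Fin N) (Fin N) B, leg1 M * leg2 (g.map (algebraMap Z B)) =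
      leg2 (g.map (algebraMap Z B)) * leg1 M := fun M ↦
    leg1_leg2_comm fun i j k l ↦ (Algebra.commutes _ _).symm
  have e1 := h1.yangR_comm
  have e2 := h2.yangRt_comm
  have e3 := h3.yangRt_comm'
  have e4 := h4.yangR_transpose_comm
  have e5 := const_reflection (B := B) (z := z) (y := y) (h := h) hg
  have c1 := hc V
  have c2 := hc' T'.transpose
  have c3 := hc' T
  have c4 := hc V'.transpose
  simp only [leg1_mul, leg2_mul]
  generalize yangR B N z h = R at *
  generalize yangRt B N y h = Q at *
  generalize leg1 (g.map (algebraMap Z B)) = G1 at *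
  generalize leg2 (g.map (algebraMap Z B)) = G2 at *
  generalize leg1 T = T1 at *
  generalize leg1 T'.transpose = T1' at *
  generalize leg2 V = V2 at *
  generalize leg2 V'.transpose = V2' at *
  -- The factor `V₂` is moved left to meet `R T₁`, the ternary relation carries `R` past `T₁ V₂`,
  -- the constant solution carries it past `G₁ Q G₂`, and the transposed relation past `T'₁ᵗ V'₂ᵗ`.
  -- The mixed relations with `Q` perform the exchanges needed before and after.
  calc R * (T1 * G1 * T1' * Q * (V2 * G2 * V2'))
      = R * T1 * G1 * (T1' * Q * V2) * G2 * V2' := by simp only [mul_assoc]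
    _ = R * T1 * (G1 * V2) * Q * (T1' * G2) * V2' := by rw [e2]; simp only [mul_assoc]
    _ = (R * (T1 * V2)) * G1 * Q * G2 * T1' * V2' := by rw [c1, c2]; simp only [mul_assoc]
    _ = V2 * T1 * (R * (G1 * Q * G2)) * T1' * V2' := by rw [e1]; simp only [mul_assoc]
    _ = V2 * (T1 * G2) * Q * G1 * (R * (T1' * V2')) := by rw [e5]; simp only [mul_assoc]
    _ = V2 * G2 * T1 * Q * (G1 * V2') * T1' * R := by rw [c3, e4]; simp only [mul_assoc]
    _ = V2 * G2 * (T1 * Q * V2') * G1 * T1' * R := by rw [c4]; simp only [mul_assoc]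
    _ = V2 * G2 * V2' * Q * (T1 * G1 * T1') * R := by rw [← e3]; simp only [mul_assoc]

/-- The entries of the reflection equation, expanded in the coefficients of `h`. -/
lemma reflection_expand (hg : ∀ i j k l, g i k * g j l = g k i * g l j)
    {S S' s s' : Matrix (Fin N) (Fin N) B} (hS : S = g.map (algebraMap Z B) - h • s)
    (hS' : S' = g.map (algebraMap Z B) - h • s')
    (hr : yangR B N z h * (leg1 S * yangRt B N y h * leg2 S') =
      leg2 S' * yangRt B N y h * leg1 S * yangR B N z h) (i j k l : Fin N) :
    (h * h) • ((z * y) • (s i j * s' k l - s' k l * s i j) -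
      z • (g i k • s' j l + g j l • s i k - g k i • s l j - g l j • s' k i) +
      y • (g k j • s' i l + g i l • s k j - g k j • s i l - g i l • s' k j) +
      h • (z • (s i k * s' j l - s' k i * s l j) - y • (s k j * s' i l - s' k j * s i l) +
        (g k i • s' j l + g j l • s k i - g k i • s j l - g j l • s' k i) -
        h • (s k i * s' j l - s' k i * s j l))) = 0 := by
  have h1 := congrFun (congrFun hr (i, k)) (j, l)
  rw [yangR_yangRt_apply, yangRt_yangR_apply] at h1
  rw [← sub_eq_zero] at h1
  have hm : ∀ a b c d : Fin N, S a b * S' c d = (g a b * g c d) • (1 : B) - h • (g a b • s' c d) -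
      h • (g c d • s a b) + (h * h) • (s a b * s' c d) := by
    intro a b c d
    subst hS hS'
    simp only [Matrix.sub_apply, Matrix.map_apply, Matrix.smul_apply, Algebra.algebraMap_eq_smul_one,
      sub_mul, mul_sub, smul_mul_assoc, mul_smul_comm, one_mul, mul_one]
    module
  have hm' : ∀ a b c d : Fin N, S' c d * S a b = (g a b * g c d) • (1 : B) - h • (g a b • s' c d) -
      h • (g c d • s a b) + (h * h) • (s' c d * s a b) := by
    intro a b c d
    subst hS hS'
    simp only [Matrix.sub_apply, Matrix.map_apply, Matrix.smul_apply, Algebra.algebraMap_eq_smul_one,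
      sub_mul, mul_sub, smul_mul_assoc, mul_smul_comm, one_mul, mul_one]
    module
  simp only [hm, hm'] at h1
  -- Terms free of `s`, `s'` cancel, partly by `hg`. The linear terms with coefficient `z y` cancel
  -- in the commutator. What remains has the factor `h²`.
  have h2 := hg i j k l
  rw [← h1, mul_comm (g l j), ← h2]
  module

end Reflection

/-! ### Power series in two variables -/

section TwoVariables

variable {A : Type*} [Ring A] {N : ℕ}

variable (A) in
/-- Power series in two variables `u, v`, with `u` as inner and `v` as outer variable. -/
abbrev Ser₂ : Type _ := A⟦X⟧⟦X⟧

/-- The coefficient of `u ^ a * v ^ b`. -/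
def coeff₂ (a b : ℕ) : Ser₂ A →+ A :=
  (PowerSeries.coeff (R := A) a).toAddMonoidHom.comp (PowerSeries.coeff (R := A⟦X⟧) b).toAddMonoidHom

lemma coeff₂_apply (a b : ℕ) (x : Ser₂ A) :
    coeff₂ a b x = PowerSeries.coeff a (PowerSeries.coeff b x) := rfl

lemma ser₂_ext {x y : Ser₂ A} (h : ∀ a b, coeff₂ a b x = coeff₂ a b y) : x = y := by
  ext b a
  exact h a b

/-- The sequence shifted by one. -/
def prev (f : ℕ → A) : ℕ → A
  | 0 => 0
  | n + 1 => f n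

/-- A series in the variable `u`. -/
def serU : A⟦X⟧ →+* Ser₂ A := PowerSeries.C

/-- A series in the variable `v`. -/
def serV : A⟦X⟧ →+* Ser₂ A := PowerSeries.map PowerSeries.C

lemma coeff₂_serU_mul_serV (f g : A⟦X⟧) (a b : ℕ) :
    coeff₂ a b (serU f * serV g) = PowerSeries.coeff a f * PowerSeries.coeff b g := by
  rw [coeff₂_apply, serU, PowerSeries.coeff_C_mul, serV, PowerSeries.coeff_map,
    PowerSeries.coeff_mul_C]

lemma coeff₂_serV_mul_serU (f g : A⟦X⟧) (a b : ℕ) :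
    coeff₂ a b (serV g * serU f) = PowerSeries.coeff b g * PowerSeries.coeff a f := by
  rw [coeff₂_apply, serU, PowerSeries.coeff_mul_C, serV, PowerSeries.coeff_map,
    PowerSeries.coeff_C_mul]

lemma coeff₂_serU (f : A⟦X⟧) (a b : ℕ) :
    coeff₂ a b (serU f) = if b = 0 then PowerSeries.coeff a f else 0 := by
  rw [coeff₂_apply, serU, PowerSeries.coeff_C]
  split_ifs <;> simp

lemma coeff₂_serV (f : A⟦X⟧) (a b : ℕ) :
    coeff₂ a b (serV f) = if a = 0 then PowerSeries.coeff b f else 0 := by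
  rw [coeff₂_apply, serV, PowerSeries.coeff_map, PowerSeries.coeff_C]

variable (A) in
/-- The variable `u` as a central element. -/
def varU : Subring.center (Ser₂ A) := ⟨PowerSeries.C PowerSeries.X, C_mem_center X_mem_center⟩

variable (A) in
/-- The variable `v` as a central element. -/
def varV : Subring.center (Ser₂ A) := ⟨PowerSeries.X, X_mem_center⟩

/-- A central constant. -/
def cst {c : A} (hc : c ∈ Subring.center A) : Subring.center (Ser₂ A) :=
  ⟨PowerSeries.C (PowerSeries.C c), C_mem_center (C_mem_center hc)⟩

lemma coeff₂_varU_smul (a b : ℕ) (x : Ser₂ A) :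
    coeff₂ a b (varU A • x) = prev (fun a ↦ coeff₂ a b x) a := by
  rw [Subring.smul_def, smul_eq_mul, varU, coeff₂_apply, PowerSeries.coeff_C_mul]
  cases a with
  | zero => simp [prev]
  | succ a => rw [PowerSeries.coeff_succ_X_mul]; rfl

lemma coeff₂_varV_smul (a b : ℕ) (x : Ser₂ A) :
    coeff₂ a b (varV A • x) = prev (fun b ↦ coeff₂ a b x) b := by
  rw [Subring.smul_def, smul_eq_mul, varV, coeff₂_apply]
  cases b with
  | zero => simp [prev]
  | succ b => rw [PowerSeries.coeff_succ_X_mul]; rfl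

lemma coeff₂_cst_smul {c : A} (hc : c ∈ Subring.center A) (a b : ℕ) (x : Ser₂ A) :
    coeff₂ a b (cst hc • x) = c * coeff₂ a b x := by
  rw [Subring.smul_def, smul_eq_mul, cst, coeff₂_apply, PowerSeries.coeff_C_mul,
    PowerSeries.coeff_C_mul, coeff₂_apply]

end TwoVariables

/-! ### The ternary relations for `T⁺(± u)` as power series -/

section PlusSeries

variable {A : Type*} [Ring A] [Algebra ℂ⟦X⟧ A] {N : ℕ} {t : Fin N → Fin N → ℕ+ → A}

/-- This is `(u - v) [T⁺_ij(u), T⁺_kl(v)] = h (T⁺_kj(u) T⁺_il(v) - T⁺_kj(v) T⁺_il(u))`, coefficient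
by coefficient. Multiplication by `u - v` telescopes the sums that come from expanding `(u - v)⁻¹`;
this form has no denominators and admits changes of sign of the variables. -/
lemma prev_plusCoeff_commutator (ht : ∀ i j k l r s, plusComm t i j k l r s = 0)
    (i j k l : Fin N) (a b : ℕ) :
    prev (fun a ↦ plusCoeff t i j a * plusCoeff t k l b - plusCoeff t k l b * plusCoeff t i j a) a -
      prev (fun b ↦ plusCoeff t i j a * plusCoeff t k l b - plusCoeff t k l b * plusCoeff t i j a) b =
      hbar A * (plusCoeff t k j a * plusCoeff t i l b - plusCoeff t k j b * plusCoeff t i l a) := by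
  have h : ∀ r s, plusCoeff t i j r * plusCoeff t k l s - plusCoeff t k l s * plusCoeff t i j r =
      hbar A * ∑ p ∈ Finset.HasAntidiagonal.antidiagonal s,
      (plusCoeff t k j (r + p.1 + 1) * plusCoeff t i l p.2 -
        plusCoeff t k j p.2 * plusCoeff t i l (r + p.1 + 1)) :=
    fun r s ↦ sub_eq_zero.1 (ht i j k l r s)
  match a, b with
  | 0, 0 => simp [prev]
  | a + 1, 0 => simp [prev, h]
  | a + 1, b + 1 =>
    simp only [prev, h]
    rw [Finset.Nat.sum_antidiagonal_succ, ← mul_sub]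
    congr 1
    simp only [add_zero, add_assoc, add_comm 1]
    abel
  | 0, b + 1 =>
    -- For `u^0` there is no shifted term to telescope with. Both halves of the sum are parts of the
    -- sum over pairs adding up to `b + 1`, each lacking one end, so their difference consists of
    -- the two end terms.
    simp only [prev, h, zero_sub, zero_add, ← mul_neg]
    congr 1
    have e1 := Finset.Nat.sum_antidiagonal_succ (n := b)
      (f := fun p ↦ plusCoeff t k j p.1 * plusCoeff t i l p.2)
    have e2 := Finset.Nat.sum_antidiagonal_succ' (n := b)
      (f := fun p ↦ plusCoeff t k j p.1 * plusCoeff t i l p.2)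
    have e3 := Finset.Nat.sum_antidiagonal_swap (n := b)
      (f := fun p ↦ plusCoeff t k j p.1 * plusCoeff t i l (p.2 + 1))
    rw [Finset.sum_sub_distrib]
    simp only [Prod.fst_swap, Prod.snd_swap] at e3
    rw [e3]
    rw [e1] at e2
    rw [← sub_eq_zero, ← neg_eq_zero] at e2
    rw [← sub_eq_zero]
    rw [← e2]
    abel

/-- The series `T⁺(α u)`. -/
def plusScaled (t : Fin N → Fin N → ℕ+ → A) (α : ℤ) : Matrix (Fin N) (Fin N) A⟦X⟧ :=
  Matrix.of fun i j ↦ PowerSeries.mk fun a ↦ α ^ a • plusCoeff t i j a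

lemma coeff_plusScaled (α : ℤ) (i j : Fin N) (a : ℕ) :
    PowerSeries.coeff a (plusScaled t α i j) = α ^ a • plusCoeff t i j a := by
  rw [plusScaled, Matrix.of_apply, PowerSeries.coeff_mk]

lemma plusScaled_one : plusScaled t 1 = tPlusMatrix t := by
  ext i j a
  rw [coeff_plusScaled, one_pow, one_smul, plusCoeff]

lemma plusScaled_neg_one : plusScaled t (-1) = (tPlusMatrix t).map negVar := by
  ext i j a
  rw [coeff_plusScaled, Matrix.map_apply, negVar, PowerSeries.coeff_mk, plusCoeff]
  simp

variable (A) in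
/-- `h` as a central series. -/
def hbar₂ : Subring.center (Ser₂ A) := cst (hbar_mem_center A)

/-- The substitution `u ↦ αu`, `v ↦ βv` multiplies the coefficient of `u^a v^b` by `α^a β^b`. The
signs `α, β = ±1` give the relations involving `T⁺(-u)`. -/
lemma ternRel_serU_serV (ht : ∀ i j k l r s, plusComm t i j k l r s = 0) (α β : ℤ) :
    TernRel (α • varU A - β • varV A) (hbar₂ A) ((plusScaled t α).map serU)
      ((plusScaled t β).map serV) := by
  intro i j k l
  refine ser₂_ext fun a b ↦ ?_
  have h := congrArg (fun x ↦ (α ^ a * β ^ b) • x) (prev_plusCoeff_commutator ht i j k l a b)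
  simp only [hbar₂, sub_smul, smul_assoc, map_sub, map_zsmul, coeff₂_varU_smul, coeff₂_varV_smul,
    coeff₂_cst_smul, Matrix.map_apply, coeff₂_serU_mul_serV, coeff₂_serV_mul_serU, coeff_plusScaled,
    smul_mul_smul_comm]
  have e : ∀ x y : A, (α ^ a * β ^ b) • x - (β ^ b * α ^ a) • y = (α ^ a * β ^ b) • (x - y) :=
    fun x y ↦ by rw [mul_comm (β ^ b), smul_sub]
  have e' : ∀ x y : A, (β ^ b * α ^ a) • x - (α ^ a * β ^ b) • y = (α ^ a * β ^ b) • (x - y) :=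
    fun x y ↦ by rw [mul_comm (β ^ b), smul_sub]
  simp only [e, mul_smul_comm] at h ⊢
  refine Eq.trans ?_ h
  match a, b with
  | 0, 0 => simp [prev]
  | a + 1, 0 => simp only [prev]; module
  | 0, b + 1 => simp only [prev]; module
  | a + 1, b + 1 =>
    simp only [prev]; module

lemma ternRel_serV_serU (ht : ∀ i j k l r s, plusComm t i j k l r s = 0) (α β : ℤ) :
    TernRel (β • varV A - α • varU A) (hbar₂ A) ((plusScaled t β).map serV)
      ((plusScaled t α).map serU) := by
  intro i j k l
  refine ser₂_ext fun a b ↦ ?_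
  have h := congrArg (fun x ↦ (α ^ a * β ^ b) • x) (prev_plusCoeff_commutator ht i j k l b a)
  simp only [hbar₂, sub_smul, smul_assoc, map_sub, map_zsmul, coeff₂_varU_smul, coeff₂_varV_smul,
    coeff₂_cst_smul, Matrix.map_apply, coeff₂_serU_mul_serV, coeff₂_serV_mul_serU, coeff_plusScaled,
    smul_mul_smul_comm]
  have e : ∀ x y : A, (α ^ a * β ^ b) • x - (β ^ b * α ^ a) • y = (α ^ a * β ^ b) • (x - y) :=
    fun x y ↦ by rw [mul_comm (β ^ b), smul_sub]
  have e' : ∀ x y : A, (β ^ b * α ^ a) • x - (α ^ a * β ^ b) • y = (α ^ a * β ^ b) • (x - y) :=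
    fun x y ↦ by rw [mul_comm (β ^ b), smul_sub]
  simp only [e', mul_smul_comm] at h ⊢
  refine Eq.trans ?_ h
  match a, b with
  | 0, 0 => simp [prev]
  | a + 1, 0 => simp only [prev]; module
  | 0, b + 1 => simp only [prev]; module
  | a + 1, b + 1 =>
    simp only [prev]; module

end PlusSeries

/-! ### The reflection equation in coefficients -/

section TwistedRelations

variable {A B : Type*} [Ring A] [Ring B] [Algebra ℂ⟦X⟧ A] [Algebra ℂ⟦X⟧ B] {N : ℕ}
  (G : Matrix (Fin N) (Fin N) ℂ)

/-- `f 0` if `a = 0`, and `0` otherwise. -/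
def atZero (x : A) (a : ℕ) : A := if a = 0 then x else 0

/-- The coefficient of `u ^ r * v ^ (q + 2)` in the reflection equation, written in terms of the
coefficients of the series `s` and divided by `h ^ 2`. -/
def reflCoeff (s : Fin N → Fin N → ℕ → A) (i j k l : Fin N) (r q : ℕ) : A :=
  (prev (prev fun a ↦ s i j a * s k l (q + 2) - s k l (q + 2) * s i j a) r -
    (s i j r * s k l q - s k l q * s i j r)) -
  (prev (atZero (scal A (G i k) * s j l (q + 2) - scal A (G l j) * s k i (q + 2))) r -
    atZero (scal A (G i k) * s j l (q + 1) - scal A (G l j) * s k i (q + 1)) r) +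
  (prev (atZero (scal A (G k j) * s i l (q + 2) - scal A (G i l) * s k j (q + 2))) r +
    atZero (scal A (G k j) * s i l (q + 1) - scal A (G i l) * s k j (q + 1)) r) +
  hbar A * ((prev (fun a ↦ s i k a * s j l (q + 2) - s k i (q + 2) * s l j a) r -
      (s i k r * s j l (q + 1) - s k i (q + 1) * s l j r)) -
    (prev (fun a ↦ s k j a * s i l (q + 2) - s k j (q + 2) * s i l a) r +
      (s k j r * s i l (q + 1) - s k j (q + 1) * s i l r)) +
    atZero (scal A (G k i) * s j l (q + 2) - scal A (G j l) * s k i (q + 2)) r -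
    hbar A * (s k i r * s j l (q + 2) - s k i (q + 2) * s j l r))

omit [Algebra ℂ⟦X⟧ A] [Algebra ℂ⟦X⟧ B] in
lemma map_prev (f : A →+ B) (x : ℕ → A) (n : ℕ) : f (prev x n) = prev (fun a ↦ f (x a)) n := by
  cases n <;> simp [prev]

lemma map_reflCoeff (f : A →ₐ[ℂ⟦X⟧] B) (s : Fin N → Fin N → ℕ → A) (i j k l : Fin N) (r q : ℕ) :
    f (reflCoeff G s i j k l r q) = reflCoeff G (fun i j a ↦ f (s i j a)) i j k l r q := by
  have h := map_hbar f
  have h' := fun c ↦ map_scal f c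
  simp only [RingHom.coe_coe] at h h'
  have hp : ∀ (x : ℕ → A) (n : ℕ), f (prev x n) = prev (fun a ↦ f (x a)) n :=
    map_prev (f : A →+ B)
  have hz : ∀ (x : A) (n : ℕ), f (atZero x n) = atZero (f x) n := fun x n ↦ by
    rw [atZero, apply_ite f, map_zero, atZero]
  simp only [reflCoeff, map_sub, map_add, map_mul, h, h', hp, hz]

omit [Algebra ℂ⟦X⟧ A] in
lemma prev_succ (f : ℕ → A) (n : ℕ) : prev f (n + 1) = f n := rfl

variable {G} {t : Fin N → Fin N → ℕ+ → A}

/-- The reflection equation is applied with `z = u - v` and `y = u + v`. Terms in which a constant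
multiplies an entry of `s(u)` contain `v` at most to the first power, so they are absent from the
coefficients of `v^(q+2)`. The factor `h²` is not cancelled, since `A` may have torsion. -/
lemma hbar_sq_mul_reflCoeff (hG : G.transpose = G ∨ G.transpose = -G)
    (ht : ∀ i j k l r s, plusComm t i j k l r s = 0) (i j k l : Fin N) (r q : ℕ) :
    hbar A * hbar A * reflCoeff G (fun i j a ↦ PowerSeries.coeff a (sSeries G t i j)) i j k l r q
      = 0 := by
  let g : Matrix (Fin N) (Fin N) (Subring.center (Ser₂ A)) :=
    G.map fun c ↦ cst (scal_mem_center (B := A) c)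
  have hs : ∀ c c' : ℂ, cst (scal_mem_center (B := A) c) * cst (scal_mem_center (B := A) c') =
      cst (scal_mem_center (B := A) (c * c')) := fun c c' ↦ Subtype.ext (by
    simp [cst, scal_mul])
  have hg : ∀ i j k l, g i k * g j l = g k i * g l j := by
    intro i j k l
    simp only [g, Matrix.map_apply, hs]
    congr 2
    rcases hG with h | h
    · have e : ∀ a b, G b a = G a b := fun a b ↦ congrFun (congrFun h a) b
      rw [e i k, e j l]
    · have e : ∀ a b, G b a = -G a b := fun a b ↦ congrFun (congrFun h a) b
      rw [e i k, e j l, neg_mul_neg]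
  have hgU : (constMatrix G : Matrix (Fin N) (Fin N) A⟦X⟧).map serU =
      g.map (algebraMap _ (Ser₂ A)) := rfl
  have hgV : (constMatrix G : Matrix (Fin N) (Fin N) A⟦X⟧).map serV =
      g.map (algebraMap _ (Ser₂ A)) := by
    ext1 i j
    exact PowerSeries.map_C (PowerSeries.C (R := A)) (scal A (G i j))
  have hU : (plusScaled t 1).map serU * g.map (algebraMap _ (Ser₂ A)) *
      ((plusScaled t (-1)).map serU).transpose =
        g.map (algebraMap _ (Ser₂ A)) - hbar₂ A • (sSeries G t).map serU := by
    have h := congrArg (serU (A := A)).mapMatrix (sPlusMatrix_eq G t)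
    rw [sPlusMatrix, map_mul, map_mul, map_sub, ← plusScaled_neg_one, ← plusScaled_one] at h
    refine h.trans ?_
    ext1 i j
    simp only [RingHom.mapMatrix_apply, Matrix.sub_apply, Matrix.map_apply, Matrix.smul_apply,
      smul_eq_mul, map_mul, Subring.smul_def]
    rfl
  have hV : (plusScaled t 1).map serV * g.map (algebraMap _ (Ser₂ A)) *
      ((plusScaled t (-1)).map serV).transpose =
        g.map (algebraMap _ (Ser₂ A)) - hbar₂ A • (sSeries G t).map serV := by
    have h := congrArg (serV (A := A)).mapMatrix (sPlusMatrix_eq G t)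
    rw [sPlusMatrix, map_mul, map_mul, map_sub, ← plusScaled_neg_one, ← plusScaled_one] at h
    rw [← hgV]
    refine h.trans ?_
    ext1 i j
    simp only [RingHom.mapMatrix_apply, Matrix.sub_apply, Matrix.map_apply, Matrix.smul_apply,
      smul_eq_mul, map_mul, Subring.smul_def]
    congr 2
    exact PowerSeries.map_C (PowerSeries.C (R := A)) (hbar A)
  have h1 : TernRel (varU A - varV A) (hbar₂ A) ((plusScaled t 1).map serU)
      ((plusScaled t 1).map serV) := by
    simpa using ternRel_serU_serV ht 1 1
  have h2 : TernRel (-(varU A + varV A)) (hbar₂ A) ((plusScaled t (-1)).map serU)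
      ((plusScaled t 1).map serV) := by
    convert ternRel_serU_serV ht (-1) 1 using 1
    module
  have h3 : TernRel (-(varU A + varV A)) (hbar₂ A) ((plusScaled t (-1)).map serV)
      ((plusScaled t 1).map serU) := by
    convert ternRel_serV_serU ht 1 (-1) using 1
    module
  have h4 : TernRel (varU A - varV A) (hbar₂ A) ((plusScaled t (-1)).map serV)
      ((plusScaled t (-1)).map serU) := by
    convert ternRel_serV_serU ht (-1) (-1) using 1
    module
  have h5 := reflection_expand hg hU hV (reflection hg h1 h2 h3 h4) i j k l
  have h6 := congrArg (coeff₂ r (q + 2)) h5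
  rw [map_zero, mul_smul, hbar₂] at h6
  simp only [sub_smul, add_smul, mul_smul, smul_sub, smul_add, map_sub, map_add, coeff₂_varU_smul,
    coeff₂_varV_smul, coeff₂_cst_smul, Matrix.map_apply, coeff₂_serU_mul_serV,
    coeff₂_serV_mul_serU, coeff₂_serU, coeff₂_serV, prev_succ, g] at h6
  rw [← h6, mul_assoc, reflCoeff]
  have e1 : ∀ n : ℕ, ¬n + 1 = 0 := fun n ↦ n.succ_ne_zero
  match r with
  | 0 =>
    simp only [prev, atZero, if_pos, e1, if_false, mul_sub, mul_add, mul_zero]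
    abel
  | 1 =>
    simp only [prev, atZero, if_pos, e1, if_false, mul_sub, mul_add, mul_zero]
    abel
  | r + 2 =>
    simp only [prev, atZero, e1, if_false, mul_sub, mul_add, mul_zero]
    abel

end TwistedRelations

/-! ### The symmetry relation -/

section Symmetry

variable {A : Type*} [Ring A] [Algebra ℂ⟦X⟧ A] {N : ℕ} {t : Fin N → Fin N → ℕ+ → A}

omit [Algebra ℂ⟦X⟧ A] in
lemma coeff_negVar (f : A⟦X⟧) (n : ℕ) :
    PowerSeries.coeff n (negVar f) = (-1 : ℤ) ^ n • PowerSeries.coeff n f := by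
  rw [negVar, PowerSeries.coeff_mk]
  simp

omit [Algebra ℂ⟦X⟧ A] in
lemma coeff_negVar_mul (f g : A⟦X⟧) (n : ℕ) :
    PowerSeries.coeff n (negVar f * g) = (-1 : ℤ) ^ n • PowerSeries.coeff n (f * negVar g) := by
  rw [PowerSeries.coeff_mul, PowerSeries.coeff_mul, Finset.smul_sum]
  refine Finset.sum_congr rfl fun p hp ↦ ?_
  rw [← Finset.HasAntidiagonal.mem_antidiagonal.1 hp, coeff_negVar, coeff_negVar, smul_mul_assoc,
    mul_smul_comm, smul_smul, pow_add, mul_assoc, ← pow_add, Even.neg_one_pow (Even.add_self p.2),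
    mul_one]

/-- The ternary relation for the series `T⁺(u)` and `T⁺(-u)`. -/
lemma coeff_commutator_negVar (ht : ∀ i j k l r s, plusComm t i j k l r s = 0)
    (i j k l : Fin N) (n : ℕ) :
    2 * (PowerSeries.coeff n (tPlusMatrix t i j * negVar (tPlusMatrix t k l)) -
        PowerSeries.coeff n (negVar (tPlusMatrix t k l) * tPlusMatrix t i j)) =
      hbar A * (PowerSeries.coeff (n + 1) (tPlusMatrix t k j * negVar (tPlusMatrix t i l)) -
        PowerSeries.coeff (n + 1) (negVar (tPlusMatrix t k j) * tPlusMatrix t i l)) := by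
  have h : ∀ i j k l n, PowerSeries.coeff n (tPlusMatrix t i j * negVar (tPlusMatrix t k l)) =
      ∑ p ∈ Finset.HasAntidiagonal.antidiagonal n,
        (-1 : ℤ) ^ p.2 • (plusCoeff t i j p.1 * plusCoeff t k l p.2) := by
    intro i j k l n
    rw [PowerSeries.coeff_mul]
    refine Finset.sum_congr rfl fun p _ ↦ ?_
    rw [coeff_negVar, mul_smul_comm]
    rfl
  have h' : ∀ i j k l n, PowerSeries.coeff n (negVar (tPlusMatrix t k l) * tPlusMatrix t i j) =
      ∑ p ∈ Finset.HasAntidiagonal.antidiagonal n,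
        (-1 : ℤ) ^ p.2 • (plusCoeff t k l p.2 * plusCoeff t i j p.1) := by
    intro i j k l n
    rw [PowerSeries.coeff_mul, ← Finset.Nat.sum_antidiagonal_swap]
    refine Finset.sum_congr rfl fun p _ ↦ ?_
    rw [coeff_negVar, smul_mul_assoc]
    rfl
  rw [h, h', h, h']
  -- Setting `v = -u` amounts to summing over `a + b = n + 1` with signs `(-1)^b`; the factor `u -
  -- v` becomes `2u`.
  have e := Finset.sum_congr (rfl : Finset.HasAntidiagonal.antidiagonal (n + 1) = _) fun p _ ↦
    congrArg (fun x ↦ (-1 : ℤ) ^ p.2 • x) (prev_plusCoeff_commutator ht i j k l p.1 p.2)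
  have hh : ∀ (m : ℤ) (x : A), m • (hbar A * x) = hbar A * m • x := fun m x ↦ by
    rw [mul_smul_comm]
  simp only [smul_sub, Finset.sum_sub_distrib] at e
  rw [Finset.Nat.sum_antidiagonal_succ, Finset.Nat.sum_antidiagonal_succ'] at e
  simp only [prev, smul_zero, zero_add, mul_sub, hh, smul_sub, Finset.sum_sub_distrib,
    pow_succ, mul_neg_one, neg_smul, Finset.sum_neg_distrib, ← Finset.mul_sum] at e
  rw [mul_sub (hbar A), ← e]
  noncomm_ring

/-- The symmetry relation for the coefficients of `sSeries`. -/
lemma hbar_mul_symmetry {G : Matrix (Fin N) (Fin N) ℂ} {ε : ℤ} (hε : ε * ε = 1)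
    (hG : G.transpose = ε • G) (ht : ∀ i j k l r s, plusComm t i j k l r s = 0)
    (i j : Fin N) (n : ℕ) :
    hbar A * (2 * (PowerSeries.coeff n (sSeries G t i j) -
        (ε * (-1) ^ n) • PowerSeries.coeff n (sSeries G t j i)) -
      hbar A * ((1 + (-1 : ℤ) ^ n) • PowerSeries.coeff (n + 1) (sSeries G t j i))) = 0 := by
  have hS : ∀ i j n, PowerSeries.coeff n (sPlusMatrix G t i j) = ∑ a, ∑ b, scal A (G a b) *
      PowerSeries.coeff n (tPlusMatrix t i a * negVar (tPlusMatrix t j b)) := by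
    intro i j n
    rw [sPlusMatrix, Matrix.mul_apply, map_sum, Finset.sum_comm]
    refine Finset.sum_congr rfl fun b _ ↦ ?_
    rw [Matrix.mul_apply, Finset.sum_mul, map_sum]
    refine Finset.sum_congr rfl fun a _ ↦ ?_
    rw [constMatrix, Matrix.map_apply, Matrix.transpose_apply, Matrix.map_apply,
      Subring.mem_center_iff.1 (C_mem_center (scal_mem_center _)), mul_assoc,
      PowerSeries.coeff_C_mul]
  have hT : ∀ i j n, PowerSeries.coeff n (sPlusMatrix G t i j) =
      (if n = 0 then scal A (G i j) else 0) - hbar A * PowerSeries.coeff n (sSeries G t i j) := by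
    intro i j n
    rw [sPlusMatrix_eq, Matrix.sub_apply, Matrix.smul_apply, smul_eq_mul, map_sub,
      PowerSeries.coeff_C_mul, constMatrix, Matrix.map_apply, PowerSeries.coeff_C]
  have h1 : 2 * (PowerSeries.coeff n (sPlusMatrix G t i j) -
      (ε * (-1) ^ n) • PowerSeries.coeff n (sPlusMatrix G t j i)) =
      hbar A * ((1 + (-1 : ℤ) ^ n) • PowerSeries.coeff (n + 1) (sPlusMatrix G t j i)) := by
    have hz : ∀ (m : ℤ) (c : ℂ), scal A (m • c) = m • scal A c := fun m c ↦ by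
      rw [scal, map_zsmul, map_zsmul, scal]
    have hGab : ∀ a b, G b a = ε • G a b := fun a b ↦ congrFun (congrFun hG a) b
    -- The relation between `T⁺_ia(u)` and `T⁺_jb(-u)` is summed against `G_ab`. The products in
    -- reversed order then form `S_ji(-u)` with `G` transposed, which is the origin of `ε`.
    have e := Finset.sum_congr rfl fun a (_ : a ∈ Finset.univ) ↦ Finset.sum_congr rfl
      fun b (_ : b ∈ Finset.univ) ↦ congrArg (fun x ↦ scal A (G a b) * x)
        (coeff_commutator_negVar ht i a j b n)
    have e1 : ∑ a, ∑ b, scal A (G a b) *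
        PowerSeries.coeff n (tPlusMatrix t j b * negVar (tPlusMatrix t i a)) =
          ε • PowerSeries.coeff n (sPlusMatrix G t j i) := by
      rw [hS, Finset.sum_comm]
      simp only [Finset.smul_sum, ← smul_mul_assoc, ← hz, ← hGab]
    have hh : ∀ x, hbar A * x = x * hbar A := fun x ↦
      (Subring.mem_center_iff.1 (hbar_mem_center A) x).symm
    have ht : ∀ x : A, 2 * x = x * 2 := fun x ↦ by noncomm_ring
    rw [hh, ht]
    simp only [hh, ht] at e
    simp only [← mul_assoc, ← Finset.sum_mul, coeff_negVar_mul, mul_sub, mul_smul_comm,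
      Finset.sum_sub_distrib, ← Finset.smul_sum, e1, ← hS] at e
    convert e using 2 
    · rw [smul_smul, mul_comm]
    · rw [pow_succ]; module
  rw [hT, hT, hT, if_neg n.succ_ne_zero] at h1
  have e0 : (if n = 0 then scal A (G i j) else 0) -
      (ε * (-1) ^ n) • (if n = 0 then scal A (G j i) else 0) = 0 := by
    have hGij : G j i = ε • G i j := congrFun (congrFun hG i) j
    split_ifs with h
    · rw [hGij, h, pow_zero, mul_one, scal, scal, map_zsmul, map_zsmul, smul_smul, hε, one_smul,
        sub_self]
    · simp
  have h2 : 2 * hbar A = hbar A * 2 := Subring.mem_center_iff.1 (hbar_mem_center A) 2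
  have h3 : ∀ x y : A, x - hbar A * PowerSeries.coeff n (sSeries G t i j) -
      (ε * (-1) ^ n) • (y - hbar A * PowerSeries.coeff n (sSeries G t j i)) =
      (x - (ε * (-1) ^ n) • y) - hbar A * (PowerSeries.coeff n (sSeries G t i j) -
        (ε * (-1) ^ n) • PowerSeries.coeff n (sSeries G t j i)) := by
    intro x y
    rw [smul_sub, mul_sub, mul_smul_comm]
    abel
  rw [h3, e0, zero_sub, zero_sub, mul_neg, ← mul_assoc, h2, smul_neg, mul_neg, neg_inj] at h1
  rw [mul_sub, ← mul_assoc, h1]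
  simp only [mul_smul_comm, sub_self]

end Symmetry

lemma mem_of_sub_sub_add_add_mem {A : Type*} [AddCommGroup A] {S : AddSubgroup A} {p c x y z : A}
    (hp : p ∈ S) (hx : x ∈ S) (hy : y ∈ S) (hz : z ∈ S) (h : p - c - x + y + z ∈ S) : c ∈ S := by
  have e : c = p - x + y + z - (p - c - x + y + z) := by abel
  rw [e]
  exact sub_mem (add_mem (add_mem (sub_mem hp hx) hy) hz) h

/-! ### Leading terms of the relations of the `s_ij^(-r)` -/

section FilteredRelations

variable {A : Type*} [Ring A] [Algebra ℂ⟦X⟧ A] {N : ℕ}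

/-- The linear combination of the elements `s i j n` with coefficients given by a matrix. -/
def linComb (s : Fin N → Fin N → ℕ → A) (n : ℕ) : Matrix (Fin N) (Fin N) ℂ →+ A where
  toFun M := ∑ i, ∑ j, scal A (M i j) * s i j n
  map_zero' := by simp [scal]
  map_add' M M' := by simp [scal_add, add_mul, Finset.sum_add_distrib]

variable {s : Fin N → Fin N → ℕ → A}

lemma linComb_apply (n : ℕ) (M : Matrix (Fin N) (Fin N) ℂ) :
    linComb s n M = ∑ i, ∑ j, scal A (M i j) * s i j n := rfl

lemma linComb_smul (n : ℕ) (c : ℂ) (M : Matrix (Fin N) (Fin N) ℂ) :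
    linComb s n (c • M) = scal A c * linComb s n M := by
  simp only [linComb_apply, Matrix.smul_apply, smul_eq_mul, scal_mul, Finset.mul_sum, mul_assoc]

lemma linComb_single (n : ℕ) (i j : Fin N) : linComb s n (Matrix.single i j 1) = s i j n := by
  rw [linComb_apply, Finset.sum_eq_single i, Finset.sum_eq_single j]
  · simp [scal]
  · intro k _ hk
    simp [hk.symm, scal]
  · simp
  · intro k _ hk
    simp [hk.symm, scal]
  · simp

variable (s) (W : ℤ → Submodule ℂ⟦X⟧ A)

/-- The elements of degree `-(n + 1)` which are linear in the `s i j n` up to terms of lower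
degree. -/
def linMod (n : ℕ) : AddSubgroup A := (linComb s n).range ⊔ (W (-(n : ℤ) - 2)).toAddSubgroup

variable {s W}

lemma mem_linMod {n : ℕ} {x : A} :
    x ∈ linMod s W n ↔ ∃ M, x - linComb s n M ∈ W (-(n : ℤ) - 2) := by
  rw [linMod, AddSubgroup.mem_sup]
  constructor
  · rintro ⟨_, ⟨M, rfl⟩, z, hz, rfl⟩
    exact ⟨M, by rwa [add_sub_cancel_left]⟩
  · rintro ⟨M, h⟩
    exact ⟨_, ⟨M, rfl⟩, _, h, add_sub_cancel _ _⟩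

lemma scal_mul_mem_linMod {n : ℕ} (c : ℂ) {x : A} (hx : x ∈ linMod s W n) :
    scal A c * x ∈ linMod s W n := by
  obtain ⟨M, hM⟩ := mem_linMod.1 hx
  refine mem_linMod.2 ⟨c • M, ?_⟩
  rw [linComb_smul, ← mul_sub]
  exact scal_mul_mem _ c hM

lemma gen_mem_linMod (i j : Fin N) (n : ℕ) : s i j n ∈ linMod s W n :=
  mem_linMod.2 ⟨Matrix.single i j 1, by rw [linComb_single, sub_self]; exact zero_mem _⟩

lemma mem_linMod_of_mem {n : ℕ} {x : A} (hx : x ∈ W (-(n : ℤ) - 2)) : x ∈ linMod s W n :=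
  mem_linMod.2 ⟨0, by rwa [map_zero, sub_zero]⟩

lemma pair_mem_linMod (a b : ℂ) (i j k l : Fin N) (n : ℕ) :
    scal A a * s i j n - scal A b * s k l n ∈ linMod s W n :=
  sub_mem (scal_mul_mem_linMod a (gen_mem_linMod i j n))
    (scal_mul_mem_linMod b (gen_mem_linMod k l n))

variable [IsRingFiltration W (fun n ↦ W (n - 1))] (hW : Monotone W)
  (hs : ∀ i j (n : ℕ), s i j n ∈ W (-(n : ℤ) - 1))

include hs in
omit [IsRingFiltration W fun n ↦ W (n - 1)] in
lemma linComb_mem (n : ℕ) (M : Matrix (Fin N) (Fin N) ℂ) : linComb s n M ∈ W (-(n : ℤ) - 1) := by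
  rw [linComb_apply]
  exact Submodule.sum_mem _ fun i _ ↦ Submodule.sum_mem _ fun j _ ↦ scal_mul_mem _ _ (hs i j n)

include hW hs in
lemma gen_mul_gen_mem {i j k l : Fin N} {a b : ℕ} {p : ℤ} (h : -(a : ℤ) - 1 + (-(b : ℤ) - 1) ≤ p) :
    s i j a * s k l b ∈ W p := hW h (SetLike.mul_mem_graded (hs i j a) (hs k l b))

-- The part `(u² - v²) [s_ij(u), s_kl(v)]` of the reflection equation contributes `[s_(r-2),
-- s_(q+2)] - [s_r, s_q]` to the coefficient of `u^r v^(q+2)`, so induction on `r` in steps of two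
-- applies. The other terms are linear in the generators of index `r + q + 1`, or they have a factor
-- `h` and lower degree. The resulting matrix is left unspecified; it can be identified afterwards
-- from leading terms.
include hW hs in
lemma commutator_gen_mem_linMod {G : Matrix (Fin N) (Fin N) ℂ}
    (hr : ∀ i j k l r q p, reflCoeff G s i j k l r q ∈ W p) (i j k l : Fin N) (r q : ℕ) :
    s i j r * s k l q - s k l q * s i j r ∈ linMod s W (r + q + 1) := by
  induction r using Nat.strong_induction_on generalizing q with
  | _ r ih =>
  have hm : ∀ (a b : ℕ), r + q + 1 ≤ a + b →
      ∀ i j k l, s i j a * s k l b ∈ W (-((r + q + 1 : ℕ) : ℤ) - 2) :=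
    fun a b h i j k l ↦ gen_mul_gen_mem hW hs (by omega)
  have h1 : prev (prev fun a ↦ s i j a * s k l (q + 2) - s k l (q + 2) * s i j a) r ∈
      linMod s W (r + q + 1) := by
    match r with
    | 0 => exact zero_mem _
    | 1 => exact zero_mem _
    | r + 2 =>
      have := ih r (by omega) (q + 2)
      rwa [show r + (q + 2) + 1 = r + 2 + q + 1 by omega] at this
  have h2 : ∀ a b i j k l, prev (atZero (scal A a * s i j (q + 2) - scal A b * s k l (q + 2))) r ∈
      linMod s W (r + q + 1) := by
    intro a b i j k l
    match r with
    | 0 => exact zero_mem _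
    | 1 =>
      have := pair_mem_linMod (s := s) (W := W) a b i j k l (q + 2)
      rwa [show 1 + q + 1 = q + 2 by omega]
    | r + 2 => exact zero_mem _
  have h3 : ∀ a b i j k l, atZero (scal A a * s i j (q + 1) - scal A b * s k l (q + 1)) r ∈
      linMod s W (r + q + 1) := by
    intro a b i j k l
    match r with
    | 0 =>
      have := pair_mem_linMod (s := s) (W := W) a b i j k l (q + 1)
      rwa [show 0 + q + 1 = q + 1 by omega]
    | r + 1 => exact zero_mem _
  have h4 : ∀ i j k l i' j' k' l', prev (fun a ↦ s i j a * s k l (q + 2) - s i' j' (q + 2) * s k' l' a) r ∈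
      W (-((r + q + 1 : ℕ) : ℤ) - 2) := by
    intro i j k l i' j' k' l'
    match r with
    | 0 => exact zero_mem _
    | r + 1 => exact sub_mem (hm _ _ (by omega) _ _ _ _) (hm _ _ (by omega) _ _ _ _)
  have h5 : ∀ a b i j k l, atZero (scal A a * s i j (q + 2) - scal A b * s k l (q + 2)) r ∈
      W (-((r + q + 1 : ℕ) : ℤ) - 2) := by
    intro a b i j k l
    match r with
    | 0 =>
      have h : -((q + 2 : ℕ) : ℤ) - 1 ≤ -((0 + q + 1 : ℕ) : ℤ) - 2 := by push_cast; omega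
      exact sub_mem (scal_mul_mem _ _ (hW h (hs i j _))) (scal_mul_mem _ _ (hW h (hs k l _)))
    | r + 1 => exact zero_mem _
  have h6 := mem_linMod_of_mem (s := s) (hr i j k l r q (-((r + q + 1 : ℕ) : ℤ) - 2))
  exact mem_of_sub_sub_add_add_mem h1 (sub_mem (h2 _ _ _ _ _ _) (h3 _ _ _ _ _ _))
    (add_mem (h2 _ _ _ _ _ _) (h3 _ _ _ _ _ _)) (mem_linMod_of_mem (hbar_mul_mem _
      (sub_mem (add_mem (sub_mem (sub_mem (h4 _ _ _ _ _ _ _ _)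
        (sub_mem (hm _ _ (by omega) _ _ _ _) (hm _ _ (by omega) _ _ _ _)))
        (add_mem (h4 _ _ _ _ _ _ _ _)
          (sub_mem (hm _ _ (by omega) _ _ _ _) (hm _ _ (by omega) _ _ _ _)))) (h5 _ _ _ _ _ _))
        (hbar_mul_mem _
          (sub_mem (hm _ _ (by omega) _ _ _ _) (hm _ _ (by omega) _ _ _ _)))))) h6

include hW hs in
lemma commutator_linComb_mem_linMod {G : Matrix (Fin N) (Fin N) ℂ}
    (hr : ∀ i j k l r q p, reflCoeff G s i j k l r q ∈ W p) (r q : ℕ)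
    (M M' : Matrix (Fin N) (Fin N) ℂ) :
    linComb s r M * linComb s q M' - linComb s q M' * linComb s r M ∈ linMod s W (r + q + 1) := by
  induction M using matrix_induction_unit with
  | h0 => simp
  | hadd a b ha hb =>
    convert add_mem ha hb using 1
    simp only [map_add, add_mul, mul_add]
    abel
  | hsmul c a ha =>
    convert scal_mul_mem_linMod c ha using 1
    rw [linComb_smul, mul_sub, mul_assoc, ← mul_assoc (linComb s q M'), scal_mul_comm, mul_assoc]
  | h i j =>
    induction M' using matrix_induction_unit with
    | h0 => simp
    | hadd a b ha hb =>
      convert add_mem ha hb using 1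
      simp only [map_add, add_mul, mul_add]
      abel
    | hsmul c a ha =>
      convert scal_mul_mem_linMod c ha using 1
      rw [linComb_smul, mul_sub, mul_assoc, ← mul_assoc (linComb s r _), scal_mul_comm, mul_assoc]
    | h k l =>
      rw [linComb_single, linComb_single]
      exact commutator_gen_mem_linMod hW hs hr i j k l r q

-- In the symmetry relation the term with factor `h` contains `s_ji` with index `n + 1` and is of
-- lower degree; the factor `2` is invertible.
include hW hs in
omit [IsRingFiltration W fun n ↦ W (n - 1)] in
lemma linComb_sub_transpose_mem {ε : ℤ} (hsymm : ∀ i j n p,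
      2 * (s i j n - (ε * (-1) ^ n) • s j i n) - hbar A * ((1 + (-1 : ℤ) ^ n) • s j i (n + 1)) ∈ W p)
    (n : ℕ) (M : Matrix (Fin N) (Fin N) ℂ) :
    linComb s n (M - (ε * (-1) ^ n) • M.transpose) ∈ W (-(n : ℤ) - 2) := by
  have h1 : ∀ i j, s i j n - (ε * (-1) ^ n) • s j i n ∈ W (-(n : ℤ) - 2) := by
    intro i j
    have h := add_mem (hsymm i j n (-(n : ℤ) - 2)) (hbar_mul_mem _
      (zsmul_mem (hW (show -((n + 1 : ℕ) : ℤ) - 1 ≤ -(n : ℤ) - 2 by push_cast; omega)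
        (hs j i (n + 1))) (1 + (-1 : ℤ) ^ n)))
    rw [sub_add_cancel] at h
    have h2 := scal_mul_mem _ (1 / 2) h
    have h3 : scal A (1 / 2) * 2 = 1 := by
      have : (2 : A) = scal A 2 := by rw [scal, map_ofNat, map_ofNat]
      rw [this, ← scal_mul]
      norm_num [scal]
    rwa [← mul_assoc, h3, one_mul] at h2
  induction M using matrix_induction_unit with
  | h0 => simp
  | hadd a b ha hb =>
    convert add_mem ha hb using 1
    rw [Matrix.transpose_add, smul_add, ← map_add]
    congr 1
    abel
  | hsmul c a ha =>
    convert scal_mul_mem _ c ha using 1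
    rw [Matrix.transpose_smul, smul_comm, ← smul_sub, linComb_smul]
  | h i j =>
    rw [Matrix.transpose_single, map_sub, map_zsmul, linComb_single, linComb_single]
    exact h1 i j

end FilteredRelations

/-! ### The filtration of `Y⁺(g_N)` defined by its generators -/

section GeneratorFiltration

variable {N : ℕ} (G : Matrix (Fin N) (Fin N) ℂ)

/-- The generator `s_ij^(-n-1)` of `Y⁺(g_N)`. -/
def sTw (i j : Fin N) (n : ℕ) : TwistedDual G :=
  (⟨sMinus G i j n.succPNat, Algebra.subset_adjoin ⟨i, j, n.succPNat, rfl⟩⟩ : twistedDual G)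

lemma val_sTw (i j : Fin N) (n : ℕ) :
    TwistedDual.val G (sTw G i j n) = PowerSeries.coeff n (sSeries G tMinus i j) := by
  change sMinus G i j n.succPNat = _
  rw [sMinus, Nat.natPred_succPNat]

lemma val_injective : Function.Injective (TwistedDual.val G) := Subtype.val_injective

/-- The elements of degree `-∞`. -/
def negInfinity : Submodule ℂ⟦X⟧ (TwistedDual G) := ⨅ q, twistedFiltration G q

variable {G}

lemma mem_negInfinity {x : TwistedDual G} :
    x ∈ negInfinity G ↔ ∀ q, TwistedDual.val G x ∈ degFiltration N q := Submodule.mem_iInf _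

/-- Every element has degree at most `0`, so multiplication never raises degrees; the elements of
degree `-∞` form an ideal. -/
lemma mul_mem_negInfinity {x : TwistedDual G} (y : TwistedDual G) (hx : x ∈ negInfinity G) :
    x * y ∈ negInfinity G := by
  rw [mem_negInfinity] at hx ⊢
  intro q
  have h : TwistedDual.val G y ∈ degFiltration N 0 := by
    rw [degFiltration_of_nonneg le_rfl]; trivial
  have h1 := SetLike.mul_mem_graded (hx q) h
  rwa [add_zero, ← map_mul] at h1

lemma mul_mem_negInfinity' {x : TwistedDual G} (y : TwistedDual G) (hx : x ∈ negInfinity G) :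
    y * x ∈ negInfinity G := by
  rw [mem_negInfinity] at hx ⊢
  intro q
  have h : TwistedDual.val G y ∈ degFiltration N 0 := by
    rw [degFiltration_of_nonneg le_rfl]; trivial
  have h1 := SetLike.mul_mem_graded h (hx q)
  rwa [zero_add, ← map_mul] at h1

/-- Saturation of the degree filtration puts `h`-torsion into every step. Relations known only after
multiplication by a power of `h` can thus be used modulo `negInfinity`. -/
lemma mem_negInfinity_of_hbar_mul {x : TwistedDual G}
    (hx : hbar _ * TwistedDual.val G x = 0) : x ∈ negInfinity G :=
  mem_negInfinity.2 fun q ↦ mem_of_hbar_mul_mem (by rw [hx]; exact zero_mem _)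

lemma mem_negInfinity_of_hbar_sq_mul {x : TwistedDual G}
    (hx : hbar _ * hbar _ * TwistedDual.val G x = 0) : x ∈ negInfinity G :=
  mem_negInfinity.2 fun q ↦ mem_of_hbar_mul_mem (mem_of_hbar_mul_mem (by
    rw [← mul_assoc, hx]; exact zero_mem _))

variable (G)

/-- The submodules spanned by the monomials in the generators of degree at most `p` and the elements
of degree `-∞`. -/
def genFiltration (p : ℤ) : Submodule ℂ⟦X⟧ (TwistedDual G) :=
  Submodule.span ℂ⟦X⟧ {x | ∃ l : List (Fin N × Fin N × ℕ),
    (l.map fun g ↦ -(g.2.2 : ℤ) - 1).sum ≤ p ∧ x = (l.map fun g ↦ sTw G g.1 g.2.1 g.2.2).prod} ⊔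
      negInfinity G

lemma genFiltration_mono : Monotone (genFiltration G) := fun _ _ hpq ↦
  sup_le_sup (Submodule.span_mono fun _ ⟨l, hl, hx⟩ ↦ ⟨l, hl.trans hpq, hx⟩) le_rfl

instance genFiltration_gradedMonoid : SetLike.GradedMonoid (genFiltration G) where
  one_mem := Submodule.mem_sup_left (Submodule.subset_span ⟨[], by simp, by simp⟩)
  mul_mem p q x y hx hy := by
    obtain ⟨x, hx₁, x', hx', rfl⟩ := Submodule.mem_sup.1 hx
    obtain ⟨y, hy₁, y', hy', rfl⟩ := Submodule.mem_sup.1 hy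
    rw [add_mul, mul_add]
    refine add_mem (add_mem (Submodule.mem_sup_left ?_)
      (Submodule.mem_sup_right (mul_mem_negInfinity' _ hy')))
      (Submodule.mem_sup_right (mul_mem_negInfinity _ hx'))
    have h := Submodule.mul_mem_mul hx₁ hy₁
    rw [Submodule.span_mul_span] at h
    refine Submodule.span_mono ?_ h
    rintro _ ⟨_, ⟨l, hl, rfl⟩, _, ⟨l', hl', rfl⟩, rfl⟩
    refine ⟨l ++ l', ?_, by simp⟩
    rw [List.map_append, List.sum_append]
    exact add_le_add hl hl'

instance genFiltration_isRingFiltration :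
    IsRingFiltration (genFiltration G) (fun n ↦ genFiltration G (n - 1)) :=
  IsRingFiltration.mk_int _ (genFiltration_mono G)

lemma sTw_mem (i j : Fin N) (n : ℕ) : sTw G i j n ∈ genFiltration G (-(n : ℤ) - 1) :=
  Submodule.mem_sup_left (Submodule.subset_span ⟨[(i, j, n)], by simp, by simp⟩)

lemma negInfinity_le (p : ℤ) : negInfinity G ≤ genFiltration G p := le_sup_right

/-- The leading term of the expansion of the `s_ij^(-n-1)` in the `t_ij^(-n-1)`. -/
def leadMatrix (n : ℕ) (M : Matrix (Fin N) (Fin N) ℂ) : Matrix (Fin N) (Fin N) ℂ :=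
  M * G.transpose + (-1 : ℤ) ^ n • (M.transpose * G)

variable {G} in
lemma leadMatrix_add (n : ℕ) (M M' : Matrix (Fin N) (Fin N) ℂ) :
    leadMatrix G n (M + M') = leadMatrix G n M + leadMatrix G n M' := by
  rw [leadMatrix, leadMatrix, leadMatrix, Matrix.transpose_add, add_mul, add_mul, smul_add]
  abel

variable {G} in
lemma leadMatrix_smul (n : ℕ) (c : ℂ) (M : Matrix (Fin N) (Fin N) ℂ) :
    leadMatrix G n (c • M) = c • leadMatrix G n M := by
  rw [leadMatrix, leadMatrix, Matrix.transpose_smul, smul_mul_assoc, smul_mul_assoc, smul_add,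
    smul_comm c]

lemma single_mul_eq_sum (i j : Fin N) (M : Matrix (Fin N) (Fin N) ℂ) :
    Matrix.single i j 1 * M = ∑ b, M j b • Matrix.single i b (1 : ℂ) := by
  ext a b
  rw [Matrix.sum_apply]
  by_cases h : a = i
  · subst h
    simp [Matrix.single_apply]
  · simp [h, Ne.symm h]

/-- The part of `sSeries` linear in `τ` gives the matrix `leadMatrix`. In the quadratic part the
indices of the two generators add up to `n + 2`, while the generator itself has degree `-n - 1`. -/
lemma val_sTw_sub_mem (i j : Fin N) (n : ℕ) :
    TwistedDual.val G (sTw G i j n) - tLin n.succPNat (leadMatrix G n (Matrix.single i j 1)) ∈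
      degFiltration N (-(n : ℤ) - 2) := by
  have h1 : ∀ p ∈ Finset.HasAntidiagonal.antidiagonal n, ∀ (a b : Fin N),
      tMinus i a p.1.succPNat * tMinus j b p.2.succPNat ∈ degFiltration N (-(n : ℤ) - 2) := by
    intro p hp a b
    rw [Finset.HasAntidiagonal.mem_antidiagonal] at hp
    refine degFiltration_mono N ?_ (SetLike.mul_mem_graded (tMinus_mem _ _ _) (tMinus_mem _ _ _))
    simp only [Nat.succPNat_coe]
    omega
  have h2 : tLin n.succPNat (leadMatrix G n (Matrix.single i j 1)) =
      PowerSeries.coeff n ((tauMatrix tMinus * constMatrix G +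
        constMatrix G * ((tauMatrix tMinus).map negVar).transpose :
          Matrix (Fin N) (Fin N) (DualYangian N)⟦X⟧) i j) := by
    rw [leadMatrix, Matrix.transpose_single, single_mul_eq_sum, single_mul_eq_sum, map_add,
      map_zsmul, map_sum, map_sum, Matrix.add_apply, map_add, Matrix.mul_apply, Matrix.mul_apply,
      map_sum, map_sum, Finset.smul_sum]
    congr 1
    · refine Finset.sum_congr rfl fun b _ ↦ ?_
      rw [tLin_smul, tLin_single, constMatrix, Matrix.map_apply, PowerSeries.coeff_mul_C,
        scal_mul_comm]
      simp [tauMatrix]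
    · refine Finset.sum_congr rfl fun b _ ↦ ?_
      rw [tLin_smul, tLin_single, constMatrix, Matrix.map_apply, PowerSeries.coeff_C_mul,
        Matrix.transpose_apply, Matrix.map_apply, coeff_negVar, mul_smul_comm]
      simp [tauMatrix]
  rw [val_sTw, sSeries, h2, Matrix.sub_apply, map_sub, sub_sub_cancel_left, Matrix.smul_apply,
    smul_eq_mul, PowerSeries.coeff_C_mul]
  refine neg_mem (hbar_mul_mem _ ?_)
  rw [Matrix.mul_apply, map_sum]
  refine Submodule.sum_mem _ fun b _ ↦ ?_
  rw [Matrix.mul_apply, Finset.sum_mul, map_sum]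
  refine Submodule.sum_mem _ fun a _ ↦ ?_
  rw [constMatrix, Matrix.map_apply, Matrix.transpose_apply, Matrix.map_apply,
    Subring.mem_center_iff.1 (C_mem_center (scal_mem_center _)), mul_assoc, PowerSeries.coeff_C_mul,
    PowerSeries.coeff_mul]
  refine scal_mul_mem _ _ (Submodule.sum_mem _ fun p hp ↦ ?_)
  rw [coeff_negVar, mul_smul_comm]
  refine zsmul_mem ?_ _
  simpa [tauMatrix] using h1 p hp a b

lemma sTw_mem_twistedFiltration (i j : Fin N) (n : ℕ) :
    sTw G i j n ∈ twistedFiltration G (-(n : ℤ) - 1) := by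
  have h := add_mem (degFiltration_mono N (by omega : -(n : ℤ) - 2 ≤ -(n : ℤ) - 1)
    (val_sTw_sub_mem G i j n)) (degFiltration_mono N (by simp)
      (tLin_mem n.succPNat (leadMatrix G n (Matrix.single i j 1))))
  rwa [sub_add_cancel] at h

lemma genFiltration_le (p : ℤ) : genFiltration G p ≤ twistedFiltration G p := by
  refine sup_le (Submodule.span_le.2 ?_) (iInf_le _ p)
  rintro _ ⟨l, hl, rfl⟩
  exact twistedFiltration_mono G hl (GrAlg.list_prod_mem _ _
    (fun g : Fin N × Fin N × ℕ ↦ sTw_mem_twistedFiltration G g.1 g.2.1 g.2.2) l)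

variable {G}

lemma val_linComb_sub_mem (n : ℕ) (M : Matrix (Fin N) (Fin N) ℂ) :
    TwistedDual.val G (linComb (sTw G) n M) - tLin n.succPNat (leadMatrix G n M) ∈
      degFiltration N (-(n : ℤ) - 2) := by
  have hv := fun c ↦ map_scal (TwistedDual.val G) c
  simp only [RingHom.coe_coe] at hv
  induction M using matrix_induction_unit with
  | h0 => simp [leadMatrix]
  | hadd a b ha hb =>
    convert add_mem ha hb using 1
    rw [leadMatrix_add, map_add, map_add, map_add]
    abel
  | hsmul c a ha =>
    convert scal_mul_mem _ c ha using 1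
    rw [leadMatrix_smul, tLin_smul, linComb_smul, map_mul, hv, mul_sub]
  | h i j =>
    rw [linComb_single]
    exact val_sTw_sub_mem G i j n

variable {ε : ℤ} (hε : ε * ε = 1) (hG : G.transpose = ε • G)

lemma reflCoeff_sTw_mem (hG' : G.transpose = G ∨ G.transpose = -G) (i j k l : Fin N) (r q : ℕ)
    (p : ℤ) : reflCoeff G (sTw G) i j k l r q ∈ genFiltration G p := by
  refine negInfinity_le G p (mem_negInfinity_of_hbar_sq_mul ?_)
  rw [map_reflCoeff]
  simp only [val_sTw]
  exact hbar_sq_mul_reflCoeff hG' plusComm_tMinus i j k l r q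

include hε hG in
lemma symmetry_sTw_mem (i j : Fin N) (n : ℕ) (p : ℤ) :
    2 * (sTw G i j n - (ε * (-1) ^ n) • sTw G j i n) -
      hbar _ * ((1 + (-1 : ℤ) ^ n) • sTw G j i (n + 1)) ∈ genFiltration G p := by
  refine negInfinity_le G p (mem_negInfinity_of_hbar_mul ?_)
  have h := map_hbar (TwistedDual.val G)
  rw [RingHom.coe_coe] at h
  rw [map_sub, map_mul, map_mul, map_ofNat, map_sub, map_zsmul, map_zsmul, h, val_sTw, val_sTw,
    val_sTw]
  exact hbar_mul_symmetry hε hG plusComm_tMinus i j n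

end GeneratorFiltration

/-! ### The twisted current algebra and the generators of `Y⁺(g_N)` -/

section TwistedLift

variable {N : ℕ} (G : GL (Fin N) ℂ) (ε : ℤ)

/-- A right inverse of the leading term on the eigenspaces of `σ`. -/
def leadSection : Matrix (Fin N) (Fin N) ℂ →+ Matrix (Fin N) (Fin N) ℂ where
  toFun B := (1 / 2 : ℂ) • ε • (B * (G⁻¹ : GL (Fin N) ℂ))
  map_zero' := by simp
  map_add' B B' := by rw [add_mul, smul_add, smul_add]

lemma leadSection_apply (B : Matrix (Fin N) (Fin N) ℂ) :
    leadSection G ε B = (1 / 2 : ℂ) • ε • (B * (G⁻¹ : GL (Fin N) ℂ)) := rfl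

/-- The linear combinations of the `s_ij^(-m)` that correspond to the elements of the twisted current
Lie algebra. -/
def twistedLin (m : ℕ+) : Matrix (Fin N) (Fin N) ℂ →+ TwistedDual (G : Matrix (Fin N) (Fin N) ℂ) :=
  (linComb (sTw _) m.natPred).comp (leadSection G ε)

lemma twistedLin_apply (m : ℕ+) (B : Matrix (Fin N) (Fin N) ℂ) :
    twistedLin G ε m B = linComb (sTw _) m.natPred (leadSection G ε B) := rfl

lemma natPred_cast (m : ℕ+) : (m.natPred : ℤ) = (m : ℕ) - 1 := by
  have := PNat.natPred_add_one m
  omega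

lemma twistedLin_mem (m : ℕ+) (B : Matrix (Fin N) (Fin N) ℂ) :
    twistedLin G ε m B ∈ genFiltration (G : Matrix (Fin N) (Fin N) ℂ) (-((m : ℕ) : ℤ)) := by
  have h := linComb_mem (W := genFiltration (G : Matrix (Fin N) (Fin N) ℂ)) (sTw_mem _) m.natPred
    (leadSection G ε B)
  rwa [natPred_cast, show -(((m : ℕ) : ℤ) - 1) - 1 = -((m : ℕ) : ℤ) by ring] at h

lemma twistedLin_smul (m : ℕ+) (c : ℂ) (B : Matrix (Fin N) (Fin N) ℂ) :
    twistedLin G ε m (c • B) = scal _ c * twistedLin G ε m B := by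
  rw [twistedLin_apply, twistedLin_apply, ← linComb_smul]
  congr 1
  rw [leadSection_apply, leadSection_apply, smul_mul_assoc, smul_comm ε, smul_comm (1 / 2 : ℂ)]

/-- The eigenspace of `σ` for the eigenvalue `(-1) ^ m`. -/
def eigenSet (m : ℕ+) : Set (Matrix (Fin N) (Fin N) ℂ) :=
  {B | sigma G B = (-1 : ℂ) ^ (m : ℕ) • B}

variable {G ε}

/-- The minus sign in `σ` is absorbed by the shift from `m` to `m - 1`, the power of `u` that
accompanies `s_ij^(-m)`. -/
lemma mem_eigenSet {m : ℕ+} {B : Matrix (Fin N) (Fin N) ℂ} :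
    B ∈ eigenSet G m ↔
      ((G⁻¹ : GL (Fin N) ℂ) * B.transpose * G : Matrix (Fin N) (Fin N) ℂ) =
        (-1 : ℤ) ^ m.natPred • B := by
  have h1 : sigma G B = -((G⁻¹ : GL (Fin N) ℂ) * B.transpose * G : Matrix (Fin N) (Fin N) ℂ) := rfl
  have h2 : (-1 : ℂ) ^ (m : ℕ) • B = -((-1 : ℤ) ^ m.natPred • B) := by
    rw [← PNat.natPred_add_one m, pow_succ, mul_neg_one, neg_smul, ← Int.cast_smul_eq_zsmul ℂ]
    simp
  rw [eigenSet, Set.mem_ofPred_eq, h1, h2, neg_inj]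

variable (hε : ε * ε = 1)
  (hG : (G : Matrix (Fin N) (Fin N) ℂ).transpose = ε • (G : Matrix (Fin N) (Fin N) ℂ))

lemma coe_mul_coe_inv : (G : Matrix (Fin N) (Fin N) ℂ) * (G⁻¹ : GL (Fin N) ℂ) = 1 := by
  rw [← Units.val_mul, mul_inv_cancel, Units.val_one]

lemma coe_inv_mul_coe : ((G⁻¹ : GL (Fin N) ℂ) : Matrix (Fin N) (Fin N) ℂ) * G = 1 := by
  rw [← Units.val_mul, inv_mul_cancel, Units.val_one]

include hε hG in
lemma transpose_coe_inv : ((G⁻¹ : GL (Fin N) ℂ) : Matrix (Fin N) (Fin N) ℂ).transpose =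
    ε • ((G⁻¹ : GL (Fin N) ℂ) : Matrix (Fin N) (Fin N) ℂ) := by
  have h := congrArg Matrix.transpose (coe_mul_coe_inv (G := G))
  rw [Matrix.transpose_mul, hG, Matrix.transpose_one] at h
  have h2 := congrArg (fun M ↦ M * (ε • ((G⁻¹ : GL (Fin N) ℂ) : Matrix (Fin N) (Fin N) ℂ))) h
  simp only [mul_assoc, smul_mul_smul_comm, hε, one_smul, coe_mul_coe_inv, mul_one, one_mul] at h2
  exact h2

lemma neg_one_pow_mul_self (n : ℕ) : (-1 : ℤ) ^ n * (-1) ^ n = 1 := by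
  rw [← mul_pow]; simp

-- For `B` in the eigenspace both summands of `leadMatrix` are equal to `B / 2`, the second one by
-- the eigenvalue equation; this fixes the factor `ε / 2` in `leadSection`.
include hε hG in
lemma leadMatrix_leadSection {m : ℕ+} {B : Matrix (Fin N) (Fin N) ℂ} (hB : B ∈ eigenSet G m) :
    leadMatrix (G : Matrix (Fin N) (Fin N) ℂ) m.natPred (leadSection G ε B) = B := by
  rw [mem_eigenSet] at hB
  have e : B * ((G⁻¹ : GL (Fin N) ℂ) : Matrix (Fin N) (Fin N) ℂ) * G = B := by
    rw [mul_assoc, coe_inv_mul_coe, mul_one]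
  rw [leadSection_apply, leadMatrix, Matrix.transpose_smul, Matrix.transpose_smul,
    Matrix.transpose_mul, transpose_coe_inv hε hG, hG, smul_mul_assoc, smul_mul_smul_comm, hε,
    one_smul, e, smul_mul_assoc ε, smul_smul, hε, one_smul, smul_mul_assoc, hB, smul_comm, smul_smul,
    neg_one_pow_mul_self, one_smul, ← add_smul]
  norm_num

include hG in
lemma leadMatrix_mem_eigenSet (m : ℕ+) (M : Matrix (Fin N) (Fin N) ℂ) :
    leadMatrix (G : Matrix (Fin N) (Fin N) ℂ) m.natPred M ∈ eigenSet G m := by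
  rw [mem_eigenSet, leadMatrix, Matrix.transpose_add, Matrix.transpose_smul, Matrix.transpose_mul,
    Matrix.transpose_mul, Matrix.transpose_transpose, Matrix.transpose_transpose, hG]
  simp only [mul_add, add_mul, smul_mul_assoc, mul_smul_comm, smul_add, smul_smul,
    ← mul_assoc, coe_inv_mul_coe, one_mul, neg_one_pow_mul_self, one_smul]
  abel

-- The composite in this order is the projection `M ↦ (M + ε (-1)^n Mᵗ) / 2`, which averages
-- precisely over the symmetry of the generators.
include hε hG in
lemma leadSection_leadMatrix (n : ℕ) (M : Matrix (Fin N) (Fin N) ℂ) :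
    leadSection G ε (leadMatrix (G : Matrix (Fin N) (Fin N) ℂ) n M) =
      M - (1 / 2 : ℂ) • (M - (ε * (-1) ^ n) • M.transpose) := by
  rw [leadSection_apply, leadMatrix, hG, add_mul, mul_smul_comm, smul_mul_assoc, smul_mul_assoc,
    mul_assoc, mul_assoc, coe_mul_coe_inv, mul_one, mul_one, smul_add, smul_smul, hε, one_smul,
    smul_smul]
  generalize (ε * (-1) ^ n) • M.transpose = M'
  module

-- The difference is half of the combination attached to `M - ε (-1)^(m-1) Mᵗ`, which has lower
-- degree by the symmetry relation. Up to lower degree, a combination of the generators thus depends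
-- only on its leading matrix.
include hε hG in
lemma linComb_sub_twistedLin_mem (m : ℕ+) (M : Matrix (Fin N) (Fin N) ℂ) :
    linComb (sTw _) m.natPred M -
      twistedLin G ε m (leadMatrix (G : Matrix (Fin N) (Fin N) ℂ) m.natPred M) ∈
        genFiltration (G : Matrix (Fin N) (Fin N) ℂ) (-((m : ℕ) : ℤ) - 1) := by
  have h := scal_mul_mem _ (1 / 2) (linComb_sub_transpose_mem
    (genFiltration_mono (G : Matrix (Fin N) (Fin N) ℂ)) (sTw_mem _)
    (symmetry_sTw_mem hε hG) m.natPred M)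
  rw [twistedLin_apply, leadSection_leadMatrix hε hG, map_sub, sub_sub_cancel, linComb_smul]
  rwa [natPred_cast, show -(((m : ℕ) : ℤ) - 1) - 2 = -((m : ℕ) : ℤ) - 1 by ring] at h

include hε hG in
lemma val_twistedLin_sub_mem {m : ℕ+} {B : Matrix (Fin N) (Fin N) ℂ} (hB : B ∈ eigenSet G m) :
    TwistedDual.val _ (twistedLin G ε m B) - tLin m B ∈
      degFiltration N (-((m : ℕ) : ℤ) - 1) := by
  have h := val_linComb_sub_mem (G := (G : Matrix (Fin N) (Fin N) ℂ)) m.natPred (leadSection G ε B)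
  rw [leadMatrix_leadSection hε hG hB, PNat.succPNat_natPred] at h
  rwa [natPred_cast, show -(((m : ℕ) : ℤ) - 1) - 2 = -((m : ℕ) : ℤ) - 1 by ring] at h

lemma commutator_sub_mem {A : Type*} [Ring A] [Algebra ℂ⟦X⟧ A] {F : ℤ → Submodule ℂ⟦X⟧ A}
    [SetLike.GradedMonoid F] {p q : ℤ} {x x' y y' : A} (hx : x' ∈ F p) (hy : y ∈ F q)
    (hxx : x - x' ∈ F (p - 1)) (hyy : y - y' ∈ F (q - 1)) :
    (x * y - y * x) - (x' * y' - y' * x') ∈ F (p + q - 1) := by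
  have h1 := SetLike.mul_mem_graded hxx hy
  have h2 := SetLike.mul_mem_graded hy hxx
  have h3 := SetLike.mul_mem_graded hx hyy
  have h4 := SetLike.mul_mem_graded hyy hx
  rw [show p - 1 + q = p + q - 1 by ring] at h1
  rw [show q + (p - 1) = p + q - 1 by ring] at h2
  rw [show p + (q - 1) = p + q - 1 by ring] at h3
  rw [show q - 1 + p = p + q - 1 by ring] at h4
  convert add_mem (sub_mem h1 h2) (sub_mem h3 h4) using 1
  noncomm_ring

-- The reflection equation gives some matrix `M` with commutator congruent to `linComb M`. Its
-- leading matrix is found in the larger algebra, where the leading terms of the commutator are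
-- governed by `[B, B']`, and the symmetry relation then replaces `linComb M` by `twistedLin` of
-- that matrix.
include hε hG in
lemma twistedLin_commutator_mem (m n : ℕ+) (B B' : Matrix (Fin N) (Fin N) ℂ)
    (hB : B ∈ eigenSet G m) (hB' : B' ∈ eigenSet G n) :
    twistedLin G ε m B * twistedLin G ε n B' - twistedLin G ε n B' * twistedLin G ε m B -
      twistedLin G ε (m + n) (B * B' - B' * B) ∈
        genFiltration (G : Matrix (Fin N) (Fin N) ℂ) (-((m : ℕ) : ℤ) + -((n : ℕ) : ℤ) - 1) := by
  have hd : -((m : ℕ) : ℤ) + -((n : ℕ) : ℤ) = -(((m + n : ℕ+) : ℕ) : ℤ) := by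
    push_cast; ring
  have hG' : (G : Matrix (Fin N) (Fin N) ℂ).transpose = G ∨
      (G : Matrix (Fin N) (Fin N) ℂ).transpose = -G := by
    rcases Int.isUnit_iff.1 (IsUnit.of_mul_eq_one ε hε) with h | h
    · left; rw [hG, h, one_smul]
    · right; rw [hG, h, neg_smul, one_smul]
  obtain ⟨M, hM⟩ := mem_linMod.1 (commutator_linComb_mem_linMod
    (genFiltration_mono (G : Matrix (Fin N) (Fin N) ℂ)) (sTw_mem _)
    (reflCoeff_sTw_mem hG') m.natPred n.natPred (leadSection G ε B) (leadSection G ε B'))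
  have e1 : m.natPred + n.natPred + 1 = (m + n).natPred := by
    have h1 := PNat.natPred_add_one m
    have h2 := PNat.natPred_add_one n
    have h3 := PNat.natPred_add_one (m + n)
    rw [PNat.add_coe] at h3
    omega
  rw [e1, natPred_cast, show -((((m + n : ℕ+) : ℕ) : ℤ) - 1) - 2 =
    -((m : ℕ) : ℤ) + -((n : ℕ) : ℤ) - 1 by rw [hd]; ring] at hM
  have hM' := linComb_sub_twistedLin_mem hε hG (m + n) M
  rw [← hd] at hM'
  -- Both matrices describe the leading term of the same commutator inside `Y⁺(gl_N)`, and `tLin` is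
  -- injective modulo lower degree.
  have e2 : leadMatrix (G : Matrix (Fin N) (Fin N) ℂ) (m + n).natPred M = B * B' - B' * B := by
    refine eq_of_tLin_sub_mem (m + n) ?_
    rw [← hd]
    have h1 := val_twistedLin_sub_mem hε hG hB
    have h2 := val_twistedLin_sub_mem hε hG hB'
    have h0 : TwistedDual.val _ (twistedLin G ε n B') ∈ degFiltration N _ :=
      genFiltration_le _ _ (twistedLin_mem G ε n B')
    have h3 := commutator_sub_mem (F := degFiltration N) (tLin_mem m B) h0 h1 h2
    have h4 := tLin_commutator_mem m n B B'
    have h5 := genFiltration_le _ _ (add_mem hM hM')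
    have h6 := val_twistedLin_sub_mem hε hG (leadMatrix_mem_eigenSet hG (m + n) M)
    rw [← hd] at h6
    have h5' : TwistedDual.val _ _ ∈ degFiltration N _ := h5
    rw [sub_add_sub_cancel, map_sub, map_sub, map_mul, map_mul] at h5'
    have h7 := sub_mem (sub_mem (add_mem h3 h4) h5') h6
    convert h7 using 1
    simp only [twistedLin_apply]
    abel
  have h := add_mem hM hM'
  rw [sub_add_sub_cancel, e2] at h
  exact h

end TwistedLift

/-! ### Maps of associated graded algebras -/

section GradedMap

variable {A B : Type*} [Ring A] [Algebra ℂ⟦X⟧ A] [Ring B] [Algebra ℂ⟦X⟧ B]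
  {F : ℤ → Submodule ℂ⟦X⟧ A} [IsRingFiltration F (fun n ↦ F (n - 1))]
  {F' : ℤ → Submodule ℂ⟦X⟧ B} [IsRingFiltration F' (fun n ↦ F' (n - 1))]
  (f : A →ₐ[ℂ⟦X⟧] B) (hf : ∀ p x, x ∈ F p → f x ∈ F' p)

/-- The map between the components of degree `p` induced by a filtered homomorphism. -/
def grPieceMap (p : ℤ) : GrPiece F p →ₗ[ℂ⟦X⟧] GrPiece F' p :=
  Submodule.liftQ _ (grMk F' p ∘ₗ (f.toLinearMap.restrict (hf p))) (by
    intro x hx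
    rw [LinearMap.mem_ker, LinearMap.comp_apply, grMk_eq_zero]
    exact hf (p - 1) x hx)

/-- The homomorphism of associated graded algebras induced by a filtered homomorphism. -/
def GrAlg.map : GrAlg F →ₐ[ℂ⟦X⟧] GrAlg F' :=
  let g : Gr F →ₐ[ℂ⟦X⟧] Gr F' := DirectSum.toAlgebra ℂ⟦X⟧ (GrPiece F)
    (fun p ↦ (DirectSum.lof ℂ⟦X⟧ ℤ (GrPiece F') p).comp (grPieceMap f hf p))
    (GrAlg.sym_congr (F := F') rfl ⟨f 1, _⟩ ⟨1, SetLike.one_mem_graded F'⟩ (map_one f))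
    (by
      intro p q x y
      obtain ⟨x, rfl⟩ := grMk_surjective p x
      obtain ⟨y, rfl⟩ := grMk_surjective q y
      refine Eq.trans ?_ (GrAlg.sym_mul p q ⟨f x, hf p x x.2⟩ ⟨f y, hf q y y.2⟩).symm
      exact GrAlg.sym_congr (F := F') rfl ⟨f (x * y), hf _ _ (SetLike.mul_mem_graded x.2 y.2)⟩ _
        (map_mul f _ _))
  g

lemma GrAlg.map_sym (p : ℤ) (x : F p) :
    GrAlg.map f hf (GrAlg.sym F p x) = GrAlg.sym F' p ⟨f x, hf p x x.2⟩ :=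
  DirectSum.toAddMonoid_of (fun p ↦ ((DirectSum.lof ℂ⟦X⟧ ℤ (GrPiece F') p).comp
    (grPieceMap f hf p)).toAddMonoidHom) p (grMk F p x)

variable {N : ℕ} {lam : ℕ+ → Matrix (Fin N) (Fin N) ℂ →+ A} {lam' : ℕ+ → Matrix (Fin N) (Fin N) ℂ →+ B}
  (hlam : ∀ (m : ℕ+) B, lam m B ∈ F (-((m : ℕ) : ℤ)))
  (hlam' : ∀ (m : ℕ+) B, lam' m B ∈ F' (-((m : ℕ) : ℤ)))

lemma map_polySym {q : Polynomial (Matrix (Fin N) (Fin N) ℂ)}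
    (h : ∀ m : ℕ+, f (lam m (q.coeff m)) - lam' m (q.coeff m) ∈ F' (-((m : ℕ) : ℤ) - 1)) :
    GrAlg.map f hf (polySym F lam hlam q) = polySym F' lam' hlam' q := by
  have e : polySym F lam hlam q = ∑ m ∈ q.support, homSym F lam hlam m (q.coeff m) := rfl
  have e' : polySym F' lam' hlam' q = ∑ m ∈ q.support, homSym F' lam' hlam' m (q.coeff m) := rfl
  rw [e, e', map_sum]
  refine Finset.sum_congr rfl fun m _ ↦ ?_
  rcases Nat.eq_zero_or_pos m with rfl | hm
  · simp [homSym]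
  · lift m to ℕ+ using hm
    rw [homSym_pos, homSym_pos, GrAlg.map_sym, ← sub_eq_zero, ← map_sub, GrAlg.sym_eq_zero]
    exact h m

end GradedMap

/-! ### The associated graded algebra of `Y⁺(g_N)` -/

section TwistedEquiv

variable {N : ℕ} {G : GL (Fin N) ℂ} {ε : ℤ} (hε : ε * ε = 1)
  (hG : (G : Matrix (Fin N) (Fin N) ℂ).transpose = ε • (G : Matrix (Fin N) (Fin N) ℂ))

include hε hG in
lemma exists_twistedLift : ∃ Θ : Env (twistedCurrent G) →ₐ[ℂ⟦X⟧]
    GrAlg (genFiltration (G : Matrix (Fin N) (Fin N) ℂ)),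
    ∀ x : twistedCurrent G, Θ (Env.ι x) =
      polySym (genFiltration _) (twistedLin G ε) (twistedLin_mem G ε) (x : current N) :=
  exists_envToGr _ (twistedLin G ε) (twistedLin_mem G ε) (twistedLin_smul G ε) (eigenSet G)
    (twistedLin_commutator_mem hε hG) (twistedCurrent G).incl fun x m ↦ x.2 m

lemma single_mem_twistedCurrent {m : ℕ+} {B : Matrix (Fin N) (Fin N) ℂ} (hB : B ∈ eigenSet G m) :
    current.single B m ∈ twistedCurrent G := by
  intro r
  change sigma G ((Polynomial.monomial (m : ℕ) B).coeff r) =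
    (-1 : ℂ) ^ r • (Polynomial.monomial (m : ℕ) B).coeff r
  rw [Polynomial.coeff_monomial]
  split_ifs with h
  · subst h
    exact hB
  · rw [map_zero, smul_zero]

-- The symbols of the `s_ij^(-m)` generate, as elements of degree `-∞` vanish in every graded
-- component; each symbol equals that of `twistedLin` at its leading matrix, which lies in the
-- eigenspace.
include hε hG in
lemma twistedLift_surjective {Θ : Env (twistedCurrent G) →ₐ[ℂ⟦X⟧]
    GrAlg (genFiltration (G : Matrix (Fin N) (Fin N) ℂ))}
    (hΘ : ∀ x : twistedCurrent G, Θ (Env.ι x) =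
      polySym (genFiltration _) (twistedLin G ε) (twistedLin_mem G ε) (x : current N)) :
    Function.Surjective Θ := by
  have h := GrAlg.adjoin_eq_top (F := genFiltration (G : Matrix (Fin N) (Fin N) ℂ))
    (fun g : Fin N × Fin N × ℕ ↦ sTw (G : Matrix (Fin N) (Fin N) ℂ) g.1 g.2.1 g.2.2)
    (fun g ↦ -(g.2.2 : ℤ) - 1) (genFiltration_mono _) (fun g ↦ sTw_mem _ _ _ _)
    (fun _ ↦ negInfinity _) (fun p ↦ negInfinity_le _ _) fun p ↦ le_rfl
  rw [← AlgHom.range_eq_top, eq_top_iff, ← h]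
  refine Algebra.adjoin_le ?_
  rintro _ ⟨⟨i, j, n⟩, rfl⟩
  obtain ⟨m, rfl⟩ : ∃ m : ℕ+, n = m.natPred := ⟨n.succPNat, by simp⟩
  have hB := leadMatrix_mem_eigenSet hG m (Matrix.single i j 1)
  refine ⟨Env.ι ⟨_, single_mem_twistedCurrent hB⟩, ?_⟩
  refine (hΘ _).trans ((polySym_monomial _ _ _ (m : ℕ) _).trans ?_)
  rw [homSym_pos]
  have h1 := linComb_sub_twistedLin_mem hε hG m (Matrix.single i j 1)
  rw [linComb_single] at h1
  have e : -(m.natPred : ℤ) - 1 = -((m : ℕ) : ℤ) := by rw [natPred_cast]; ring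
  have h2 := sTw_mem (G : Matrix (Fin N) (Fin N) ℂ) i j m.natPred
  rw [e] at h2
  refine Eq.trans ?_ (GrAlg.sym_congr e _ ⟨_, h2⟩ rfl).symm
  rw [eq_comm, ← sub_eq_zero, ← map_sub, GrAlg.sym_eq_zero]
  exact h1

lemma genFiltration_of_nonneg (G : Matrix (Fin N) (Fin N) ℂ) {p : ℤ} (hp : 0 ≤ p) :
    genFiltration G p = ⊤ := by
  have h := Algebra.adjoin_adjoin_coe_preimage (R := ℂ⟦X⟧) (s := {x | ∃ i j r, x = sMinus G i j r})
  have h' : Algebra.adjoin ℂ⟦X⟧ {x : TwistedDual G | ∃ i j r, TwistedDual.val G x = sMinus G i j r} =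
    ⊤ := h
  rw [eq_top_iff]
  rintro x -
  refine genFiltration_mono G hp ?_
  have hx : x ∈ Algebra.adjoin ℂ⟦X⟧
      {x : TwistedDual G | ∃ i j r, TwistedDual.val G x = sMinus G i j r} := by
    rw [h']; trivial
  induction hx using Algebra.adjoin_induction with
  | mem x hx =>
    obtain ⟨i, j, r, hx⟩ := hx
    have e : x = sTw G i j r.natPred := val_injective G (by rw [hx, val_sTw, sMinus])
    rw [e]
    exact genFiltration_mono G (by omega) (sTw_mem G i j r.natPred)
  | algebraMap r =>
    rw [Algebra.algebraMap_eq_smul_one]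
    exact Submodule.smul_mem _ _ (SetLike.one_mem_graded (genFiltration G))
  | add x y _ _ hx hy => exact add_mem hx hy
  | mul x y _ _ hx hy =>
    have := SetLike.mul_mem_graded hx hy
    rwa [add_zero] at this

lemma val_mem_degFiltration {G : Matrix (Fin N) (Fin N) ℂ} (p : ℤ) (x : TwistedDual G)
    (hx : x ∈ genFiltration G p) : TwistedDual.val G x ∈ degFiltration N p :=
  genFiltration_le G p hx

/-- The homomorphism of associated graded algebras induced by the inclusion of `Y⁺(g_N)`, for the
filtration defined by the generators. -/
def genMap (G : Matrix (Fin N) (Fin N) ℂ) :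
    GrAlg (genFiltration G) →ₐ[ℂ⟦X⟧] GrAlg (degFiltration N) :=
  GrAlg.map (TwistedDual.val G) val_mem_degFiltration

/-- Descent from degree `0`, where `genFiltration` is everything: if `x` of restricted degree `p`
lies in step `-k` of `genFiltration` with `p < -k`, its symbol there maps to zero in the larger
graded algebra, so it vanishes by injectivity and `x` lies in step `-k - 1`. -/
lemma genFiltration_eq_of_injective {G : Matrix (Fin N) (Fin N) ℂ}
    (hinj : Function.Injective (genMap G)) : genFiltration G = twistedFiltration G := by
  funext p
  refine le_antisymm (genFiltration_le G p) fun x hx ↦ ?_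
  rcases le_or_gt 0 p with hp | hp
  · rw [genFiltration_of_nonneg G hp]; trivial
  have key : ∀ k : ℕ, (k : ℤ) ≤ -p → x ∈ genFiltration G (-(k : ℤ)) := by
    intro k
    induction k with
    | zero => intro _; rw [genFiltration_of_nonneg G (by simp)]; trivial
    | succ k ih =>
      intro hk
      have h1 := ih (by omega)
      have h2 : genMap G (GrAlg.sym _ _ ⟨x, h1⟩) = 0 := by
        rw [genMap, GrAlg.map_sym, GrAlg.sym_eq_zero]
        exact degFiltration_mono N (by omega) hx
      have h3 := (GrAlg.sym_eq_zero _ _).1 (hinj (h2.trans (map_zero _).symm))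
      convert h3 using 2
      push_cast
      ring
  have := key (-p).toNat (by omega)
  rwa [show -((-p).toNat : ℤ) = p by omega] at this

/-- The filtration is a variable here so that the equality can be substituted; the type and the
algebra structure of the graded algebra depend on it. -/
lemma exists_equiv_of_eq {W : ℤ → Submodule ℂ⟦X⟧ (TwistedDual (G : Matrix (Fin N) (Fin N) ℂ))}
    [IsRingFiltration W (fun n ↦ W (n - 1))] (h : W = twistedFiltration _)
    (hW : ∀ p x, x ∈ W p → TwistedDual.val _ x ∈ degFiltration N p)
    (Θ : Env (twistedCurrent G) ≃ₐ[ℂ⟦X⟧] GrAlg W)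
    (hΘ : ∀ y, GrAlg.map (TwistedDual.val _) hW (Θ y) = currentLift N (envIncl G y)) :
    ∃ Θ' : Env (twistedCurrent G) ≃ₐ[ℂ⟦X⟧]
      GrAlg (twistedFiltration (G : Matrix (Fin N) (Fin N) ℂ)),
      ∀ y, GrAlg.map (F' := degFiltration N) (TwistedDual.val _) (fun _ _ h ↦ h) (Θ' y) =
        currentLift N (envIncl G y) := by
  subst h
  exact ⟨Θ, hΘ⟩

-- The composite of the surjection `Θ` with `genMap` is `currentLift ∘ envIncl`, by comparison of
-- leading terms on generators. Injectivity of the composite gives injectivity of `Θ`, and with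
-- surjectivity of `Θ` also that of `genMap`.
include hε hG in
lemma exists_twistedEquiv : ∃ Θ : Env (twistedCurrent G) ≃ₐ[ℂ⟦X⟧]
    GrAlg (twistedFiltration (G : Matrix (Fin N) (Fin N) ℂ)),
    ∀ y, GrAlg.map (F' := degFiltration N) (TwistedDual.val _) (fun _ _ h ↦ h) (Θ y) =
      currentLift N (envIncl G y) := by
  obtain ⟨Θ, hΘ⟩ := exists_twistedLift hε hG
  have h1 : ((genMap (G : Matrix (Fin N) (Fin N) ℂ)).comp Θ).toRingHom =
      ((currentLift N).comp (envIncl G)).toRingHom := by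
    refine Env.hom_ext (fun r ↦ ?_) fun x ↦ ?_
    · exact (AlgHom.commutes _ r).trans (AlgHom.commutes _ r).symm
    · change genMap _ (Θ (Env.ι x)) = currentLift N (envIncl G (Env.ι x))
      rw [hΘ, envIncl_ι]
      refine Eq.trans ?_ ((exists_currentLift N).choose_spec _).symm
      exact map_polySym _ _ _ _ fun m ↦ val_twistedLin_sub_mem hε hG (x.2 m)
  have h2 : ∀ y, genMap (G : Matrix (Fin N) (Fin N) ℂ) (Θ y) = currentLift N (envIncl G y) :=
    RingHom.congr_fun h1
  have h3 : Function.Injective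
      (genMap (G : Matrix (Fin N) (Fin N) ℂ) ∘ Θ) := by
    intro y y' h
    have h' : genMap _ (Θ y) = genMap _ (Θ y') := h
    rw [h2, h2] at h'
    exact envIncl_injective G (currentLift_injective h')
  have h4 := twistedLift_surjective hε hG hΘ
  refine exists_equiv_of_eq (genFiltration_eq_of_injective fun z z' h ↦ ?_)
    val_mem_degFiltration (AlgEquiv.ofBijective Θ ⟨h3.of_comp, h4⟩) h2
  obtain ⟨y, rfl⟩ := h4 z
  obtain ⟨y', rfl⟩ := h4 z'
  rw [h3 h]

end TwistedEquiv

end TwistedYangian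

end

open TwistedYangian

theorem proposition3p1 (N : ℕ) (hN : 2 ≤ N) (G : GL (Fin N) ℂ)
    (hG : (G : Matrix (Fin N) (Fin N) ℂ).transpose = G ∨
      (G : Matrix (Fin N) (Fin N) ℂ).transpose = -G) :
    ∃ Φ : Gr (degFiltration N) ≃ₐ[ℂ⟦X⟧] ℂ⟦X⟧ ⊗[ℂ] UniversalEnvelopingAlgebra ℂ (current N),
      (∀ (i j : Fin N) (r : ℕ+),
        Φ (symbol (degFiltration N) (-((r : ℕ) : ℤ)) ⟨tMinus i j r, tMinus_mem i j r⟩) =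
          1 ⊗ₜ UniversalEnvelopingAlgebra.ι ℂ (current.single (Matrix.single i j 1) r)) ∧
      ∃ Ψ : Gr (twistedFiltration (G : Matrix (Fin N) (Fin N) ℂ)) ≃ₐ[ℂ⟦X⟧]
          ℂ⟦X⟧ ⊗[ℂ] UniversalEnvelopingAlgebra ℂ (twistedCurrent G),
        ∀ (p : ℤ) (x : twistedFiltration (G : Matrix (Fin N) (Fin N) ℂ) p),
          envInclusion G (Ψ (symbol (twistedFiltration (G : Matrix (Fin N) (Fin N) ℂ)) p x)) =
            Φ (symbol (degFiltration N) p (filInclusion (G : Matrix (Fin N) (Fin N) ℂ) p x)) := by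
  obtain ⟨ε, hε, hG'⟩ : ∃ ε : ℤ, ε * ε = 1 ∧
      (G : Matrix (Fin N) (Fin N) ℂ).transpose = ε • (G : Matrix (Fin N) (Fin N) ℂ) := by
    rcases hG with h | h
    · exact ⟨1, rfl, by rw [h, one_smul]⟩
    · exact ⟨-1, rfl, by rw [h, neg_smul, one_smul]⟩
  obtain ⟨Θ, hΘ⟩ := exists_twistedEquiv hε hG'
  refine ⟨(currentEquiv N).symm, fun i j r ↦ ?_, Θ.symm, fun p x ↦ ?_⟩
  · refine (currentEquiv N).symm_apply_eq.2 ?_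
    refine Eq.trans ?_ (currentLift_single (Matrix.single i j 1) r).symm
    exact GrAlg.sym_congr (F := degFiltration N) rfl ⟨tMinus i j r, tMinus_mem i j r⟩ _
      (tLin_single r i j).symm
  -- As `Φ` is the inverse of `currentLift`, compatibility is the intertwining property of `Θ` at
  -- the preimage of the symbol.
  · refine ((currentEquiv N).symm_apply_eq.2 ?_).symm
    refine Eq.trans ?_ (hΘ (Θ.symm (GrAlg.sym _ p x)))
    rw [AlgEquiv.apply_symm_apply]
    exact (GrAlg.map_sym (F' := degFiltration N) (TwistedDual.val _) (fun _ _ h ↦ h) p x).symm
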